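/- **Setting.** Let $m\ge 0$, let $M=\mathbb R^3$ if $m>0$ and $M=\mathbb R^3\setminus\{0\}$ if $m=0$, and let $\omega(\mathbf k)=\sqrt{m^2+|\mathbf k|^2}$; the proper orthochronous Poincaré group $\mathrm{ISO}^+(3,1)$ acts on $M$ through the Lorentz action on the 4-momentum $(\omega(\mathbf k),\mathbf k)$. A *particle bundle of mass $m$* is a smooth Hermitian vector bundle $E\to M$ of finite rank with a smooth, fiberwise unitary action $\Sigma$ of $\mathrm{ISO}^+(3,1)$ by vector bundle isomorphisms $\Sigma_g:E(\mathbf k)\to E(g\mathbf k)$ covering this action, such that translations by $a=(a^0,\mathbf a)$ act on $E(\mathbf k)$ by the phase $e^{i(\omega a^0-\mathbf k\cdot\mathbf a)}$, and which is irreducible (it has no proper invariant subbundle of nonzero rank). On sections put $(\tilde\Sigma_g\psi)(\mathbf k)=\Sigma_g[\psi(g^{-1}\mathbf k)]$ and $\langle\psi,\zeta\rangle=\int_M\frac{d^3k}{\omega}\langle\psi(\mathbf k),\zeta(\mathbf k)\rangle$. On smooth sections define $H\psi=\omega\psi$, $P_a\psi=k_a\psi$, $\hat P_a=P_a/|\mathbf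 P|$, $J_a\psi=i\frac{d}{dt}\big|_{0}\tilde\Sigma_{R_a(t)}\psi$, $K_a\psi=-i\frac{d}{dt}\big|_{0}\tilde\Sigma_{\Lambda_a(t)}\psi$, where $R_a(t)$ and $\Lambda_a(t)$ are the rotation about, and the boost along, the $a$-th axis. A *connection* on $E$ is a map $(\mathbf X,\psi)\mapsto D_{\mathbf X}\psi$ from smooth vector fields and smooth sections to smooth sections, additive in both arguments, with $D_{f\mathbf X}\psi=fD_{\mathbf X}\psi$ and $D_{\mathbf X}(f\psi)=df(\mathbf X)\psi+fD_{\mathbf X}\psi$ for smooth $f:M\to\mathbb C$. Write $D_a=D_{\mathbf e_a}$. It is *anti-Hermitian* if the operators $Q_a=iD_a$ satisfy $\langle Q_a\psi,\zeta\rangle=\langle\psi,Q_a\zeta\rangle$ for all smooth square-integrable $\psi,\zeta$ with $Q_a\psi,Q_a\zeta$ square-integrable, and *rotationally symmetric* if $D_{R\mathbf X}=\tilde\Sigma_RD_{\mathbf X}\tilde\Sigma_{R^{-1}}$ for all $R\in\mathrm{SO}(3)$ and all smooth $\mathbf X$, where $(R\mathbf X)(\mathbf k)=R\,\mathbf X(R^{-1}\mathbf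 k)$. The splitting $\mathbf J=\mathbf L^{D}+\mathbf S^{D}$ induced by $D$ is $\mathbf L^{D}=-i\,\mathbf k\times D$, that is $L^{D}_a=-iD_{\mathbf e_a\times\mathbf k}$, and $\mathbf S^{D}=\mathbf J-\mathbf L^{D}$. **Theorem 5 (Boost connection).** Let $E$ be a particle bundle of mass $m\ge0$. Then $$D^K=-\tfrac i2\big(H^{-1}\mathbf K+\mathbf K H^{-1}\big)=-iH^{-1}\big(\mathbf K-\tfrac{i}{2}H^{-1}\mathbf P\big),\qquad D^K_{\mathbf X}=\sum_a X^aD^K_a,$$ is an anti-Hermitian, rotationally symmetric connection on $E$. If $m=0$, the splitting of $\mathbf J$ that it induces is $$\mathbf L^K=\mathbf J_\perp=-H^{-1}\,\mathbf P\times\mathbf K,\qquad \mathbf S^K=\mathbf J_\parallel=(\hat{\mathbf P}\cdot\mathbf J)\hat{\mathbf P}.$$ Both are vector operators ($[A_a,J_b]=i\epsilon_{abc}A_c$ for $\mathbf A=\mathbf L^K$ and $\mathbf A=\mathbf S^K$), and if the helicity operator $\hat{\mathbf P}\cdot\mathbf J$ is not zero, neither satisfies the angular momentum commutation relations $[A_a,A_b]=i\epsilon_{abc}A_c$.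 -/

import Mathlib

open scoped Manifold ContDiff Matrix

namespace Particle

/-! ## The restricted Lorentz group and the Poincaré group -/

/-- Space-time indices: one time index and three space indices. -/
abbrev Idx : Type := Unit ⊕ Fin 3

/-- The Minkowski metric `diag(-1, 1, 1, 1)`. -/
def minkowski : Matrix Idx Idx ℝ := Matrix.diagonal (Sum.elim (fun _ => -1) (fun _ => 1))

theorem minkowski_mul_self : minkowski * minkowski = 1 := by
  unfold minkowski
  rw [Matrix.diagonal_mul_diagonal, ← Matrix.diagonal_one]
  congr 1
  ext i
  rcases i with i | i <;> simp

theorem minkowski_quad (q : Idx → ℝ) :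
    q ⬝ᵥ (minkowski *ᵥ q) = (∑ b, q (Sum.inr b) ^ 2) - q (Sum.inl ()) ^ 2 := by
  unfold minkowski
  simp only [dotProduct, Matrix.mulVec_diagonal, Fintype.sum_sum_type, Finset.univ_unique,
    Finset.sum_singleton, Sum.elim_inl, Sum.elim_inr, Fin.sum_univ_three]
  simp only [PUnit.default_eq_unit]
  ring

theorem mul_minkowski_transpose {Λ : Matrix Idx Idx ℝ} (h : Λᵀ * minkowski * Λ = minkowski) :
    Λ * minkowski * Λᵀ = minkowski := by
  have h1 : (minkowski * Λᵀ * minkowski) * Λ = 1 := by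
    rw [Matrix.mul_assoc minkowski, Matrix.mul_assoc minkowski, h, minkowski_mul_self]
  have h2 := mul_eq_one_comm.mp h1
  calc Λ * minkowski * Λᵀ = (Λ * (minkowski * Λᵀ * minkowski)) * minkowski := by
        simp only [Matrix.mul_assoc, minkowski_mul_self, Matrix.mul_one]
    _ = minkowski := by rw [h2, Matrix.one_mul]

theorem lorentz_quad {Λ : Matrix Idx Idx ℝ} (h : Λᵀ * minkowski * Λ = minkowski)
    (q : Idx → ℝ) : (∑ b, (Λ *ᵥ q) (Sum.inr b) ^ 2) - (Λ *ᵥ q) (Sum.inl ()) ^ 2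
      = (∑ b, q (Sum.inr b) ^ 2) - q (Sum.inl ()) ^ 2 := by
  rw [← minkowski_quad, ← minkowski_quad, ← h, Matrix.dotProduct_mulVec q,
    ← Matrix.vecMul_vecMul, ← Matrix.vecMul_vecMul, Matrix.vecMul_transpose,
    ← Matrix.dotProduct_mulVec, h, Matrix.dotProduct_mulVec]

theorem lorentz_row {Λ : Matrix Idx Idx ℝ} (h : Λᵀ * minkowski * Λ = minkowski) :
    (∑ b, Λ (Sum.inl ()) (Sum.inr b) ^ 2) = Λ (Sum.inl ()) (Sum.inl ()) ^ 2 - 1 := by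
  have h' : (Λᵀ)ᵀ * minkowski * Λᵀ = minkowski := by
    rw [Matrix.transpose_transpose]; exact mul_minkowski_transpose h
  have := lorentz_quad h' (Pi.single (Sum.inl ()) 1)
  rw [Matrix.mulVec_single_one] at this
  simp [Matrix.col_apply, Matrix.transpose_apply] at this
  linarith

/-- Lorentz transformations with positive time-time entry preserve the forward cone. -/
theorem time_pos {Λ : Matrix Idx Idx ℝ} (h : Λᵀ * minkowski * Λ = minkowski)
    (h0 : 0 < Λ (Sum.inl ()) (Sum.inl ())) {q : Idx → ℝ} (hq0 : 0 < q (Sum.inl ()))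
    (hq : (∑ b, q (Sum.inr b) ^ 2) ≤ q (Sum.inl ()) ^ 2) : 0 < (Λ *ᵥ q) (Sum.inl ()) := by
  have hr := lorentz_row h
  have hcs := Finset.sum_mul_sq_le_sq_mul_sq Finset.univ
    (fun b : Fin 3 => Λ (Sum.inl ()) (Sum.inr b)) (fun b => q (Sum.inr b))
  rw [hr] at hcs
  have he : (Λ *ᵥ q) (Sum.inl ()) = Λ (Sum.inl ()) (Sum.inl ()) * q (Sum.inl ())
      + ∑ b : Fin 3, Λ (Sum.inl ()) (Sum.inr b) * q (Sum.inr b) := by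
    simp [Matrix.mulVec, dotProduct, Fintype.sum_sum_type]
  have hrow : 0 ≤ Λ (Sum.inl ()) (Sum.inl ()) ^ 2 - 1 := by
    rw [← hr]; positivity
  have hlt : (∑ b : Fin 3, Λ (Sum.inl ()) (Sum.inr b) * q (Sum.inr b)) ^ 2
      < (Λ (Sum.inl ()) (Sum.inl ()) * q (Sum.inl ())) ^ 2 := by
    have := mul_le_mul_of_nonneg_left hq hrow
    nlinarith [pow_pos hq0 2]
  have habs := abs_lt_of_sq_lt_sq hlt (by positivity)
  rw [he]
  linarith [(abs_lt.mp habs).1]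

/-- The restricted (proper orthochronous) Lorentz group `SO⁺(3,1)`. -/
def Lorentz : Subgroup (Matrix.SpecialLinearGroup Idx ℝ) where
  carrier := {Λ | (Λ.1)ᵀ * minkowski * Λ.1 = minkowski ∧ 0 < Λ.1 (Sum.inl ()) (Sum.inl ())}
  one_mem' := by simp
  mul_mem' := by
    rintro A B ⟨hA, hA0⟩ ⟨hB, hB0⟩
    refine ⟨?_, ?_⟩
    · rw [Matrix.SpecialLinearGroup.coe_mul, Matrix.transpose_mul]
      calc B.1ᵀ * A.1ᵀ * minkowski * (A.1 * B.1) = B.1ᵀ * (A.1ᵀ * minkowski * A.1) * B.1 := by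
            simp only [Matrix.mul_assoc]
        _ = minkowski := by rw [hA, hB]
    · have hq := lorentz_quad hB (Pi.single (Sum.inl ()) 1)
      have := time_pos hA hA0 (q := B.1 *ᵥ Pi.single (Sum.inl ()) 1) (by simpa using hB0)
        (by simp at hq ⊢; linarith)
      rw [Matrix.mulVec_mulVec] at this
      simpa using this
  inv_mem' := by
    rintro A ⟨hA, hA0⟩
    have hinv : (A⁻¹).1 = minkowski * A.1ᵀ * minkowski := by
      have h1 : (minkowski * A.1ᵀ * minkowski) * A.1 = 1 := by
        rw [Matrix.mul_assoc minkowski, Matrix.mul_assoc minkowski, hA, minkowski_mul_self]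
      have h2 : A.1 * (A⁻¹).1 = 1 := by
        rw [← Matrix.SpecialLinearGroup.coe_mul]; simp
      calc (A⁻¹).1 = (minkowski * A.1ᵀ * minkowski * A.1) * (A⁻¹).1 := by rw [h1, Matrix.one_mul]
        _ = minkowski * A.1ᵀ * minkowski := by rw [Matrix.mul_assoc, h2, Matrix.mul_one]
    refine ⟨?_, ?_⟩
    · rw [hinv]
      have ht : minkowskiᵀ = minkowski := by simp [minkowski]
      simp only [Matrix.transpose_mul, Matrix.transpose_transpose, ht]
      calc minkowski * (A.1 * minkowski) * minkowski * (minkowski * A.1ᵀ * minkowski)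
          = minkowski * (A.1 * minkowski * (minkowski * minkowski) * A.1ᵀ) * minkowski := by
            simp only [Matrix.mul_assoc]
        _ = minkowski := by
            rw [minkowski_mul_self, Matrix.mul_one, mul_minkowski_transpose hA,
              minkowski_mul_self, Matrix.one_mul]
    · rw [hinv]
      simpa [minkowski, Matrix.mul_diagonal, Matrix.diagonal_mul] using hA0

/-- The (proper orthochronous) Poincaré group `ISO⁺(3,1)`: the element `⟨a, Λ⟩` is the
transformation `x ↦ Λ x + a` of space-time. -/
@[ext] structure Poincare where
  trans : Idx → ℝ
  lor : Lorentz

/-- The matrix of the Lorentz part. -/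
def Poincare.mat (g : Poincare) : Matrix Idx Idx ℝ := g.lor.1.1

instance : Group Poincare where
  mul g h := ⟨g.trans + g.mat *ᵥ h.trans, g.lor * h.lor⟩
  one := ⟨0, 1⟩
  inv g := ⟨-(g.lor⁻¹.1.1 *ᵥ g.trans), g.lor⁻¹⟩
  mul_assoc a b c := by
    refine Poincare.ext ?_ (mul_assoc _ _ _)
    change a.trans + a.mat *ᵥ b.trans + (a.lor * b.lor).1.1 *ᵥ c.trans
      = a.trans + a.mat *ᵥ (b.trans + b.mat *ᵥ c.trans)
    rw [Matrix.mulVec_add, Matrix.mulVec_mulVec, add_assoc]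
    rfl
  one_mul a := by
    refine Poincare.ext ?_ (one_mul _)
    change 0 + (1 : Matrix Idx Idx ℝ) *ᵥ a.trans = a.trans
    simp
  mul_one a := by
    refine Poincare.ext ?_ (mul_one _)
    change a.trans + a.mat *ᵥ 0 = a.trans
    simp
  inv_mul_cancel a := by
    refine Poincare.ext ?_ (inv_mul_cancel _)
    change -(a.lor⁻¹.1.1 *ᵥ a.trans) + a.lor⁻¹.1.1 *ᵥ a.trans = 0
    simp

theorem Poincare.mat_one : (1 : Poincare).mat = 1 := rfl

theorem Poincare.mat_mul (g h : Poincare) : (g * h).mat = g.mat * h.mat := rfl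

/-- The pure translation by the 4-vector `a`. -/
def translation (a : Idx → ℝ) : Poincare := ⟨a, 1⟩

/-- The inclusion of the spatial rotations `SO(3)` in the Poincaré group. -/
def rotation (R : Matrix.specialOrthogonalGroup (Fin 3) ℝ) : Poincare where
  trans := 0
  lor := ⟨⟨Matrix.fromBlocks 1 0 0 R.1, by
      rw [Matrix.det_fromBlocks_zero₂₁, Matrix.det_one, one_mul]
      exact (Matrix.mem_specialOrthogonalGroup_iff.mp R.2).2⟩, by
    have hR := (Matrix.mem_orthogonalGroup_iff' (Fin 3) ℝ).mp (Matrix.mem_specialOrthogonalGroup_iff.mp R.2).1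
    have hη : minkowski = Matrix.fromBlocks (-1) 0 0 1 := by
      ext i j
      rcases i with i | i <;> rcases j with j | j <;>
        simp [minkowski, Matrix.diagonal_apply, Matrix.one_apply]
    refine ⟨?_, by simp⟩
    rw [hη]
    simp only [Matrix.fromBlocks_transpose, Matrix.fromBlocks_multiply]
    simp
    exact hR⟩

/-- The rotation matrix by the angle `t` about the `a`-th coordinate axis (right-handed). -/
noncomputable def axisRotationMatrix (a : Fin 3) (t : ℝ) : Matrix (Fin 3) (Fin 3) ℝ :=
  ![!![1, 0, 0; 0, Real.cos t, -Real.sin t; 0, Real.sin t, Real.cos t],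
    !![Real.cos t, 0, Real.sin t; 0, 1, 0; -Real.sin t, 0, Real.cos t],
    !![Real.cos t, -Real.sin t, 0; Real.sin t, Real.cos t, 0; 0, 0, 1]] a

/-- The rotation `R_a(t)` as an element of `SO(3)`. -/
noncomputable def axisRotation (a : Fin 3) (t : ℝ) : Matrix.specialOrthogonalGroup (Fin 3) ℝ :=
  ⟨axisRotationMatrix a t, by
    have h := Real.cos_sq_add_sin_sq t
    rw [Matrix.mem_specialOrthogonalGroup_iff, Matrix.mem_orthogonalGroup_iff]
    constructor
    · fin_cases a <;> ext i j <;> fin_cases i <;> fin_cases j <;>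
        simp [axisRotationMatrix, Matrix.mul_apply, Fin.sum_univ_three] <;> linarith
    · fin_cases a <;> simp [axisRotationMatrix, Matrix.det_fin_three] <;> linarith⟩

/-- The matrix of the boost in the direction of the `a`-th coordinate axis with rapidity `t`
(velocity `tanh t`). -/
noncomputable def boostMatrix (a : Fin 3) (t : ℝ) : Matrix Idx Idx ℝ :=
  Matrix.fromBlocks (Matrix.of fun _ _ => Real.cosh t)
    (Matrix.of fun _ j => if j = a then Real.sinh t else 0)
    (Matrix.of fun i _ => if i = a then Real.sinh t else 0)
    (Matrix.diagonal fun i => if i = a then Real.cosh t else 1)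

theorem boostMatrix_mul (a : Fin 3) (s t : ℝ) :
    boostMatrix a s * boostMatrix a t = boostMatrix a (s + t) := by
  ext i j
  rcases i with i | i <;> rcases j with j | j <;> fin_cases a <;> (try fin_cases i) <;>
    (try fin_cases j) <;>
    simp [boostMatrix, Matrix.mul_apply, Fintype.sum_sum_type, Fin.sum_univ_three, Real.cosh_add,
      Real.sinh_add] <;> ring

theorem boostMatrix_lorentz (a : Fin 3) (t : ℝ) :
    (boostMatrix a t)ᵀ * minkowski * boostMatrix a t = minkowski := by
  have h := Real.cosh_sq t
  ext i j
  rcases i with i | i <;> rcases j with j | j <;> fin_cases a <;> (try fin_cases i) <;>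
    (try fin_cases j) <;>
    simp [boostMatrix, minkowski, Matrix.mul_apply, Fintype.sum_sum_type,
      Fin.sum_univ_three] <;> nlinarith

/-- The boost `Λ_a(t)` as an element of the Poincaré group. It is parametrized by rapidity; the
velocity is `tanh t`, so generators computed with either parameter coincide. -/
noncomputable def boost (a : Fin 3) (t : ℝ) : Poincare where
  trans := 0
  lor := ⟨⟨boostMatrix a t, by
      have h1 : (boostMatrix a t).det = (boostMatrix a (t / 2)).det ^ 2 := by
        rw [sq, ← Matrix.det_mul, boostMatrix_mul, add_halves]
      have h2 : ∀ s, (boostMatrix a s).det ^ 2 = 1 := by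
        intro s
        have h := congrArg Matrix.det (boostMatrix_lorentz a s)
        have hη : minkowski.det = -1 := by
          simp [minkowski, Matrix.det_diagonal, Fintype.prod_sum_type]
        rw [Matrix.det_mul, Matrix.det_mul, Matrix.det_transpose, hη] at h
        linarith
      rw [h1, h2]⟩,
    boostMatrix_lorentz a t, by simpa [boostMatrix] using Real.cosh_pos t⟩

/-! ## Momentum space -/

/-- Three-dimensional Euclidean space. -/
abbrev E3 : Type := EuclideanSpace ℝ (Fin 3)

/-- The manifold of momenta of particles of mass `m`, parametrized by the spatial momentum `k`:
all of `ℝ³` for `m ≠ 0` (the mass hyperboloid) and `ℝ³ ∖ {0}` for `m = 0` (the light cone). -/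
def momentumSpace (m : ℝ) : TopologicalSpace.Opens E3 where
  carrier := {k | m ≠ 0 ∨ k ≠ 0}
  is_open' := by
    by_cases hm : m = 0
    · have h : {k : E3 | m ≠ 0 ∨ k ≠ 0} = {0}ᶜ := by ext k; simp [hm]
      rw [h]
      exact isOpen_compl_singleton
    · simp [hm]

/-- The energy `ω(k) = √(m² + |k|²)`. -/
noncomputable def energy {m : ℝ} (k : momentumSpace m) : ℝ := Real.sqrt (m ^ 2 + ‖k.1‖ ^ 2)

/-- The 4-momentum `(ω, k)`. -/
noncomputable def fourMomentum {m : ℝ} (k : momentumSpace m) : Idx → ℝ :=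
  Sum.elim (fun _ => energy k) (fun b => k.1 b)

theorem energy_sq {m : ℝ} (k : momentumSpace m) : energy k ^ 2 = m ^ 2 + ∑ b, k.1 b ^ 2 := by
  unfold energy
  rw [Real.sq_sqrt (by positivity), EuclideanSpace.real_norm_sq_eq]

theorem energy_pos {m : ℝ} (k : momentumSpace m) : 0 < energy k := by
  refine Real.sqrt_pos.mpr ?_
  rcases k.2 with h | h
  · positivity
  · have := norm_pos_iff.mpr h
    positivity

theorem fourMomentum_time_pos {m : ℝ} (g : Poincare) (k : momentumSpace m) :
    0 < (g.mat *ᵥ fourMomentum k) (Sum.inl ()) := by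
  refine time_pos g.lor.2.1 g.lor.2.2 (energy_pos k) ?_
  simp only [fourMomentum, Sum.elim_inl, Sum.elim_inr, energy_sq]
  nlinarith [sq_nonneg m]

theorem fourMomentum_shell {m : ℝ} (g : Poincare) (k : momentumSpace m) :
    (g.mat *ᵥ fourMomentum k) (Sum.inl ()) ^ 2
      = m ^ 2 + ∑ b, (g.mat *ᵥ fourMomentum k) (Sum.inr b) ^ 2 := by
  have h := lorentz_quad g.lor.2.1 (fourMomentum k)
  simp only [fourMomentum, Sum.elim_inl, Sum.elim_inr, energy_sq] at h
  unfold Poincare.mat fourMomentum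
  linarith

/-- The action of the Poincaré group on momenta: `k ↦ Λ k` on 4-momenta. -/
noncomputable def actMomentum {m : ℝ} (g : Poincare) (k : momentumSpace m) : momentumSpace m :=
  ⟨WithLp.toLp 2 fun b => (g.mat *ᵥ fourMomentum k) (Sum.inr b), by
    by_contra hcon
    change ¬ (m ≠ 0 ∨ _) at hcon
    push Not at hcon
    obtain ⟨hm, h0⟩ := hcon
    have hz : ∀ b, (g.mat *ᵥ fourMomentum k) (Sum.inr b) = 0 := fun b => congrArg (fun v : E3 => v b) h0
    have h1 := fourMomentum_shell g k
    have h2 := fourMomentum_time_pos g k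
    simp only [hz, hm] at h1
    simp at h1
    exact h2.ne' h1⟩

theorem fourMomentum_act {m : ℝ} (g : Poincare) (k : momentumSpace m) :
    fourMomentum (actMomentum g k) = g.mat *ᵥ fourMomentum k := by
  ext i
  rcases i with i | i
  · have h1 : energy (actMomentum g k) ^ 2 = (g.mat *ᵥ fourMomentum k) (Sum.inl ()) ^ 2 := by
      rw [energy_sq, fourMomentum_shell]; rfl
    exact (sq_eq_sq₀ (energy_pos _).le (fourMomentum_time_pos g k).le).mp h1
  · rfl

theorem fourMomentum_injective {m : ℝ} :
    Function.Injective (fourMomentum : momentumSpace m → Idx → ℝ) := by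
  intro k l h
  refine Subtype.ext (PiLp.ext fun b => ?_)
  exact congrFun h (Sum.inr b)

noncomputable instance (m : ℝ) : MulAction Poincare (momentumSpace m) where
  smul := actMomentum
  one_smul k := fourMomentum_injective (by
    change fourMomentum (actMomentum 1 k) = _
    rw [fourMomentum_act, Poincare.mat_one, Matrix.one_mulVec])
  mul_smul g h k := fourMomentum_injective (by
    change fourMomentum (actMomentum (g * h) k) = fourMomentum (actMomentum g (actMomentum h k))
    rw [fourMomentum_act, fourMomentum_act, fourMomentum_act, Poincare.mat_mul,
      Matrix.mulVec_mulVec])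

/-! ## Hermitian vector bundles over momentum space and their sections -/

/-- The model fiber of a complex vector bundle of rank `r`. -/
abbrev Fiber (r : ℕ) : Type := EuclideanSpace ℂ (Fin r)

/-- A scalar function `f : M → ℂ` on momentum space is smooth. -/
def SmoothFun {m : ℝ} (f : momentumSpace m → ℂ) : Prop :=
  ContMDiff 𝓘(ℝ, E3) 𝓘(ℝ, ℂ) ∞ f

/-- The partial derivative of `f` in the direction of the `a`-th coordinate axis. -/
noncomputable def partialDeriv {m : ℝ} (a : Fin 3) (f : momentumSpace m → ℂ)
    (k : momentumSpace m) : ℂ :=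
  (mfderiv 𝓘(ℝ, E3) 𝓘(ℝ, ℂ) f k : E3 →L[ℝ] ℂ) (EuclideanSpace.single a 1)

/-- Vector fields on momentum space, given by their Cartesian components, `X(k) = X^a(k) e_a`.
The components may be complex, so that `f X` is a vector field for every `f : M → ℂ`; the usual
(real) vector fields are those with real components. -/
abbrev VField (m : ℝ) : Type := momentumSpace m → Fin 3 → ℂ

/-- The vector field is smooth. -/
def VField.Smooth {m : ℝ} (X : VField m) : Prop := ∀ a, SmoothFun fun k => X k a

/-- The constant vector field `e_a`. -/
def constField {m : ℝ} (a : Fin 3) : VField m := fun _ => Pi.single a 1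

/-- The vector field `k ↦ k`. -/
def radialField {m : ℝ} : VField m := fun k b => (k.1 b : ℂ)

/-- The cross product `X × Y` of vector fields. -/
def VField.cross {m : ℝ} (X Y : VField m) : VField m := fun k => crossProduct (X k) (Y k)

/-- The function `df(X)`. -/
noncomputable def dAlong {m : ℝ} (f : momentumSpace m → ℂ) (X : VField m) :
    momentumSpace m → ℂ :=
  fun k => ∑ a, X k a * partialDeriv a f k

/-- The rotated vector field `(R X)(k) = R (X (R⁻¹ k))`. -/
noncomputable def VField.rotate {m : ℝ} (R : Matrix.specialOrthogonalGroup (Fin 3) ℝ)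
    (X : VField m) : VField m :=
  fun k => (R.1.map Complex.ofReal) *ᵥ X ((rotation R)⁻¹ • k)

section Bundle

open Bundle

variable {m : ℝ} {r : ℕ} {E : momentumSpace m → Type*} [TopologicalSpace (TotalSpace (Fiber r) E)]
  [∀ k, NormedAddCommGroup (E k)] [∀ k, InnerProductSpace ℂ (E k)]
  [FiberBundle (Fiber r) E]

/-- A section `k ↦ ψ(k) ∈ E(k)` is smooth on the set `U`. -/
def SmoothSectionOn (r : ℕ) {E : momentumSpace m → Type*}
    [TopologicalSpace (TotalSpace (Fiber r) E)] [∀ k, NormedAddCommGroup (E k)]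
    [∀ k, InnerProductSpace ℂ (E k)] [FiberBundle (Fiber r) E]
    (ψ : ∀ k, E k) (U : Set (momentumSpace m)) : Prop :=
  ContMDiffOn 𝓘(ℝ, E3) (𝓘(ℝ, E3).prod 𝓘(ℝ, Fiber r)) ∞
    (fun k => TotalSpace.mk' (Fiber r) k (ψ k)) U

/-- A smooth section (wave function). -/
def SmoothSection (r : ℕ) {E : momentumSpace m → Type*}
    [TopologicalSpace (TotalSpace (Fiber r) E)] [∀ k, NormedAddCommGroup (E k)]
    [∀ k, InnerProductSpace ℂ (E k)] [FiberBundle (Fiber r) E] (ψ : ∀ k, E k) : Prop :=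
  ContMDiff 𝓘(ℝ, E3) (𝓘(ℝ, E3).prod 𝓘(ℝ, Fiber r)) ∞
    (fun k => TotalSpace.mk' (Fiber r) k (ψ k))

/-- Lebesgue measure `d³k` on momentum space. -/
noncomputable def d3k (m : ℝ) : MeasureTheory.Measure (momentumSpace m) :=
  MeasureTheory.volume.comap Subtype.val

/-- The inner product `⟨ψ, ζ⟩ = ∫ d³k/ω ⟨ψ(k), ζ(k)⟩` of wave functions. -/
noncomputable def secInner {E : momentumSpace m → Type*} [∀ k, NormedAddCommGroup (E k)]
    [∀ k, InnerProductSpace ℂ (E k)] (ψ ζ : ∀ k, E k) : ℂ :=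
  ∫ k : momentumSpace m, ((energy k)⁻¹ : ℂ) * inner ℂ (ψ k) (ζ k) ∂(d3k m)

/-- Square integrability of a (smooth) section with respect to `d³k/ω`. -/
def SquareIntegrable {E : momentumSpace m → Type*} [∀ k, NormedAddCommGroup (E k)]
    (ψ : ∀ k, E k) : Prop :=
  MeasureTheory.Integrable (fun k : momentumSpace m => (energy k)⁻¹ * ‖ψ k‖ ^ 2) (d3k m)

/-- A family of subspaces `W(k) ⊆ E(k)` is a (smooth) subbundle: locally it is spanned by a smooth
frame. -/
def IsSubbundle (r : ℕ) {E : momentumSpace m → Type*}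
    [TopologicalSpace (TotalSpace (Fiber r) E)] [∀ k, NormedAddCommGroup (E k)]
    [∀ k, InnerProductSpace ℂ (E k)] [FiberBundle (Fiber r) E]
    (W : ∀ k, Submodule ℂ (E k)) : Prop :=
  ∀ k₀, ∃ U : Set (momentumSpace m), IsOpen U ∧ k₀ ∈ U ∧ ∃ (d : ℕ) (s : Fin d → ∀ k, E k),
    (∀ i, SmoothSectionOn r (s i) U) ∧
    ∀ k ∈ U, LinearIndependent ℂ (fun i => s i k) ∧
      Submodule.span ℂ (Set.range fun i => s i k) = W k

/-- A family `g(t)` of Poincaré transformations with parameters `t ∈ ℝⁿ` is smooth. -/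
def SmoothFamily {n : ℕ} (g : EuclideanSpace ℝ (Fin n) → Poincare) : Prop :=
  (∀ i, ContDiff ℝ ∞ fun t => (g t).trans i) ∧ ∀ i j, ContDiff ℝ ∞ fun t => (g t).mat i j

/-- The structure of a particle bundle of mass `m` on a smooth complex vector bundle `E` of
rank `r` over momentum space, with an inner product on each fiber: the inner product depends
smoothly on the base point (so that `E` is a Hermitian vector bundle), and there is given a smooth,
unitary, irreducible action `Σ` of the Poincaré group on
`E` by vector bundle isomorphisms covering the action on momenta, such that the elements of `E(k)`
have 4-momentum `k`. The map `Σ_g : E(k) → E(g k)` is `act g h`, where `h : g • k = k'`. -/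
structure ParticleBundle (m : ℝ) (r : ℕ) (E : momentumSpace m → Type*)
    [TopologicalSpace (TotalSpace (Fiber r) E)] [∀ k, NormedAddCommGroup (E k)]
    [∀ k, InnerProductSpace ℂ (E k)] [FiberBundle (Fiber r) E] where
  smooth_inner : ∀ (U : Set (momentumSpace m)) (ψ ζ : ∀ k, E k), IsOpen U →
    SmoothSectionOn r ψ U → SmoothSectionOn r ζ U →
    ContMDiffOn 𝓘(ℝ, E3) 𝓘(ℝ, ℂ) ∞ (fun k => inner ℂ (ψ k) (ζ k)) U
  act : ∀ (g : Poincare) {k k' : momentumSpace m}, g • k = k' → (E k ≃ₗᵢ[ℂ] E k')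
  act_one : ∀ {k : momentumSpace m} (h : (1 : Poincare) • k = k) (v : E k), act 1 h v = v
  act_mul : ∀ (g₁ g₂ : Poincare) {k k' k'' : momentumSpace m} (h₂ : g₂ • k = k')
    (h₁ : g₁ • k' = k'') (h : (g₁ * g₂) • k = k'') (v : E k),
    act (g₁ * g₂) h v = act g₁ h₁ (act g₂ h₂ v)
  /-- Translations act on states of momentum `k` by the phase `exp(i (ω a⁰ - k · a))`. -/
  act_translation : ∀ (a : Idx → ℝ) {k : momentumSpace m} (h : translation a • k = k) (v : E k),
    act (translation a) h v =
      Complex.exp (Complex.I *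
        ((energy k * a (Sum.inl ()) - ∑ b, k.1 b * a (Sum.inr b) : ℝ) : ℂ)) • v
  /-- The action is smooth: so is its composition with every smooth family of transformations. -/
  smooth_act : ∀ (n : ℕ) (g : EuclideanSpace ℝ (Fin n) → Poincare), SmoothFamily g →
    ContMDiff (𝓘(ℝ, EuclideanSpace ℝ (Fin n)).prod (𝓘(ℝ, E3).prod 𝓘(ℝ, Fiber r)))
      (𝓘(ℝ, E3).prod 𝓘(ℝ, Fiber r)) ∞
      (fun p : EuclideanSpace ℝ (Fin n) × TotalSpace (Fiber r) E =>
        TotalSpace.mk' (Fiber r) (g p.1 • p.2.1) (act (g p.1) rfl p.2.2))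
  /-- There are no proper invariant subbundles of nonzero rank. -/
  irreducible : ∀ W : ∀ k, Submodule ℂ (E k), IsSubbundle r W →
    (∀ (g : Poincare) {k k' : momentumSpace m} (h : g • k = k'), ∀ v ∈ W k, act g h v ∈ W k') →
    (∀ k, W k = ⊥) ∨ (∀ k, W k = ⊤)

/-! ## Generators -/

/-- Operators on sections of `E`. -/
abbrev Op {m : ℝ} (E : momentumSpace m → Type*) : Type _ := (∀ k, E k) → (∀ k, E k)

namespace ParticleBundle

variable (S : ParticleBundle m r E)

/-- The representation on wave functions, `(Σ̃_g ψ)(k) = Σ_g [ψ(g⁻¹ k)]`. -/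
noncomputable def rep (g : Poincare) : Op E :=
  fun ψ k => S.act g (smul_inv_smul g k) (ψ (g⁻¹ • k))

/-- The angular momentum operators `J_a ψ = i d/dt Σ̃(R_a(t)) ψ` at `t = 0`. -/
noncomputable def J (a : Fin 3) : Op E :=
  fun ψ k => Complex.I • deriv (fun t : ℝ => S.rep (rotation (axisRotation a t)) ψ k) 0

/-- The boost operators `K_a ψ = -i d/dt Σ̃(Λ_a(t)) ψ` at `t = 0`. -/
noncomputable def K (a : Fin 3) : Op E :=
  fun ψ k => -Complex.I • deriv (fun t : ℝ => S.rep (boost a t) ψ k) 0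

end ParticleBundle

/-- The momentum operators `(P_a ψ)(k) = k_a ψ(k)`. -/
noncomputable def opP {m : ℝ} {E : momentumSpace m → Type*} [∀ k, NormedAddCommGroup (E k)]
    [∀ k, InnerProductSpace ℂ (E k)] (a : Fin 3) : Op E :=
  fun ψ k => (k.1 a : ℂ) • ψ k

/-- The operators `P̂_a = P_a / |P|`. -/
noncomputable def opPhat {m : ℝ} {E : momentumSpace m → Type*} [∀ k, NormedAddCommGroup (E k)]
    [∀ k, InnerProductSpace ℂ (E k)] (a : Fin 3) : Op E :=
  fun ψ k => ((k.1 a / ‖k.1‖ : ℝ) : ℂ) • ψ k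

/-- The Hamiltonian `(H ψ)(k) = ω(k) ψ(k)`. -/
noncomputable def opH {m : ℝ} {E : momentumSpace m → Type*} [∀ k, NormedAddCommGroup (E k)]
    [∀ k, InnerProductSpace ℂ (E k)] : Op E :=
  fun ψ k => (energy k : ℂ) • ψ k

/-- The inverse `H⁻¹` of the Hamiltonian. -/
noncomputable def opHinv {m : ℝ} {E : momentumSpace m → Type*} [∀ k, NormedAddCommGroup (E k)]
    [∀ k, InnerProductSpace ℂ (E k)] : Op E :=
  fun ψ k => ((energy k)⁻¹ : ℂ) • ψ k

theorem opHinv_opH {m : ℝ} {E : momentumSpace m → Type*} [∀ k, NormedAddCommGroup (E k)]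
    [∀ k, InnerProductSpace ℂ (E k)] (ψ : ∀ k, E k) :
    opHinv (opH ψ) = ψ ∧ opH (opHinv ψ) = ψ := by
  have h : ∀ k : momentumSpace m, (energy k : ℂ) ≠ 0 := fun k =>
    Complex.ofReal_ne_zero.mpr (energy_pos k).ne'
  constructor <;> funext k <;> simp only [opH, opHinv, smul_smul] <;>
    simp [h k]

/-- The Levi-Civita symbol `ε_{abc}`, the `c`-th component of `e_a × e_b`. -/
def eps (a b c : Fin 3) : ℂ := crossProduct (Pi.single a (1 : ℂ)) (Pi.single b 1) c

/-- The cross product of triples of operators, `(A × B)_a = ε_{abc} A_b B_c`. -/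
noncomputable def opCross {m : ℝ} {E : momentumSpace m → Type*} [∀ k, NormedAddCommGroup (E k)]
    [∀ k, InnerProductSpace ℂ (E k)] (A B : Fin 3 → Op E) (a : Fin 3) : Op E :=
  fun ψ => ∑ b, ∑ c, eps a b c • A b (B c ψ)

/-! ## Connections -/

/-- A connection on `E`: a map `(X, ψ) ↦ D_X ψ` taking smooth vector fields and smooth sections to
smooth sections, additive in both arguments, with `D_{fX} ψ = f D_X ψ` and
`D_X (f ψ) = df(X) ψ + f D_X ψ` for all smooth `f : M → ℂ`. -/
structure IsConnection (r : ℕ) {E : momentumSpace m → Type*}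
    [TopologicalSpace (TotalSpace (Fiber r) E)] [∀ k, NormedAddCommGroup (E k)]
    [∀ k, InnerProductSpace ℂ (E k)] [FiberBundle (Fiber r) E] (D : VField m → Op E) : Prop where
  smooth : ∀ (X : VField m) (ψ : ∀ k, E k), X.Smooth → SmoothSection r ψ →
    SmoothSection r (D X ψ)
  add_field : ∀ (X Y : VField m) (ψ : ∀ k, E k), X.Smooth → Y.Smooth → SmoothSection r ψ →
    D (X + Y) ψ = D X ψ + D Y ψ
  smul_field : ∀ (f : momentumSpace m → ℂ) (X : VField m) (ψ : ∀ k, E k), SmoothFun f →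
    X.Smooth → SmoothSection r ψ → D (fun k => f k • X k) ψ = fun k => f k • D X ψ k
  add_section : ∀ (X : VField m) (ψ ζ : ∀ k, E k), X.Smooth → SmoothSection r ψ →
    SmoothSection r ζ → D X (ψ + ζ) = D X ψ + D X ζ
  leibniz : ∀ (f : momentumSpace m → ℂ) (X : VField m) (ψ : ∀ k, E k), SmoothFun f →
    X.Smooth → SmoothSection r ψ →
    D X (fun k => f k • ψ k) = fun k => dAlong f X k • ψ k + f k • D X ψ k

/-- `D` is anti-Hermitian: the operators `Q_a = i D_a` satisfy `⟨Q_a ψ, ζ⟩ = ⟨ψ, Q_a ζ⟩` for all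
smooth square-integrable wave functions `ψ`, `ζ` for which `Q_a ψ`, `Q_a ζ` are square-integrable
(in particular for all smooth wave functions with compact support). -/
def IsAntiHermitian (r : ℕ) {E : momentumSpace m → Type*}
    [TopologicalSpace (TotalSpace (Fiber r) E)] [∀ k, NormedAddCommGroup (E k)]
    [∀ k, InnerProductSpace ℂ (E k)] [FiberBundle (Fiber r) E] (D : VField m → Op E) : Prop :=
  ∀ (a : Fin 3) (ψ ζ : ∀ k, E k), SmoothSection r ψ → SmoothSection r ζ →
    SquareIntegrable ψ → SquareIntegrable ζ →
    SquareIntegrable (D (constField a) ψ) → SquareIntegrable (D (constField a) ζ) →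
    secInner (Complex.I • D (constField a) ψ) ζ = secInner ψ (Complex.I • D (constField a) ζ)

/-- A triple of operators is a vector operator: `[A_a, J_b] = i ε_{abc} A_c` on smooth sections. -/
def ParticleBundle.IsVectorOperator (S : ParticleBundle m r E) (A : Fin 3 → Op E) : Prop :=
  ∀ (a b : Fin 3) (ψ : ∀ k, E k), SmoothSection r ψ →
    A a (S.J b ψ) - S.J b (A a ψ) = Complex.I • ∑ c, eps a b c • A c ψ

/-- The angular momentum commutation relations `[A_a, A_b] = i ε_{abc} A_c` on smooth sections. -/
def IsAngularMomentum (r : ℕ) {E : momentumSpace m → Type*}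
    [TopologicalSpace (TotalSpace (Fiber r) E)] [∀ k, NormedAddCommGroup (E k)]
    [∀ k, InnerProductSpace ℂ (E k)] [FiberBundle (Fiber r) E] (A : Fin 3 → Op E) : Prop :=
  ∀ (a b : Fin 3) (ψ : ∀ k, E k), SmoothSection r ψ →
    A a (A b ψ) - A b (A a ψ) = Complex.I • ∑ c, eps a b c • A c ψ

namespace ParticleBundle

variable (S : ParticleBundle m r E)

/-- `D` is rotationally symmetric: `D_{R X} = Σ̃_R D_X Σ̃_{R⁻¹}` for all `R ∈ SO(3)`. -/
def IsRotationallySymmetric (D : VField m → Op E) : Prop :=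
  ∀ (R : Matrix.specialOrthogonalGroup (Fin 3) ℝ) (X : VField m) (ψ : ∀ k, E k), X.Smooth →
    SmoothSection r ψ →
    D (X.rotate R) ψ = S.rep (rotation R) (D X (S.rep (rotation R⁻¹) ψ))

/-- The operators `L^D = -i k × D` induced by `D`, with components
`L^D_a = -i (e_a · (k × D)) = -i D_{e_a × k}`. -/
noncomputable def L (D : VField m → Op E) (a : Fin 3) : Op E :=
  fun ψ => -Complex.I • D ((constField a).cross radialField) ψ

/-- The operators `S^D = J - L^D` induced by `D`. -/
noncomputable def spin (D : VField m → Op E) (a : Fin 3) : Op E :=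
  fun ψ => S.J a ψ - L D a ψ

/-- The boost connection `D^K = -(i/2) (H⁻¹ K + K H⁻¹)`, with `D^K_X = X^a D^K_a`. -/
noncomputable def boostConnection (X : VField m) : Op E :=
  fun ψ k => ∑ a, X k a • (-(Complex.I / 2) • (opHinv (S.K a ψ) + S.K a (opHinv ψ)) k)

/-- `J_⊥ = -H⁻¹ P × K`. -/
noncomputable def Jperp (a : Fin 3) : Op E :=
  fun ψ => -opHinv (opCross opP S.K a ψ)

/-- The helicity operator `χ = P̂ · J`. -/
noncomputable def helicity : Op E :=
  fun ψ => ∑ b, opPhat b (S.J b ψ)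

/-- `J_∥ = (P̂ · J) P̂`. -/
noncomputable def Jpar (a : Fin 3) : Op E :=
  fun ψ => S.helicity (opPhat a ψ)

end ParticleBundle

end Bundle

end Particle

set_option linter.unusedSectionVars false

namespace Particle

/-! ## Smooth families of Poincaré transformations -/

/-! Everything rests on differentiating the representation along curves of group elements. The
inverse boost along the `a`-th axis moves `k` with velocity `-ω e_a`, so `K_a (f ψ) = i ω ∂_a f ψ +
f K_a ψ`, and `-i H⁻¹ K_a` obeys the Leibniz rule of a derivative in the direction `e_a`.
Symmetrizing the order of `H⁻¹` and `K_a` only adds the scalar `-k_a / (2 ω²)`, because the energy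
changes at the rate `-k_a` under the same boost.

This scalar accounts for the density in `d³k/ω`. Fiberwise unitarity gives `∂_a (ω⁻¹ ⟨ψ, ζ⟩) = ω⁻¹
⟨D_a ψ, ζ⟩ + ω⁻¹ ⟨ψ, D_a ζ⟩` (`partialDeriv_inner`), and the integral of the left side vanishes:
almost every line parallel to an axis avoids the origin, and on it the fundamental theorem of
calculus applies. Rotational symmetry follows from `R Λ(u) R⁻¹ = Λ(R u)` for boosts with vector `u`,
together with the invariance of `ω`.

For `m = 0` the stabilizer of a momentum contains a Euclidean group `E(2)`, whose translations are
the null rotations. On the fiber let `A`, `B` generate these translations and `C` the plane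
rotations, so that `B = [C, A]` and `[A, B] = 0`. Then `tr B² = 0`; since `B` is skew-adjoint and
the fiber finite dimensional, `B = 0`, and hence `A = 0` (`fiberDeriv_eq_zero`). In terms of `J` and
`K` this says `J + n × K = n (n · J)` with `n = k/|k|` (`null_generators`, `add_cross_eq_of_SO`). As
`k × k = 0`, the scalar correction drops out of `L`, so `L = -n × K` and `S = n χ` with the helicity
`χ = n · J`.

The helicity commutes with `J` and with multiplication by the components of `n`. Hence `S` is a
vector operator with commuting components, and so `L = J - S` is a vector operator with `[L_a, L_b]
= i ε_{abc} (L_c - S_c)`. Either set of angular momentum relations would force `S = 0`, and then `χ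
= n · S = 0`. -/

theorem Poincare.ext_mat {g h : Poincare} (ht : g.trans = h.trans) (hm : g.mat = h.mat) :
    g = h :=
  Poincare.ext ht (Subtype.ext (Subtype.ext hm))

theorem Poincare.trans_mul (g h : Poincare) : (g * h).trans = g.trans + g.mat *ᵥ h.trans := rfl

theorem Poincare.trans_inv (g : Poincare) : (g⁻¹).trans = -((g⁻¹).mat *ᵥ g.trans) := rfl

theorem Poincare.trans_one : (1 : Poincare).trans = 0 := rfl

/-- The inverse of a Lorentz matrix is linear in its entries, which makes inverses of smooth
families smooth without any matrix inversion. -/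
theorem Poincare.mat_inv (g : Poincare) : (g⁻¹).mat = minkowski * g.matᵀ * minkowski := by
  have h1 : (minkowski * g.matᵀ * minkowski) * g.mat = 1 := by
    rw [Matrix.mul_assoc minkowski, Matrix.mul_assoc minkowski, Poincare.mat, g.lor.2.1,
      minkowski_mul_self]
  have h2 : g.mat * (g⁻¹).mat = 1 := by
    rw [← Poincare.mat_mul, mul_inv_cancel, Poincare.mat_one]
  calc (g⁻¹).mat = (minkowski * g.matᵀ * minkowski * g.mat) * (g⁻¹).mat := by
        rw [h1, Matrix.one_mul]
    _ = minkowski * g.matᵀ * minkowski := by rw [Matrix.mul_assoc, h2, Matrix.mul_one]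

section Family

variable {V W : Type*} [NormedAddCommGroup V] [NormedSpace ℝ V] [NormedAddCommGroup W]
  [NormedSpace ℝ W]

/-- A family of Poincaré transformations with parameters in a normed space is smooth. -/
structure IsSmoothFamily (g : V → Poincare) : Prop where
  trans : ∀ i, ContDiff ℝ ∞ fun x => (g x).trans i
  mat : ∀ i j, ContDiff ℝ ∞ fun x => (g x).mat i j

theorem IsSmoothFamily.const (g : Poincare) : IsSmoothFamily fun _ : V => g :=
  ⟨fun _ => contDiff_const, fun _ _ => contDiff_const⟩

theorem IsSmoothFamily.comp {g : V → Poincare} (hg : IsSmoothFamily g) {f : W → V}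
    (hf : ContDiff ℝ ∞ f) : IsSmoothFamily fun x => g (f x) :=
  ⟨fun i => (hg.trans i).comp hf, fun i j => (hg.mat i j).comp hf⟩

theorem IsSmoothFamily.mul {g h : V → Poincare} (hg : IsSmoothFamily g) (hh : IsSmoothFamily h) :
    IsSmoothFamily fun x => g x * h x := by
  refine ⟨fun i => ?_, fun i j => ?_⟩
  · simp only [Poincare.trans_mul, Pi.add_apply, Matrix.mulVec, dotProduct]
    exact (hg.trans i).add (ContDiff.sum fun j _ => (hg.mat i j).mul (hh.trans j))
  · simp only [Poincare.mat_mul, Matrix.mul_apply]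
    exact ContDiff.sum fun l _ => (hg.mat i l).mul (hh.mat l j)

theorem IsSmoothFamily.inv {g : V → Poincare} (hg : IsSmoothFamily g) :
    IsSmoothFamily fun x => (g x)⁻¹ := by
  have hm : ∀ i j, ContDiff ℝ ∞ fun x => ((g x)⁻¹).mat i j := fun i j => by
    simp only [Poincare.mat_inv, minkowski, Matrix.mul_diagonal, Matrix.diagonal_mul,
      Matrix.transpose_apply]
    exact (contDiff_const.mul (hg.mat j i)).mul contDiff_const
  refine ⟨fun i => ?_, hm⟩
  simp only [Poincare.trans_inv, Pi.neg_apply, Matrix.mulVec, dotProduct]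
  exact (ContDiff.sum fun j _ => (hm i j).mul (hg.trans j)).neg

end Family

/-! ## Rotations -/

theorem rotation_mat (R : Matrix.specialOrthogonalGroup (Fin 3) ℝ) :
    (rotation R).mat = Matrix.fromBlocks 1 0 0 R.1 := rfl

theorem rotation_mul (R Q : Matrix.specialOrthogonalGroup (Fin 3) ℝ) :
    rotation (R * Q) = rotation R * rotation Q := by
  refine Poincare.ext_mat ?_ ?_
  · simp [Poincare.trans_mul, rotation]
  · simp [Poincare.mat_mul, rotation_mat, Matrix.fromBlocks_multiply]

theorem rotation_one : rotation 1 = 1 :=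
  Poincare.ext_mat rfl (by simp [rotation_mat, Poincare.mat_one])

theorem rotation_inv (R : Matrix.specialOrthogonalGroup (Fin 3) ℝ) :
    rotation R⁻¹ = (rotation R)⁻¹ := by
  rw [eq_inv_iff_mul_eq_one, ← rotation_mul, inv_mul_cancel, rotation_one]

theorem transpose_mul_self_of_SO (R : Matrix.specialOrthogonalGroup (Fin 3) ℝ) :
    R.1ᵀ * R.1 = 1 :=
  (Matrix.mem_orthogonalGroup_iff' (Fin 3) ℝ).mp
    (Matrix.mem_specialOrthogonalGroup_iff.mp R.2).1

theorem mul_transpose_self_of_SO (R : Matrix.specialOrthogonalGroup (Fin 3) ℝ) :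
    R.1 * R.1ᵀ = 1 :=
  (Matrix.mem_orthogonalGroup_iff (Fin 3) ℝ).mp
    (Matrix.mem_specialOrthogonalGroup_iff.mp R.2).1

theorem coe_inv_SO (R : Matrix.specialOrthogonalGroup (Fin 3) ℝ) : (R⁻¹).1 = R.1ᵀ := rfl

/-- Each entry of a rotation matrix equals its cofactor. This is how orientation enters: it encodes
that the columns form a right-handed frame. -/
theorem transpose_eq_adjugate_of_SO (R : Matrix.specialOrthogonalGroup (Fin 3) ℝ) :
    R.1ᵀ = R.1.adjugate := by
  have hd : R.1.det = 1 := (Matrix.mem_specialOrthogonalGroup_iff.mp R.2).2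
  calc R.1ᵀ = R.1ᵀ * (R.1 * R.1.adjugate) := by
        rw [Matrix.mul_adjugate, hd, one_smul, Matrix.mul_one]
    _ = R.1.adjugate := by rw [← Matrix.mul_assoc, transpose_mul_self_of_SO, Matrix.one_mul]

/-- Rotations preserve the cross product. -/
theorem cross_mulVec_of_SO (R : Matrix.specialOrthogonalGroup (Fin 3) ℝ) (v w : Fin 3 → ℝ) :
    crossProduct (R.1 *ᵥ v) (R.1 *ᵥ w) = R.1 *ᵥ crossProduct v w := by
  have h := transpose_eq_adjugate_of_SO R
  rw [Matrix.adjugate_fin_three] at h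
  -- Replacing the entries of `R` on the right by their cofactors turns the claim into a polynomial
  -- identity.
  have e : ∀ i j, R.1 j i = _ := fun i j => congrFun (congrFun h i) j
  ext i
  have e0 := e 0 i
  have e1 := e 1 i
  have e2 := e 2 i
  fin_cases i <;>
  · simp [cross_apply, Matrix.mulVec, dotProduct, Fin.sum_univ_three] at e0 e1 e2 ⊢
    rw [e0, e1, e2]
    ring

theorem dotProduct_mulVec_of_SO (R : Matrix.specialOrthogonalGroup (Fin 3) ℝ)
    (v w : Fin 3 → ℝ) : (R.1 *ᵥ v) ⬝ᵥ (R.1 *ᵥ w) = v ⬝ᵥ w := by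
  rw [Matrix.dotProduct_mulVec, ← Matrix.mulVec_transpose, Matrix.mulVec_mulVec,
    transpose_mul_self_of_SO, Matrix.one_mulVec]

/-- Every direction is the image of the third axis under some rotation. -/
theorem exists_SO_col_two (n : Fin 3 → ℝ) (hn : ∑ i, n i ^ 2 = 1) :
    ∃ R : Matrix.specialOrthogonalGroup (Fin 3) ℝ, ∀ i, R.1 i 2 = n i := by
  rw [Fin.sum_univ_three] at hn
  set z : ℂ := ⟨n 0, n 1⟩ with hz
  have hs : Real.sin (Real.arccos (n 2)) = ‖z‖ := by
    rw [Real.sin_arccos, Complex.norm_eq_sqrt_sq_add_sq]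
    congr 1
    simp only [hz]
    linarith
  have hc : Real.cos (Real.arccos (n 2)) = n 2 :=
    Real.cos_arccos (by nlinarith [sq_nonneg (n 0), sq_nonneg (n 1)])
      (by nlinarith [sq_nonneg (n 0), sq_nonneg (n 1)])
  -- Spherical coordinates: tilt the third axis by the polar angle, then turn by the azimuth. If `z
  -- = 0` the azimuth is arbitrary, as it is only ever multiplied by `‖z‖`.
  refine ⟨axisRotation 2 z.arg * axisRotation 1 (Real.arccos (n 2)), fun i => ?_⟩
  have h0 : Real.cos z.arg * ‖z‖ = n 0 := by rw [mul_comm, Complex.norm_mul_cos_arg]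
  have h1 : Real.sin z.arg * ‖z‖ = n 1 := by rw [mul_comm, Complex.norm_mul_sin_arg]
  fin_cases i <;>
    simp [axisRotation, axisRotationMatrix, hs, hc, h0, h1]

/-- The matrix of `v ×`. -/
def skew (v : Fin 3 → ℝ) : Matrix (Fin 3) (Fin 3) ℝ :=
  !![0, -v 2, v 1; v 2, 0, -v 0; -v 1, v 0, 0]

theorem skew_mulVec (v w : Fin 3 → ℝ) : skew v *ᵥ w = crossProduct v w := by
  ext i
  fin_cases i <;> simp [skew, cross_apply, Matrix.mulVec, dotProduct, Fin.sum_univ_three] <;> ring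

theorem mul_skew_of_SO (R : Matrix.specialOrthogonalGroup (Fin 3) ℝ) (v : Fin 3 → ℝ) :
    R.1 * skew v = skew (R.1 *ᵥ v) * R.1 := by
  refine Matrix.ext_of_mulVec_single fun i => ?_
  rw [← Matrix.mulVec_mulVec, ← Matrix.mulVec_mulVec, skew_mulVec, skew_mulVec,
    cross_mulVec_of_SO]

/-- The rotation with Rodrigues vector `v`, that is by the angle `2 arctan |v|` about `v`. -/
noncomputable def rodriguesMatrix (v : Fin 3 → ℝ) : Matrix (Fin 3) (Fin 3) ℝ :=
  (1 + v ⬝ᵥ v)⁻¹ • ((1 - v ⬝ᵥ v) • (1 : Matrix (Fin 3) (Fin 3) ℝ)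
    + (2 : ℝ) • Matrix.vecMulVec v v + (2 : ℝ) • skew v)

theorem one_add_dotProduct_self_pos (v : Fin 3 → ℝ) : 0 < 1 + v ⬝ᵥ v := by
  have : 0 ≤ v ⬝ᵥ v := Finset.sum_nonneg fun i _ => mul_self_nonneg _
  linarith

theorem rodriguesMatrix_mem (v : Fin 3 → ℝ) :
    rodriguesMatrix v ∈ Matrix.specialOrthogonalGroup (Fin 3) ℝ := by
  have h := (one_add_dotProduct_self_pos v).ne'
  rw [Matrix.mem_specialOrthogonalGroup_iff, Matrix.mem_orthogonalGroup_iff]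
  simp only [dotProduct, Fin.sum_univ_three] at h
  constructor
  · ext i j
    fin_cases i <;> fin_cases j <;>
    · simp [rodriguesMatrix, skew, Matrix.mul_apply, Fin.sum_univ_three, dotProduct,
        Matrix.vecMulVec_apply, Matrix.one_apply]
      field_simp
      ring
  · simp [rodriguesMatrix, skew, Matrix.det_fin_three, dotProduct,
        Matrix.vecMulVec_apply, Fin.sum_univ_three]
    field_simp
    ring

/-- The rotation with Rodrigues vector `v`, as an element of `SO(3)`. -/
noncomputable def rodrigues (v : Fin 3 → ℝ) : Matrix.specialOrthogonalGroup (Fin 3) ℝ :=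
  ⟨rodriguesMatrix v, rodriguesMatrix_mem v⟩

theorem rodrigues_zero : rodrigues 0 = 1 := by
  refine Subtype.ext ?_
  ext i j
  fin_cases i <;> fin_cases j <;> simp [rodrigues, rodriguesMatrix, skew]

/-- The formula is built from `v · v`, `v vᵀ` and `v ×`, all equivariant under rotations.
Conjugation therefore acts linearly on the parameter, and the parametrization is smooth on all of
`ℝ³`. -/
theorem mul_rodrigues (R : Matrix.specialOrthogonalGroup (Fin 3) ℝ) (v : Fin 3 → ℝ) :
    R * rodrigues v = rodrigues (R.1 *ᵥ v) * R := by
  refine Subtype.ext ?_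
  change R.1 * rodriguesMatrix v = rodriguesMatrix (R.1 *ᵥ v) * R.1
  have h1 : R.1 * Matrix.vecMulVec v v = Matrix.vecMulVec (R.1 *ᵥ v) (R.1 *ᵥ v) * R.1 := by
    rw [Matrix.mul_vecMulVec, Matrix.vecMulVec_mul, ← Matrix.mulVec_transpose R.1,
      Matrix.mulVec_mulVec, transpose_mul_self_of_SO, Matrix.one_mulVec]
  simp only [rodriguesMatrix, dotProduct_mulVec_of_SO, Matrix.mul_smul, Matrix.smul_mul,
    Matrix.mul_add, Matrix.add_mul, h1, mul_skew_of_SO, Matrix.mul_one, Matrix.one_mul]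

/-- Half-angle formulas. The identity is only needed near `t = 0`, where the condition on the cosine
is automatic. -/
theorem axisRotation_eq_rodrigues (a : Fin 3) {t : ℝ} (ht : Real.cos (t / 2) ≠ 0) :
    axisRotation a t = rodrigues (Pi.single a (Real.tan (t / 2))) := by
  have hs := Real.sin_two_mul (t / 2)
  have hc := Real.cos_two_mul (t / 2)
  have h2 := Real.cos_sq_add_sin_sq (t / 2)
  rw [mul_div_cancel₀ _ (two_ne_zero)] at hs hc
  refine Subtype.ext ?_
  change axisRotationMatrix a t = rodriguesMatrix _
  rw [Real.tan_eq_sin_div_cos]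
  generalize Real.cos (t / 2) = c at *
  generalize Real.sin (t / 2) = s at *
  have hd : (1 + s / c * (s / c))⁻¹ = c ^ 2 := by
    field_simp
    rw [h2]
  ext i j
  fin_cases a <;> fin_cases i <;> fin_cases j <;>
  · simp [axisRotationMatrix, rodriguesMatrix, skew, dotProduct, Fin.sum_univ_three,
      Matrix.vecMulVec_apply, hs, hc, hd]
    try (field_simp; linear_combination (-1 : ℝ) * h2)
    try (field_simp; linear_combination (1 : ℝ) * h2)
    try field_simp

theorem contDiff_rodriguesMatrix (i j : Fin 3) :
    ContDiff ℝ ∞ fun v => rodriguesMatrix v i j := by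
  have hd : ContDiff ℝ ∞ fun v : Fin 3 → ℝ => v ⬝ᵥ v :=
    ContDiff.sum fun i _ => (contDiff_apply ℝ ℝ i).mul (contDiff_apply ℝ ℝ i)
  have hs : ContDiff ℝ ∞ fun v => skew v i j := by
    fin_cases i <;> fin_cases j <;> simp only [skew] <;>
      first
      | exact contDiff_const
      | exact contDiff_apply ℝ ℝ _
      | exact (contDiff_apply ℝ ℝ _).neg
  simp only [rodriguesMatrix, Matrix.smul_apply, Matrix.add_apply, Matrix.vecMulVec_apply,
    smul_eq_mul]
  refine ((contDiff_const.add hd).inv fun v => (one_add_dotProduct_self_pos v).ne').mul ?_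
  refine ContDiff.add (ContDiff.add ?_ ?_) ?_
  · exact (contDiff_const.sub hd).mul contDiff_const
  · exact contDiff_const.mul ((contDiff_apply ℝ ℝ i).mul (contDiff_apply ℝ ℝ j))
  · exact contDiff_const.mul hs

theorem isSmoothFamily_rotation {V : Type*} [NormedAddCommGroup V] [NormedSpace ℝ V]
    {R : V → Matrix.specialOrthogonalGroup (Fin 3) ℝ}
    (hR : ∀ i j, ContDiff ℝ ∞ fun x => (R x).1 i j) :
    IsSmoothFamily fun x => rotation (R x) := by
  refine ⟨fun i => contDiff_const, fun i j => ?_⟩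
  rcases i with i | i <;> rcases j with j | j <;> simp only [rotation_mat, Matrix.fromBlocks]
  · exact contDiff_const
  · exact contDiff_const
  · exact contDiff_const
  · exact hR i j

theorem isSmoothFamily_rodrigues : IsSmoothFamily fun v => rotation (rodrigues v) :=
  isSmoothFamily_rotation contDiff_rodriguesMatrix

theorem contDiff_axisRotationMatrix (a i j : Fin 3) :
    ContDiff ℝ ∞ fun t => axisRotationMatrix a t i j := by
  fin_cases a <;> fin_cases i <;> fin_cases j <;> simp [axisRotationMatrix] <;>
    first
    | exact contDiff_const
    | exact Real.contDiff_cos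
    | exact Real.contDiff_sin
    | exact Real.contDiff_sin.neg

theorem isSmoothFamily_axisRotation (a : Fin 3) :
    IsSmoothFamily fun t => rotation (axisRotation a t) :=
  isSmoothFamily_rotation (contDiff_axisRotationMatrix a)

theorem axisRotation_zero (a : Fin 3) : axisRotation a 0 = 1 := by
  refine Subtype.ext ?_
  ext i j
  fin_cases a <;> fin_cases i <;> fin_cases j <;> simp [axisRotation, axisRotationMatrix]

theorem axisRotation_neg (a : Fin 3) (t : ℝ) : axisRotation a (-t) = (axisRotation a t)⁻¹ := by
  refine Subtype.ext ?_
  rw [coe_inv_SO]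
  ext i j
  fin_cases a <;> fin_cases i <;> fin_cases j <;> simp [axisRotation, axisRotationMatrix]

/-! ## Boosts -/

/-- The matrix of the boost which maps the unit time vector to `(√(1 + |u|²), u)`. -/
noncomputable def pureBoostMatrix (u : Fin 3 → ℝ) : Matrix Idx Idx ℝ :=
  Matrix.fromBlocks (Matrix.of fun _ _ => √(1 + u ⬝ᵥ u)) (Matrix.of fun _ j => u j)
    (Matrix.of fun i _ => u i) (1 + (1 + √(1 + u ⬝ᵥ u))⁻¹ • Matrix.vecMulVec u u)

theorem pureBoostMatrix_lorentz (u : Fin 3 → ℝ) :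
    (pureBoostMatrix u)ᵀ * minkowski * pureBoostMatrix u = minkowski := by
  have h := Real.sq_sqrt (one_add_dotProduct_self_pos u).le
  have h0 : 1 + √(1 + u ⬝ᵥ u) ≠ 0 := by positivity
  simp only [pureBoostMatrix]
  generalize √(1 + u ⬝ᵥ u) = γ at *
  simp only [dotProduct, Fin.sum_univ_three] at h
  ext i j
  rcases i with i | i <;> rcases j with j | j <;> (try fin_cases i) <;> (try fin_cases j) <;>
  · simp [minkowski, Matrix.mul_apply, Fintype.sum_sum_type, Matrix.vecMulVec_apply,
      Fin.sum_univ_three, Matrix.one_apply]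
    try field_simp
    first
    | linear_combination (-1 : ℝ) * h
    | linear_combination (-u 0) * h
    | linear_combination (-u 1) * h
    | linear_combination (-u 2) * h
    | linear_combination (-u 0 * u 0) * h
    | linear_combination (-u 0 * u 1) * h
    | linear_combination (-u 0 * u 2) * h
    | linear_combination (-u 1 * u 1) * h
    | linear_combination (-u 1 * u 2) * h
    | linear_combination (-u 2 * u 2) * h

theorem det_pureBoostMatrix (u : Fin 3 → ℝ) : (pureBoostMatrix u).det = 1 := by
  have h := Real.sq_sqrt (one_add_dotProduct_self_pos u).le
  have h0 : 1 + √(1 + u ⬝ᵥ u) ≠ 0 := by positivity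
  have h1 : √(1 + u ⬝ᵥ u) ≠ 0 := (Real.sqrt_pos.mpr (one_add_dotProduct_self_pos u)).ne'
  simp only [pureBoostMatrix]
  generalize √(1 + u ⬝ᵥ u) = γ at *
  simp only [dotProduct, Fin.sum_univ_three] at h
  have hA : (Matrix.of fun _ _ : Unit => γ) = γ • (1 : Matrix Unit Unit ℝ) := by
    ext; simp
  let _ : Invertible (Matrix.of fun _ _ : Unit => γ) :=
    ⟨γ⁻¹ • 1, by rw [hA]; simp [smul_smul, h1], by rw [hA]; simp [smul_smul, h1]⟩
  -- Schur complement of the time-time entry `γ`: what remains is a rank one perturbation of the 3 ×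
  -- 3 identity.
  rw [Matrix.det_fromBlocks₁₁]
  have hi : ⅟(Matrix.of fun _ _ : Unit => γ) = γ⁻¹ • 1 := rfl
  rw [hi, Matrix.det_fin_three]
  simp [Matrix.mul_apply, Matrix.vecMulVec_apply]
  field_simp
  linear_combination (γ ^ 2 * (1 + γ) ^ 2) * h

/-- The boost which maps the unit time vector to `(√(1 + |u|²), u)`. -/
noncomputable def pureBoost (u : Fin 3 → ℝ) : Poincare where
  trans := 0
  lor := ⟨⟨pureBoostMatrix u, det_pureBoostMatrix u⟩, pureBoostMatrix_lorentz u, by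
    simpa [pureBoostMatrix] using one_add_dotProduct_self_pos u⟩

theorem pureBoost_mat (u : Fin 3 → ℝ) : (pureBoost u).mat = pureBoostMatrix u := rfl

theorem pureBoost_zero : pureBoost 0 = 1 := by
  refine Poincare.ext_mat rfl ?_
  rw [pureBoost_mat, Poincare.mat_one]
  ext i j
  rcases i with i | i <;> rcases j with j | j <;>
    simp [pureBoostMatrix, Matrix.one_apply]

theorem boost_eq_pureBoost (a : Fin 3) (t : ℝ) :
    boost a t = pureBoost (Pi.single a (Real.sinh t)) := by
  refine Poincare.ext_mat rfl ?_
  have h := Real.cosh_sq t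
  have hγ : √(1 + Real.sinh t * Real.sinh t) = Real.cosh t := by
    rw [← sq, add_comm, ← h, Real.sqrt_sq (Real.cosh_pos t).le]
  have h0 : 1 + Real.cosh t ≠ 0 := by have := Real.cosh_pos t; positivity
  change boostMatrix a t = pureBoostMatrix _
  ext i j
  rcases i with i | i <;> rcases j with j | j <;> (try fin_cases i) <;> (try fin_cases j) <;>
    fin_cases a <;>
  · simp [pureBoostMatrix, boostMatrix, dotProduct, Fin.sum_univ_three,
      Matrix.vecMulVec_apply, hγ]
    try (field_simp; linear_combination (1 : ℝ) * h)

/-- Rotation of the boost vector; differentiated at `u = 0`, it yields the vector character of `K`.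
-/
theorem rotation_mul_pureBoost (R : Matrix.specialOrthogonalGroup (Fin 3) ℝ) (u : Fin 3 → ℝ) :
    rotation R * pureBoost u = pureBoost (R.1 *ᵥ u) * rotation R := by
  refine Poincare.ext_mat ?_ ?_
  · simp [Poincare.trans_mul, rotation, pureBoost]
  have h1 : R.1 * Matrix.vecMulVec u u = Matrix.vecMulVec (R.1 *ᵥ u) (R.1 *ᵥ u) * R.1 := by
    rw [Matrix.mul_vecMulVec, Matrix.vecMulVec_mul, ← Matrix.mulVec_transpose R.1,
      Matrix.mulVec_mulVec, transpose_mul_self_of_SO, Matrix.one_mulVec]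
  have h2 : R.1ᵀ *ᵥ (R.1 *ᵥ u) = u := by
    rw [Matrix.mulVec_mulVec, transpose_mul_self_of_SO, Matrix.one_mulVec]
  rw [Poincare.mat_mul, Poincare.mat_mul, rotation_mat, pureBoost_mat, pureBoost_mat,
    pureBoostMatrix, pureBoostMatrix, Matrix.fromBlocks_multiply, Matrix.fromBlocks_multiply]
  simp only [dotProduct_mulVec_of_SO, Matrix.mul_add, Matrix.add_mul, Matrix.mul_one,
    Matrix.one_mul, Matrix.mul_zero, Matrix.zero_mul, add_zero, zero_add, Matrix.mul_smul,
    Matrix.smul_mul, smul_zero, h1]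
  congr 1
  · ext i j
    simp only [Matrix.of_apply, Matrix.mul_apply]
    have := congrFun h2 j
    simp only [Matrix.mulVec, dotProduct, Matrix.transpose_apply] at this ⊢
    rw [← this]
    exact Finset.sum_congr rfl fun i _ => mul_comm _ _

theorem isSmoothFamily_pureBoost : IsSmoothFamily pureBoost := by
  have hd : ContDiff ℝ ∞ fun u : Fin 3 → ℝ => √(1 + u ⬝ᵥ u) := by
    refine ContDiff.sqrt (contDiff_const.add ?_) fun u => (one_add_dotProduct_self_pos u).ne'
    exact ContDiff.sum fun i _ => (contDiff_apply ℝ ℝ i).mul (contDiff_apply ℝ ℝ i)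
  refine ⟨fun i => contDiff_const, fun i j => ?_⟩
  rcases i with i | i <;> rcases j with j | j <;>
    simp only [pureBoost_mat, pureBoostMatrix, Matrix.fromBlocks, Matrix.of_apply, Sum.elim_inl,
      Sum.elim_inr]
  · exact hd
  · exact contDiff_apply ℝ ℝ j
  · exact contDiff_apply ℝ ℝ i
  · refine contDiff_const.add (ContDiff.mul ?_ ?_)
    · exact (contDiff_const.add hd).inv fun u => by positivity
    · exact (contDiff_apply ℝ ℝ i).mul (contDiff_apply ℝ ℝ j)

theorem boost_zero (a : Fin 3) : boost a 0 = 1 := by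
  rw [boost_eq_pureBoost, Real.sinh_zero, Pi.single_zero, pureBoost_zero]

theorem boost_inv (a : Fin 3) (t : ℝ) : (boost a t)⁻¹ = boost a (-t) := by
  rw [inv_eq_iff_mul_eq_one]
  refine Poincare.ext_mat ?_ ?_
  · simp [Poincare.trans_mul, boost, Poincare.trans_one]
  · rw [Poincare.mat_mul]
    change boostMatrix a t * boostMatrix a (-t) = _
    rw [boostMatrix_mul, add_neg_cancel]
    exact congrArg Poincare.mat (boost_zero a)

theorem isSmoothFamily_boost (a : Fin 3) : IsSmoothFamily (boost a) := by
  have h : boost a = fun t => pureBoost (Pi.single a (Real.sinh t)) :=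
    funext (boost_eq_pureBoost a)
  rw [h]
  refine isSmoothFamily_pureBoost.comp (contDiff_pi.mpr fun i => ?_)
  by_cases hi : i = a
  · subst hi
    simpa using Real.contDiff_sinh
  · simpa [hi] using contDiff_const

/-! ## Null rotations -/

/-- The null rotation with parameters `s`, `t` which fixes the null direction `(1, 0, 0, 1)`. -/
noncomputable def nullRotation (s t : ℝ) : Poincare :=
  pureBoost ![s, t, (s ^ 2 + t ^ 2) / 2] * rotation (rodrigues ![t / 2, -s / 2, 0])

/-- Two descriptions serve two purposes: the defining product of a boost and a rotation exhibits the
generator in terms of `K` and `J`, while this polynomial matrix makes the group law and the fixed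
null direction visible. -/
theorem nullRotation_mat (s t : ℝ) : (nullRotation s t).mat =
    Matrix.fromBlocks (Matrix.of fun _ _ => 1 + (s ^ 2 + t ^ 2) / 2)
      (Matrix.of fun _ j => ![s, t, -(s ^ 2 + t ^ 2) / 2] j)
      (Matrix.of fun i _ => ![s, t, (s ^ 2 + t ^ 2) / 2] i)
      !![1, 0, -s; 0, 1, -t; s, t, 1 - (s ^ 2 + t ^ 2) / 2] := by
  have hγ : √(1 + ![s, t, (s ^ 2 + t ^ 2) / 2] ⬝ᵥ ![s, t, (s ^ 2 + t ^ 2) / 2])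
      = 1 + (s ^ 2 + t ^ 2) / 2 := by
    rw [← Real.sqrt_sq (by positivity : 0 ≤ 1 + (s ^ 2 + t ^ 2) / 2)]
    congr 1
    simp [dotProduct, Fin.sum_univ_three]
    ring
  have h1 : 1 + (1 + (s ^ 2 + t ^ 2) / 2) ≠ 0 := by positivity
  have h2 : 1 + (t / 2 * (t / 2) + -s / 2 * (-s / 2)) ≠ 0 := by
    nlinarith [sq_nonneg s, sq_nonneg t]
  rw [nullRotation, Poincare.mat_mul, pureBoost_mat, rotation_mat, pureBoostMatrix, hγ]
  change _ * Matrix.fromBlocks 1 0 0 (rodriguesMatrix _) = _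
  -- The Rodrigues normalization `1 + |v|² = 1 + (s² + t²)/4` is half the denominator `1 + γ` of the
  -- boost.
  have h3 : (1 + (t / 2 * (t / 2) + -s / 2 * (-s / 2)))⁻¹
      = 2 * (1 + (1 + (s ^ 2 + t ^ 2) / 2))⁻¹ := by
    field_simp
    ring
  ext i j
  rcases i with i | i <;> rcases j with j | j <;> (try fin_cases i) <;> (try fin_cases j) <;>
  · simp [rodriguesMatrix, skew, Matrix.mul_apply, Fin.sum_univ_three,
      Matrix.one_apply, Matrix.vecHead, Matrix.vecTail, h3]
    try (field_simp; ring)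

theorem nullRotation_trans (s t : ℝ) : (nullRotation s t).trans = 0 := by
  simp [nullRotation, Poincare.trans_mul, pureBoost, rotation]

/-- The null rotations form a copy of the additive group `ℝ²`, the translations of the Euclidean
plane in the little group. -/
theorem nullRotation_mul (s t s' t' : ℝ) :
    nullRotation s t * nullRotation s' t' = nullRotation (s + s') (t + t') := by
  refine Poincare.ext_mat ?_ ?_
  · simp [Poincare.trans_mul, nullRotation_trans]
  rw [Poincare.mat_mul, nullRotation_mat, nullRotation_mat, nullRotation_mat]
  ext i j
  rcases i with i | i <;> rcases j with j | j <;> (try fin_cases i) <;> (try fin_cases j) <;>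
  · simp [Matrix.mul_apply, Fin.sum_univ_three]
    try ring

/-- Rotations about the fixed direction rotate this plane of translations; together they form the
little group `E(2)`. -/
theorem axisRotation_mul_nullRotation (θ s : ℝ) :
    rotation (axisRotation 2 θ) * nullRotation s 0
      = nullRotation (Real.cos θ * s) (Real.sin θ * s) * rotation (axisRotation 2 θ) := by
  have h := Real.cos_sq_add_sin_sq θ
  refine Poincare.ext_mat ?_ ?_
  · simp [Poincare.trans_mul, nullRotation_trans, rotation]
  rw [Poincare.mat_mul, Poincare.mat_mul, nullRotation_mat, nullRotation_mat, rotation_mat]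
  ext i j
  rcases i with i | i <;> rcases j with j | j <;> (try fin_cases i) <;> (try fin_cases j) <;>
  · simp [Matrix.mul_apply, Fin.sum_univ_three, axisRotation, axisRotationMatrix]
    try (first
      | ring1
      | linear_combination (s ^ 2) * h
      | linear_combination (-s ^ 2) * h
      | linear_combination s * h
      | linear_combination (-s) * h)

theorem isSmoothFamily_nullRotation {V : Type*} [NormedAddCommGroup V] [NormedSpace ℝ V]
    {f g : V → ℝ} (hf : ContDiff ℝ ∞ f) (hg : ContDiff ℝ ∞ g) :
    IsSmoothFamily fun x => nullRotation (f x) (g x) := by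
  refine IsSmoothFamily.mul (isSmoothFamily_pureBoost.comp (contDiff_pi.mpr fun i => ?_))
    (isSmoothFamily_rodrigues.comp (contDiff_pi.mpr fun i => ?_))
  · fin_cases i
    · exact hf
    · exact hg
    · exact ((hf.pow 2).add (hg.pow 2)).div_const 2
  · fin_cases i
    · exact hg.div_const 2
    · exact hf.neg.div_const 2
    · exact contDiff_const

end Particle

namespace Particle

open Bundle

variable {V : Type*} [NormedAddCommGroup V] [NormedSpace ℝ V]

/-! ## Smoothness of the action on momenta -/

section Momentum

variable {m : ℝ}

theorem contMDiff_coord (b : Fin 3) :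
    ContMDiff 𝓘(ℝ, E3) 𝓘(ℝ, ℝ) ∞ fun k : momentumSpace m => k.1 b := by
  have h : ContDiff ℝ ∞ fun x : E3 => x b := contDiff_piLp_apply 2
  exact h.contMDiff.comp contMDiff_subtype_val

theorem contMDiff_energy :
    ContMDiff 𝓘(ℝ, E3) 𝓘(ℝ, ℝ) ∞ fun k : momentumSpace m => energy k := by
  intro k
  have h : ContDiffAt ℝ ∞ (fun x : E3 => √(m ^ 2 + ‖x‖ ^ 2)) k.1 := by
    refine ContDiffAt.sqrt (contDiffAt_const.add (contDiff_norm_sq ℝ).contDiffAt) ?_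
    exact (Real.sqrt_pos.mp (energy_pos k)).ne'
  exact ContMDiffAt.comp (g := fun x : E3 => √(m ^ 2 + ‖x‖ ^ 2)) k h.contMDiffAt
    contMDiff_subtype_val.contMDiffAt

theorem contMDiff_fourMomentum (i : Idx) :
    ContMDiff 𝓘(ℝ, E3) 𝓘(ℝ, ℝ) ∞ fun k : momentumSpace m => fourMomentum k i := by
  rcases i with i | i
  · exact contMDiff_energy
  · exact contMDiff_coord i

theorem contMDiff_to_momentumSpace {H M : Type*} {F : Type*} [NormedAddCommGroup F]
    [NormedSpace ℝ F] [TopologicalSpace H] {I : ModelWithCorners ℝ F H} [TopologicalSpace M]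
    [ChartedSpace H M] {f : M → momentumSpace m}
    (h : ∀ b, ContMDiff I 𝓘(ℝ, ℝ) ∞ fun x => (f x).1 b) : ContMDiff I 𝓘(ℝ, E3) ∞ f := by
  rw [← ContMDiff.subtypeVal_comp_iff]
  have h1 : ContMDiff I 𝓘(ℝ, Fin 3 → ℝ) ∞ fun x b => (f x).1 b := contMDiff_pi_space.mpr h
  exact (PiLp.contDiff_toLp (p := 2)).contMDiff.comp h1

theorem smul_val (g : Poincare) (k : momentumSpace m) (b : Fin 3) :
    (g • k).1 b = (g.mat *ᵥ fourMomentum k) (Sum.inr b) := rfl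

theorem fourMomentum_smul (g : Poincare) (k : momentumSpace m) :
    fourMomentum (g • k) = g.mat *ᵥ fourMomentum k := fourMomentum_act g k

theorem contMDiff_family_smul {g : V → Poincare} (hg : IsSmoothFamily g) :
    ContMDiff (𝓘(ℝ, V).prod 𝓘(ℝ, E3)) 𝓘(ℝ, E3) ∞
      fun p : V × momentumSpace m => g p.1 • p.2 := by
  refine contMDiff_to_momentumSpace fun b => ?_
  simp only [smul_val, Matrix.mulVec, dotProduct]
  refine contMDiff_finsetSum fun j _ => ?_
  exact ((hg.mat _ j).contMDiff.comp contMDiff_fst).mul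
    ((contMDiff_fourMomentum j).comp contMDiff_snd)

end Momentum

variable {m : ℝ} {r : ℕ} {E : momentumSpace m → Type*} [TopologicalSpace (TotalSpace (Fiber r) E)]
  [∀ k, NormedAddCommGroup (E k)] [∀ k, InnerProductSpace ℂ (E k)]
  [FiberBundle (Fiber r) E] [VectorBundle ℂ (Fiber r) E] [VectorBundle ℝ (Fiber r) E]
  [ContMDiffVectorBundle ∞ (Fiber r) E 𝓘(ℝ, E3)]

/-! ## Smooth sections -/

/-- The coefficients are complex while the smooth structure is real. In a trivialization, which is
`ℂ`-linear on fibers, the product becomes the smooth map `ℂ × ℂ^r → ℂ^r`. -/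
theorem SmoothSection.smul {f : momentumSpace m → ℂ} {ψ : ∀ k, E k} (hf : SmoothFun f)
    (hψ : SmoothSection r ψ) : SmoothSection r fun k => f k • ψ k := by
  intro k₀
  have hs := hψ k₀
  rw [contMDiffAt_section] at hs ⊢
  set e := trivializationAt (Fiber r) E k₀
  have h1 : ContDiff ℝ ∞ fun p : ℂ × Fiber r => p.1 • p.2 := contDiff_smul
  refine (h1.contMDiff.contMDiffAt.comp k₀ ((hf k₀).prodMk_space hs)).congr_of_eventuallyEq ?_
  filter_upwards [e.open_baseSet.mem_nhds (mem_baseSet_trivializationAt (Fiber r) E k₀)] with k hk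
  exact (e.linear ℂ hk).2 _ _

theorem SmoothSection.add {ψ ζ : ∀ k, E k} (hψ : SmoothSection r ψ) (hζ : SmoothSection r ζ) :
    SmoothSection r (ψ + ζ) :=
  ContMDiff.add_section hψ hζ

theorem SmoothSection.sub {ψ ζ : ∀ k, E k} (hψ : SmoothSection r ψ) (hζ : SmoothSection r ζ) :
    SmoothSection r (ψ - ζ) :=
  ContMDiff.sub_section hψ hζ

theorem SmoothSection.const_smul (c : ℂ) {ψ : ∀ k, E k} (hψ : SmoothSection r ψ) :
    SmoothSection r (c • ψ) :=
  SmoothSection.smul contMDiff_const hψ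

theorem SmoothSection.sum {ι : Type*} (s : Finset ι) {ψ : ι → ∀ k, E k}
    (hψ : ∀ i, SmoothSection r (ψ i)) : SmoothSection r fun k => ∑ i ∈ s, ψ i k :=
  ContMDiff.sum_section fun i _ => hψ i

/-- A smooth curve in the total space which stays in one fiber is smooth in that fiber. -/
theorem contDiff_of_contMDiff_mk {k : momentumSpace m} {φ : V → E k}
    (h : ContMDiff 𝓘(ℝ, V) (𝓘(ℝ, E3).prod 𝓘(ℝ, Fiber r)) ∞
      fun x => TotalSpace.mk' (Fiber r) k (φ x)) : ContDiff ℝ ∞ φ := by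
  set e := trivializationAt (Fiber r) E k
  have hk : k ∈ e.baseSet := mem_baseSet_trivializationAt (Fiber r) E k
  have h1 : ContDiff ℝ ∞ fun x => (e ⟨k, φ x⟩).2 := by
    rw [← contMDiff_iff_contDiff]
    exact fun x => (contMDiffAt_totalSpace.mp (h x)).2
  have h2 : φ = fun x => (e.continuousLinearEquivAt ℝ k hk).symm (e ⟨k, φ x⟩).2 := by
    funext x
    exact ((e.continuousLinearEquivAt ℝ k hk).symm_apply_apply (φ x)).symm
  rw [h2]
  exact (e.continuousLinearEquivAt ℝ k hk).symm.contDiff.comp h1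

/-- Differentiation with respect to parameters preserves smoothness of sections. -/
theorem SmoothSection.fderiv_family [FiniteDimensional ℝ V] {φ : V → ∀ k, E k}
    (h : ContMDiff (𝓘(ℝ, V).prod 𝓘(ℝ, E3)) (𝓘(ℝ, E3).prod 𝓘(ℝ, Fiber r)) ∞
      fun p : V × momentumSpace m => TotalSpace.mk' (Fiber r) p.2 (φ p.1 p.2)) (x₀ w : V) :
    SmoothSection r fun k => fderiv ℝ (fun x => φ x k) x₀ w := by
  intro k₀
  rw [contMDiffAt_section]
  set e := trivializationAt (Fiber r) E k₀
  have hk₀ : k₀ ∈ e.baseSet := mem_baseSet_trivializationAt (Fiber r) E k₀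
  have h1 : ContMDiffAt (𝓘(ℝ, E3).prod 𝓘(ℝ, V)) 𝓘(ℝ, Fiber r) ∞
      (fun p : momentumSpace m × V => (e ⟨p.1, φ p.2 p.1⟩).2) (k₀, x₀) :=
    ContMDiffAt.comp (g := fun p : V × momentumSpace m => (e ⟨p.2, φ p.1 p.2⟩).2)
      (f := fun p : momentumSpace m × V => (p.2, p.1)) (k₀, x₀)
      (contMDiffAt_totalSpace.mp (h (x₀, k₀))).2 (contMDiffAt_snd.prodMk contMDiffAt_fst)
  -- Jointly smooth in the base point and the parameter, so the parameter derivative in a fixed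
  -- trivialization is smooth in the base point; the order lost is harmless at `∞`.
  have h2 : ContMDiffAt 𝓘(ℝ, E3) 𝓘(ℝ, V →L[ℝ] Fiber r) ∞
      (fun k => fderiv ℝ (fun x => (e ⟨k, φ x k⟩).2) x₀) k₀ := by
    have := ContMDiffAt.mfderiv (n := ∞) (m := ∞) (fun k x => (e ⟨k, φ x k⟩).2) (fun _ => x₀) h1
      contMDiffAt_const (by simp)
    erw [inTangentCoordinates_model_space] at this
    simpa only [mfderiv_eq_fderiv] using this
  have h3 : ContMDiffAt 𝓘(ℝ, E3) 𝓘(ℝ, Fiber r) ∞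
      (fun k => fderiv ℝ (fun x => (e ⟨k, φ x k⟩).2) x₀ w) k₀ :=
    h2.clm_apply contMDiffAt_const
  refine h3.congr_of_eventuallyEq ?_
  filter_upwards [e.open_baseSet.mem_nhds hk₀] with k hk
  have h4 : DifferentiableAt ℝ (fun x => φ x k) x₀ := by
    refine (contDiff_of_contMDiff_mk (r := r) ?_).differentiable (by simp) x₀
    exact h.comp (contMDiff_id.prodMk contMDiff_const)
  -- The trivialization is linear on each fiber, so it commutes with differentiation inside that
  -- fiber.
  have h5 := ((e.continuousLinearEquivAt ℝ k hk).hasFDerivAt.comp x₀ h4.hasFDerivAt).fderiv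
  change e.continuousLinearEquivAt ℝ k hk _ = _
  exact (DFunLike.congr_fun h5 w).symm

/-! ## Smoothness of the representation -/

namespace ParticleBundle

variable (S : ParticleBundle m r E)

/-- Comparison in the total space identifies values in fibers whose base points are equal only
propositionally. -/
theorem mk_act {g : Poincare} {k k' k'' : momentumSpace m} (h : g • k = k') (h' : g • k = k'')
    (v : E k) : TotalSpace.mk' (Fiber r) k' (S.act g h v) = TotalSpace.mk' (Fiber r) k'' (S.act g h' v) := by
  subst h
  subst h'
  rfl

/-- Smoothness of the action is given for parameters in `ℝⁿ`; a linear coordinate change carries it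
to any finite-dimensional parameter space, such as products of parameter spaces. -/
theorem contMDiff_act [FiniteDimensional ℝ V] {g : V → Poincare} (hg : IsSmoothFamily g) :
    ContMDiff (𝓘(ℝ, V).prod (𝓘(ℝ, E3).prod 𝓘(ℝ, Fiber r))) (𝓘(ℝ, E3).prod 𝓘(ℝ, Fiber r)) ∞
      (fun p : V × TotalSpace (Fiber r) E =>
        TotalSpace.mk' (Fiber r) (g p.1 • p.2.1) (S.act (g p.1) rfl p.2.2)) := by
  have hg' := hg.comp (toEuclidean (E := V)).symm.contDiff
  have h := S.smooth_act _ _ ⟨hg'.trans, hg'.mat⟩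
  have hφ : ContMDiff (𝓘(ℝ, V).prod (𝓘(ℝ, E3).prod 𝓘(ℝ, Fiber r)))
      (𝓘(ℝ, EuclideanSpace ℝ (Fin (Module.finrank ℝ V))).prod (𝓘(ℝ, E3).prod 𝓘(ℝ, Fiber r))) ∞
      (fun p : V × TotalSpace (Fiber r) E => (toEuclidean p.1, p.2)) :=
    (((toEuclidean (E := V)).contDiff.contMDiff).comp contMDiff_fst).prodMk contMDiff_snd
  have h2 := h.comp hφ
  convert h2 using 2 with p
  simp only [Function.comp]
  rw [ContinuousLinearEquiv.symm_apply_apply]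

theorem contMDiff_rep [FiniteDimensional ℝ V] {g : V → Poincare} (hg : IsSmoothFamily g)
    {ψ : ∀ k, E k} (hψ : SmoothSection r ψ) :
    ContMDiff (𝓘(ℝ, V).prod 𝓘(ℝ, E3)) (𝓘(ℝ, E3).prod 𝓘(ℝ, Fiber r)) ∞
      fun p : V × momentumSpace m => TotalSpace.mk' (Fiber r) p.2 (S.rep (g p.1) ψ p.2) := by
  have h1 : ContMDiff (𝓘(ℝ, V).prod 𝓘(ℝ, E3)) (𝓘(ℝ, V).prod (𝓘(ℝ, E3).prod 𝓘(ℝ, Fiber r))) ∞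
      fun p : V × momentumSpace m =>
        (p.1, TotalSpace.mk' (Fiber r) ((g p.1)⁻¹ • p.2) (ψ ((g p.1)⁻¹ • p.2))) :=
    contMDiff_fst.prodMk (ContMDiff.comp hψ (contMDiff_family_smul hg.inv))
  convert (S.contMDiff_act hg).comp h1 using 2 with p
  exact S.mk_act _ _ _

theorem smoothSection_rep (g : Poincare) {ψ : ∀ k, E k} (hψ : SmoothSection r ψ) :
    SmoothSection r (S.rep g ψ) :=
  (S.contMDiff_rep (IsSmoothFamily.const (V := ℝ) g) hψ).comp
    ((contMDiff_const (c := (0 : ℝ))).prodMk contMDiff_id)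

theorem contDiff_rep [FiniteDimensional ℝ V] {g : V → Poincare} (hg : IsSmoothFamily g)
    {ψ : ∀ k, E k} (hψ : SmoothSection r ψ) (k : momentumSpace m) :
    ContDiff ℝ ∞ fun x => S.rep (g x) ψ k :=
  contDiff_of_contMDiff_mk (r := r) ((S.contMDiff_rep hg hψ).comp (contMDiff_id.prodMk contMDiff_const))

theorem contDiff_act_of_fixed [FiniteDimensional ℝ V] {g : V → Poincare} (hg : IsSmoothFamily g)
    {k : momentumSpace m} (hk : ∀ x, g x • k = k) (v : E k) :
    ContDiff ℝ ∞ fun x => S.act (g x) (hk x) v := by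
  refine contDiff_of_contMDiff_mk (r := r) ?_
  convert (S.contMDiff_act hg).comp
    (contMDiff_id.prodMk (contMDiff_const (c := TotalSpace.mk' (Fiber r) k v))) using 2 with x
  exact S.mk_act _ _ _

/-! ## Algebra of the representation -/

theorem rep_apply_of_smul_eq (g : Poincare) (ψ : ∀ k, E k) {k k' : momentumSpace m}
    (h : g • k' = k) : S.rep g ψ k = S.act g h (ψ k') := by
  obtain rfl : g⁻¹ • k = k' := by rw [← h, inv_smul_smul]
  rfl

theorem rep_one (ψ : ∀ k, E k) : S.rep 1 ψ = ψ := by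
  funext k
  rw [S.rep_apply_of_smul_eq 1 ψ (one_smul _ k), S.act_one]

theorem rep_mul (g h : Poincare) (ψ : ∀ k, E k) : S.rep (g * h) ψ = S.rep g (S.rep h ψ) := by
  funext k
  have h1 : h • (h⁻¹ • g⁻¹ • k) = g⁻¹ • k := smul_inv_smul _ _
  have h2 : g • (g⁻¹ • k) = k := smul_inv_smul _ _
  rw [S.rep_apply_of_smul_eq g _ h2, S.rep_apply_of_smul_eq h _ h1,
    S.rep_apply_of_smul_eq (g * h) ψ (k' := h⁻¹ • g⁻¹ • k) (by rw [mul_smul, h1, h2]),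
    S.act_mul g h h1 h2]

theorem rep_add (g : Poincare) (ψ ζ : ∀ k, E k) : S.rep g (ψ + ζ) = S.rep g ψ + S.rep g ζ := by
  funext k
  exact map_add _ _ _

theorem rep_smul (g : Poincare) (f : momentumSpace m → ℂ) (ψ : ∀ k, E k) (k : momentumSpace m) :
    S.rep g (fun k => f k • ψ k) k = f (g⁻¹ • k) • S.rep g ψ k :=
  map_smul (S.act g _) _ _

theorem rep_sum {ι : Type*} (s : Finset ι) (g : Poincare) (ψ : ι → ∀ k, E k)
    (k : momentumSpace m) :
    S.rep g (fun k => ∑ i ∈ s, ψ i k) k = ∑ i ∈ s, S.rep g (ψ i) k :=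
  map_sum (S.act g _) _ _

theorem inner_rep (g : Poincare) (ψ ζ : ∀ k, E k) (k : momentumSpace m) :
    inner ℂ (S.rep g ψ k) (S.rep g ζ k) = inner ℂ (ψ (g⁻¹ • k)) (ζ (g⁻¹ • k)) :=
  (S.act g _).inner_map_map _ _

end ParticleBundle

end Particle

namespace Particle

open Bundle

variable {m : ℝ} {r : ℕ} {E : momentumSpace m → Type*} [TopologicalSpace (TotalSpace (Fiber r) E)]
  [∀ k, NormedAddCommGroup (E k)] [∀ k, InnerProductSpace ℂ (E k)]
  [FiberBundle (Fiber r) E] [VectorBundle ℂ (Fiber r) E] [VectorBundle ℝ (Fiber r) E]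
  [ContMDiffVectorBundle ∞ (Fiber r) E 𝓘(ℝ, E3)]

namespace ParticleBundle

variable (S : ParticleBundle m r E)

/-! ## The generators -/

theorem hasDerivAt_rep {g : ℝ → Poincare} (hg : IsSmoothFamily g) {ψ : ∀ k, E k}
    (hψ : SmoothSection r ψ) (k : momentumSpace m) (t : ℝ) :
    HasDerivAt (fun t => S.rep (g t) ψ k) (deriv (fun t => S.rep (g t) ψ k) t) t :=
  ((S.contDiff_rep hg hψ k).differentiable (by simp) t).hasDerivAt

theorem hasDerivAt_rep_axisRotation (a : Fin 3) {ψ : ∀ k, E k} (hψ : SmoothSection r ψ)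
    (k : momentumSpace m) :
    HasDerivAt (fun t => S.rep (rotation (axisRotation a t)) ψ k) (-Complex.I • S.J a ψ k) 0 := by
  convert! S.hasDerivAt_rep (isSmoothFamily_axisRotation a) hψ k 0 using 1
  rw [J, smul_smul, neg_mul, Complex.I_mul_I, neg_neg, one_smul]

theorem hasDerivAt_rep_boost (a : Fin 3) {ψ : ∀ k, E k} (hψ : SmoothSection r ψ)
    (k : momentumSpace m) :
    HasDerivAt (fun t => S.rep (boost a t) ψ k) (Complex.I • S.K a ψ k) 0 := by
  convert! S.hasDerivAt_rep (isSmoothFamily_boost a) hψ k 0 using 1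
  rw [K, smul_smul, mul_neg, Complex.I_mul_I, neg_neg, one_smul]

theorem J_eq_of_hasDerivAt {a : Fin 3} {ψ : ∀ k, E k} {k : momentumSpace m} {v : E k}
    (h : HasDerivAt (fun t => S.rep (rotation (axisRotation a t)) ψ k) v 0) :
    S.J a ψ k = Complex.I • v := by
  rw [J, h.deriv]

theorem K_eq_of_hasDerivAt {a : Fin 3} {ψ : ∀ k, E k} {k : momentumSpace m} {v : E k}
    (h : HasDerivAt (fun t => S.rep (boost a t) ψ k) v 0) :
    S.K a ψ k = -Complex.I • v := by
  rw [K, h.deriv]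

theorem smoothSection_deriv_rep {g : ℝ → Poincare} (hg : IsSmoothFamily g) {ψ : ∀ k, E k}
    (hψ : SmoothSection r ψ) : SmoothSection r fun k => deriv (fun t => S.rep (g t) ψ k) 0 :=
  SmoothSection.fderiv_family (φ := fun t => S.rep (g t) ψ) (S.contMDiff_rep hg hψ) 0 1

theorem smoothSection_J (a : Fin 3) {ψ : ∀ k, E k} (hψ : SmoothSection r ψ) :
    SmoothSection r (S.J a ψ) :=
  (S.smoothSection_deriv_rep (isSmoothFamily_axisRotation a) hψ).const_smul Complex.I

theorem smoothSection_K (a : Fin 3) {ψ : ∀ k, E k} (hψ : SmoothSection r ψ) :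
    SmoothSection r (S.K a ψ) :=
  (S.smoothSection_deriv_rep (isSmoothFamily_boost a) hψ).const_smul (-Complex.I)

theorem J_add (a : Fin 3) {ψ ζ : ∀ k, E k} (hψ : SmoothSection r ψ) (hζ : SmoothSection r ζ) :
    S.J a (ψ + ζ) = S.J a ψ + S.J a ζ := by
  funext k
  rw [S.J_eq_of_hasDerivAt (ψ := ψ + ζ) (by
    simp only [rep_add]
    exact (S.hasDerivAt_rep_axisRotation a hψ k).add (S.hasDerivAt_rep_axisRotation a hζ k)),
    ← smul_add, smul_smul, mul_neg, Complex.I_mul_I, neg_neg, one_smul]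
  rfl

theorem K_add (a : Fin 3) {ψ ζ : ∀ k, E k} (hψ : SmoothSection r ψ) (hζ : SmoothSection r ζ) :
    S.K a (ψ + ζ) = S.K a ψ + S.K a ζ := by
  funext k
  rw [S.K_eq_of_hasDerivAt (ψ := ψ + ζ) (by
    simp only [rep_add]
    exact (S.hasDerivAt_rep_boost a hψ k).add (S.hasDerivAt_rep_boost a hζ k)),
    ← smul_add, smul_smul, neg_mul, Complex.I_mul_I, neg_neg, one_smul]
  rfl

/-- Leibniz rule along one orbit. Only the derivative of `f` along the curve through `k` enters, so
it applies whenever that derivative is known explicitly. -/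
theorem J_smul (a : Fin 3) {f : momentumSpace m → ℂ} {ψ : ∀ k, E k} (hψ : SmoothSection r ψ)
    {k : momentumSpace m} {f' : ℂ}
    (hf : HasDerivAt (fun t => f ((rotation (axisRotation a t))⁻¹ • k)) f' 0) :
    S.J a (fun k => f k • ψ k) k = (Complex.I * f') • ψ k + f k • S.J a ψ k := by
  have h := hf.smul (S.hasDerivAt_rep_axisRotation a hψ k)
  rw [S.J_eq_of_hasDerivAt (ψ := fun k => f k • ψ k) (by simpa only [rep_smul] using! h),
    axisRotation_zero, rotation_one, inv_one, one_smul, rep_one]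
  match_scalars
  · linear_combination (-f k) * Complex.I_mul_I
  · ring

theorem K_smul (a : Fin 3) {f : momentumSpace m → ℂ} {ψ : ∀ k, E k} (hψ : SmoothSection r ψ)
    {k : momentumSpace m} {f' : ℂ}
    (hf : HasDerivAt (fun t => f ((boost a t)⁻¹ • k)) f' 0) :
    S.K a (fun k => f k • ψ k) k = (-Complex.I * f') • ψ k + f k • S.K a ψ k := by
  have h := hf.smul (S.hasDerivAt_rep_boost a hψ k)
  rw [S.K_eq_of_hasDerivAt (ψ := fun k => f k • ψ k) (by simpa only [rep_smul] using! h),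
    boost_zero, inv_one, one_smul, rep_one]
  match_scalars
  · linear_combination (-f k) * Complex.I_mul_I
  · ring

/-! ## Derivatives along general boosts and rotations -/

theorem fderiv_rep_pureBoost_single (a : Fin 3) {ψ : ∀ k, E k} (hψ : SmoothSection r ψ)
    (k : momentumSpace m) :
    fderiv ℝ (fun u => S.rep (pureBoost u) ψ k) 0 (Pi.single a 1) = Complex.I • S.K a ψ k := by
  have h1 := ((S.contDiff_rep isSmoothFamily_pureBoost hψ k).differentiable (by simp)
    0).hasFDerivAt
  have h2 : HasDerivAt (fun t : ℝ => (Pi.single a (Real.sinh t) : Fin 3 → ℝ)) (Pi.single a 1)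
      0 := by
    have := (hasDerivAt_single (𝕜 := ℝ) a (Real.sinh 0)).scomp (0 : ℝ) (Real.hasDerivAt_sinh 0)
    simpa using! this
  have h3 := HasFDerivAt.comp_hasDerivAt (0 : ℝ) (f := fun t : ℝ => (Pi.single a (Real.sinh t) : Fin 3 → ℝ))
    (by simpa using h1) h2
  refine h3.unique ?_
  convert! S.hasDerivAt_rep_boost a hψ k using 1
  funext t
  simp [boost_eq_pureBoost]

/-- The factor 2 is the inverse of the derivative `1/2` of `tan (t/2)` at `0`. -/
theorem fderiv_rep_rodrigues_single (a : Fin 3) {ψ : ∀ k, E k} (hψ : SmoothSection r ψ)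
    (k : momentumSpace m) :
    fderiv ℝ (fun v => S.rep (rotation (rodrigues v)) ψ k) 0 (Pi.single a 1)
      = -(2 * Complex.I) • S.J a ψ k := by
  have h1 := ((S.contDiff_rep isSmoothFamily_rodrigues hψ k).differentiable (by simp)
    0).hasFDerivAt
  have h0 : HasDerivAt (fun t : ℝ => Real.tan (t / 2)) (1 / 2) 0 := by
    have h := (Real.hasDerivAt_tan (x := 0 / 2) (by simp)).comp (0 : ℝ)
      ((hasDerivAt_id (0 : ℝ)).div_const 2)
    simpa using! h
  have h2 : HasDerivAt (fun t : ℝ => (Pi.single a (Real.tan (t / 2)) : Fin 3 → ℝ))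
      ((1 / 2 : ℝ) • Pi.single a 1) 0 := by
    have := (hasDerivAt_single (𝕜 := ℝ) a (Real.tan (0 / 2))).scomp (0 : ℝ) h0
    simpa using! this
  have h3 := HasFDerivAt.comp_hasDerivAt (0 : ℝ)
    (f := fun t : ℝ => (Pi.single a (Real.tan (t / 2)) : Fin 3 → ℝ)) (by simpa using h1) h2
  have h4 : (fun t => S.rep (rotation (axisRotation a t)) ψ k) =ᶠ[nhds 0]
      (fun v => S.rep (rotation (rodrigues v)) ψ k) ∘
        fun t : ℝ => (Pi.single a (Real.tan (t / 2)) : Fin 3 → ℝ) := by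
    have hc : ContinuousAt (fun t : ℝ => Real.cos (t / 2)) 0 := by fun_prop
    filter_upwards [hc.eventually_ne (y := 0) (by simp)] with t ht
    simp only [Function.comp, axisRotation_eq_rodrigues a ht]
  have h5 := (h3.congr_of_eventuallyEq h4).unique (S.hasDerivAt_rep_axisRotation a hψ k)
  rw [map_smul] at h5
  have h6 := congrArg (fun x => (2 : ℝ) • x) h5
  simp only [smul_smul] at h6
  norm_num at h6
  rw [h6]
  module

/-- The tool that converts group identities into relations between generators. The representation is
smooth in the six parameters, so its derivative at the identity is linear in them and is determined
on the boost and rotation axes. -/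
theorem hasDerivAt_rep_pureBoost_mul_rodrigues {u v : ℝ → Fin 3 → ℝ} {u' v' : Fin 3 → ℝ}
    (hu : HasDerivAt u u' 0) (hv : HasDerivAt v v' 0) (hu0 : u 0 = 0) (hv0 : v 0 = 0)
    {ψ : ∀ k, E k} (hψ : SmoothSection r ψ) (k : momentumSpace m) :
    HasDerivAt (fun t => S.rep (pureBoost (u t) * rotation (rodrigues (v t))) ψ k)
      (∑ a, (Complex.I * u' a) • S.K a ψ k - ∑ a, (2 * Complex.I * v' a) • S.J a ψ k) 0 := by
  have hfam : IsSmoothFamily fun p : (Fin 3 → ℝ) × (Fin 3 → ℝ) =>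
      pureBoost p.1 * rotation (rodrigues p.2) :=
    (isSmoothFamily_pureBoost.comp contDiff_fst).mul (isSmoothFamily_rodrigues.comp contDiff_snd)
  have h1 := ((S.contDiff_rep hfam hψ k).differentiable (by simp) 0).hasFDerivAt
  set F := fun p : (Fin 3 → ℝ) × (Fin 3 → ℝ) =>
    S.rep (pureBoost p.1 * rotation (rodrigues p.2)) ψ k with hF
  have hl : ∀ x, fderiv ℝ F 0 (x, 0) = fderiv ℝ (fun u => S.rep (pureBoost u) ψ k) 0 x := by
    intro x
    have h2 := (show HasFDerivAt F (fderiv ℝ F 0) (ContinuousLinearMap.inl ℝ (Fin 3 → ℝ) (Fin 3 → ℝ) 0)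
      from h1).comp 0 (ContinuousLinearMap.inl ℝ (Fin 3 → ℝ) (Fin 3 → ℝ)).hasFDerivAt
    have h3 : F ∘ (ContinuousLinearMap.inl ℝ (Fin 3 → ℝ) (Fin 3 → ℝ))
        = fun u => S.rep (pureBoost u) ψ k := by
      funext u
      simp [hF, rodrigues_zero, rotation_one]
    rw [h3] at h2
    rw [h2.fderiv]
    rfl
  have hr : ∀ x, fderiv ℝ F 0 (0, x)
      = fderiv ℝ (fun v => S.rep (rotation (rodrigues v)) ψ k) 0 x := by
    intro x
    have h2 := (show HasFDerivAt F (fderiv ℝ F 0) (ContinuousLinearMap.inr ℝ (Fin 3 → ℝ) (Fin 3 → ℝ) 0)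
      from h1).comp 0 (ContinuousLinearMap.inr ℝ (Fin 3 → ℝ) (Fin 3 → ℝ)).hasFDerivAt
    have h3 : F ∘ (ContinuousLinearMap.inr ℝ (Fin 3 → ℝ) (Fin 3 → ℝ))
        = fun v => S.rep (rotation (rodrigues v)) ψ k := by
      funext v
      simp [hF, pureBoost_zero]
    rw [h3] at h2
    rw [h2.fderiv]
    rfl
  have h4 := HasFDerivAt.comp_hasDerivAt (0 : ℝ) (l := F) (l' := fderiv ℝ F 0)
    (f := fun t => (u t, v t)) (by
      rw [hu0, hv0]
      exact h1) (hu.prodMk hv)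
  convert! h4 using 1
  have hsplit : ((u', v') : (Fin 3 → ℝ) × (Fin 3 → ℝ)) = (u', 0) + (0, v') := by simp
  have hpi : ∀ w : Fin 3 → ℝ, w = ∑ a, w a • Pi.single a (1 : ℝ) := fun w => by
    ext i
    simp [Finset.sum_apply, Pi.single_apply]
  rw [hsplit, map_add, hl, hr, hpi u', hpi v', map_sum, map_sum, ← hpi, ← hpi, sub_eq_add_neg,
    ← Finset.sum_neg_distrib]
  congr 1
  · refine Finset.sum_congr rfl fun a _ => ?_
    rw [map_smul, S.fderiv_rep_pureBoost_single a hψ k, ← Complex.coe_smul, smul_smul, mul_comm]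
  · refine Finset.sum_congr rfl fun a _ => ?_
    rw [map_smul, S.fderiv_rep_rodrigues_single a hψ k, ← Complex.coe_smul, smul_smul, ← neg_smul]
    congr 1
    ring

/-! ## Rotational covariance of the generators -/

/-- Derivative at `t = 0` of `R Λ_a(t) = Λ(R e_a sinh t) R`, computed on both sides. -/
theorem rep_rotation_K (R : Matrix.specialOrthogonalGroup (Fin 3) ℝ) (a : Fin 3) {ψ : ∀ k, E k}
    (hψ : SmoothSection r ψ) (k : momentumSpace m) :
    S.rep (rotation R) (S.K a ψ) k = ∑ b, (R.1 b a : ℂ) • S.K b (S.rep (rotation R) ψ) k := by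
  have h1 := (((S.act (rotation R) (smul_inv_smul (rotation R)
    k)).toContinuousLinearEquiv.toContinuousLinearMap.restrictScalars ℝ).hasFDerivAt).comp_hasDerivAt
    (0 : ℝ) (S.hasDerivAt_rep_boost a hψ ((rotation R)⁻¹ • k))
  have hu : HasDerivAt (fun t : ℝ => R.1 *ᵥ (Pi.single a (Real.sinh t) : Fin 3 → ℝ))
      (fun b => R.1 b a) 0 := by
    rw [hasDerivAt_pi]
    intro b
    simpa [Matrix.mulVec_single] using (Real.hasDerivAt_sinh 0).const_mul (R.1 b a)
  have h2 := S.hasDerivAt_rep_pureBoost_mul_rodrigues hu (hasDerivAt_const (0 : ℝ) 0)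
    (by simp) rfl (S.smoothSection_rep (rotation R) hψ) k
  have h3 : (fun t => S.rep (pureBoost (R.1 *ᵥ (Pi.single a (Real.sinh t) : Fin 3 → ℝ))
      * rotation (rodrigues 0)) (S.rep (rotation R) ψ) k)
      = fun t => S.rep (rotation R) (S.rep (boost a t) ψ) k := by
    funext t
    rw [rodrigues_zero, rotation_one, mul_one, ← rep_mul, ← rep_mul, boost_eq_pureBoost,
      rotation_mul_pureBoost]
  rw [h3] at h2
  have h4 := h1.unique h2
  have h5 : Complex.I • S.rep (rotation R) (S.K a ψ) k = _ := (map_smul (S.act (rotation R)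
    (smul_inv_smul (rotation R) k)) Complex.I _).symm.trans h4
  have h6 := congrArg (fun x => -Complex.I • x) h5
  simp only [smul_smul, neg_mul, Complex.I_mul_I, neg_neg, one_smul] at h6
  rw [h6]
  simp [Finset.smul_sum, smul_smul, ← mul_assoc]

/-- The same argument with Rodrigues vectors in place of boost vectors; the group identity holds
only near `t = 0`, which suffices. -/
theorem rep_rotation_J (R : Matrix.specialOrthogonalGroup (Fin 3) ℝ) (a : Fin 3) {ψ : ∀ k, E k}
    (hψ : SmoothSection r ψ) (k : momentumSpace m) :
    S.rep (rotation R) (S.J a ψ) k = ∑ b, (R.1 b a : ℂ) • S.J b (S.rep (rotation R) ψ) k := by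
  have h1 := (((S.act (rotation R) (smul_inv_smul (rotation R)
    k)).toContinuousLinearEquiv.toContinuousLinearMap.restrictScalars ℝ).hasFDerivAt).comp_hasDerivAt
    (0 : ℝ) (S.hasDerivAt_rep_axisRotation a hψ ((rotation R)⁻¹ • k))
  have h0 : HasDerivAt (fun t : ℝ => Real.tan (t / 2)) (1 / 2) 0 := by
    have h := (Real.hasDerivAt_tan (x := 0 / 2) (by simp)).comp (0 : ℝ)
      ((hasDerivAt_id (0 : ℝ)).div_const 2)
    simpa using! h
  have hv : HasDerivAt (fun t : ℝ => R.1 *ᵥ (Pi.single a (Real.tan (t / 2)) : Fin 3 → ℝ))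
      (fun b => R.1 b a * (1 / 2)) 0 := by
    rw [hasDerivAt_pi]
    intro b
    simpa [Matrix.mulVec_single] using h0.const_mul (R.1 b a)
  have h2 := S.hasDerivAt_rep_pureBoost_mul_rodrigues (hasDerivAt_const (0 : ℝ) 0) hv rfl
    (by simp) (S.smoothSection_rep (rotation R) hψ) k
  have h3 : (fun t => S.rep (rotation R) (S.rep (rotation (axisRotation a t)) ψ) k) =ᶠ[nhds 0]
      (fun t => S.rep (pureBoost 0 * rotation (rodrigues
        (R.1 *ᵥ (Pi.single a (Real.tan (t / 2)) : Fin 3 → ℝ)))) (S.rep (rotation R) ψ) k) := by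
    have hc : ContinuousAt (fun t : ℝ => Real.cos (t / 2)) 0 := by fun_prop
    filter_upwards [hc.eventually_ne (y := 0) (by simp)] with t ht
    rw [pureBoost_zero, one_mul, ← rep_mul, ← rep_mul, axisRotation_eq_rodrigues a ht,
      ← rotation_mul, ← rotation_mul, mul_rodrigues]
  have h4 := h1.unique (h2.congr_of_eventuallyEq h3)
  have h5 : -Complex.I • S.rep (rotation R) (S.J a ψ) k = _ := (map_smul (S.act (rotation R)
    (smul_inv_smul (rotation R) k)) (-Complex.I) _).symm.trans h4
  have h6 := congrArg (fun x => Complex.I • x) h5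
  simp only [smul_smul, mul_neg, Complex.I_mul_I, neg_neg, one_smul] at h6
  rw [h6]
  simp only [Pi.zero_apply, Complex.ofReal_zero, mul_zero, zero_smul, Finset.sum_const_zero,
    zero_sub, Finset.smul_sum, smul_smul, ← Finset.sum_neg_distrib, ← neg_smul]
  refine Finset.sum_congr rfl fun b _ => ?_
  congr 1
  push_cast
  linear_combination (-(R.1 b a : ℂ)) * Complex.I_mul_I

end ParticleBundle

end Particle

namespace Particle

open Bundle

/-! ## Derivatives of functions on momentum space -/

section Functions

variable {m : ℝ}

/-- Extension by zero reduces calculus on the open set of momenta to calculus on `ℝ³`, where Fubini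
and one-dimensional integration apply. -/
theorem hasFDerivAt_extend {f : momentumSpace m → ℂ} (hf : SmoothFun f) (k : momentumSpace m) :
    HasFDerivAt (Function.extend Subtype.val f 0)
      (mfderiv 𝓘(ℝ, E3) 𝓘(ℝ, ℂ) f k : E3 →L[ℝ] ℂ) k.1 := by
  have h := ((hf k).mdifferentiableAt (by simp)).hasMFDerivAt.2
  simp only [writtenInExtChartAt, modelWithCornersSelf_coe, Set.range_id] at h
  have h1 := h.hasFDerivAt Filter.univ_mem
  refine HasFDerivAt.congr_of_eventuallyEq h1 ?_
  filter_upwards [(momentumSpace m).isOpen.mem_nhds k.2] with y hy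
  have h2 : (extChartAt 𝓘(ℝ, E3) k).symm y = ⟨y, hy⟩ := by
    have := (extChartAt 𝓘(ℝ, E3) k).left_inv (x := ⟨y, hy⟩) (by
      simp [extChartAt, TopologicalSpace.Opens.chartAt_eq, OpenPartialHomeomorph.subtypeRestr,
        chartAt_self_eq])
    exact this
  simp only [Function.comp, h2]
  exact Subtype.val_injective.extend_apply f 0 ⟨y, hy⟩

theorem hasDerivAt_comp_curve {f : momentumSpace m → ℂ} (hf : SmoothFun f)
    {c : ℝ → momentumSpace m} {w : Fin 3 → ℝ} {t₀ : ℝ}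
    (hc : ∀ b, HasDerivAt (fun t => (c t).1 b) (w b) t₀) :
    HasDerivAt (fun t => f (c t)) (∑ b, w b * partialDeriv b f (c t₀)) t₀ := by
  have h1 : HasDerivAt (fun t => (c t).1) (WithLp.toLp 2 w) t₀ := by
    have := (PiLp.continuousLinearEquiv 2 ℝ fun _ : Fin 3 => ℝ).symm.hasFDerivAt.comp_hasDerivAt t₀
      (hasDerivAt_pi.mpr hc)
    exact this
  have h2 := (hasFDerivAt_extend hf (c t₀)).comp_hasDerivAt t₀ h1
  have h3 : (Function.extend Subtype.val f 0) ∘ (fun t => (c t).1) = fun t => f (c t) := by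
    funext t
    exact Subtype.val_injective.extend_apply f 0 (c t)
  rw [h3] at h2
  have key : ∀ A : E3 →L[ℝ] ℂ,
      ∑ b, (w b : ℂ) * A (EuclideanSpace.single b 1) = A (WithLp.toLp 2 w) := by
    intro A
    have h4 : WithLp.toLp 2 w = ∑ b, w b • (EuclideanSpace.single b (1 : ℝ) : E3) := by
      ext i
      simp [Finset.sum_apply, Pi.single_apply]
    rw [h4, map_sum]
    exact Finset.sum_congr rfl fun b _ => by rw [map_smul, Complex.real_smul]
  convert! h2 using 1
  exact key _

theorem smoothFun_ofReal {f : momentumSpace m → ℝ} (hf : ContMDiff 𝓘(ℝ, E3) 𝓘(ℝ, ℝ) ∞ f) :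
    SmoothFun fun k => (f k : ℂ) :=
  Complex.ofRealCLM.contDiff.contMDiff.comp hf

theorem SmoothFun.mul {f g : momentumSpace m → ℂ} (hf : SmoothFun f) (hg : SmoothFun g) :
    SmoothFun fun k => f k * g k :=
  (contDiff_mul (𝕜 := ℝ) (𝔸 := ℂ) (n := ∞)).contMDiff.comp (hf.prodMk_space hg)

theorem smoothFun_coord (a : Fin 3) : SmoothFun fun k : momentumSpace m => (k.1 a : ℂ) :=
  smoothFun_ofReal (contMDiff_coord a)

theorem smoothFun_energy_inv : SmoothFun fun k : momentumSpace m => ((energy k : ℂ))⁻¹ := by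
  have h : ContMDiff 𝓘(ℝ, E3) 𝓘(ℝ, ℝ) ∞ fun k : momentumSpace m => (energy k)⁻¹ :=
    fun k => ContDiffAt.comp_contMDiffAt (g := fun x : ℝ => x⁻¹)
      (contDiffAt_inv ℝ (energy_pos k).ne') (contMDiff_energy k)
  simpa only [Complex.ofReal_inv] using smoothFun_ofReal h

/-! ## Infinitesimal boosts and rotations of momenta -/

theorem fourMomentum_boost_inv (a : Fin 3) (t : ℝ) (k : momentumSpace m) :
    fourMomentum ((boost a t)⁻¹ • k) = boostMatrix a (-t) *ᵥ fourMomentum k := by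
  rw [fourMomentum_smul, boost_inv]
  rfl

/-- A boost is a hyperbolic rotation of the `(ω, k_a)` plane. The velocity is exactly `-ω e_a`,
which is why dividing `K_a` by `ω` gives a derivative along `e_a`. -/
theorem hasDerivAt_boost_inv_smul (a : Fin 3) (k : momentumSpace m) (b : Fin 3) :
    HasDerivAt (fun t => ((boost a t)⁻¹ • k).1 b) ((-energy k) * Pi.single (M := fun _ => ℝ) a 1 b)
      0 := by
  have h : ∀ t, ((boost a t)⁻¹ • k).1 b = if b = a then
      Real.cosh t * k.1 b - Real.sinh t * energy k else k.1 b := by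
    intro t
    have := congrFun (fourMomentum_boost_inv a t k) (Sum.inr b)
    change ((boost a t)⁻¹ • k).1 b = _ at this
    rw [this]
    by_cases hb : b = a <;>
      simp [boostMatrix, Matrix.mulVec, dotProduct, Fintype.sum_sum_type, fourMomentum,
        Matrix.diagonal_apply, hb]
    ring
  simp only [h]
  by_cases hb : b = a
  · subst hb
    simpa using! ((Real.hasDerivAt_cosh 0).mul_const (k.1 b)).sub
      ((Real.hasDerivAt_sinh 0).mul_const (energy k))
  · simpa [hb] using hasDerivAt_const (0 : ℝ) (k.1 b)

/-- The other component of the hyperbolic rotation; it produces the commutator of `K_a` with `H⁻¹`.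
-/
theorem hasDerivAt_energy_boost_inv_smul (a : Fin 3) (k : momentumSpace m) :
    HasDerivAt (fun t => energy ((boost a t)⁻¹ • k)) (-k.1 a) 0 := by
  have h : ∀ t, energy ((boost a t)⁻¹ • k) = Real.cosh t * energy k - Real.sinh t * k.1 a := by
    intro t
    have := congrFun (fourMomentum_boost_inv a t k) (Sum.inl ())
    change energy ((boost a t)⁻¹ • k) = _ at this
    rw [this]
    simp [boostMatrix, Matrix.mulVec, dotProduct, Fintype.sum_sum_type, fourMomentum]
    ring
  simp only [h]
  simpa using! ((Real.hasDerivAt_cosh 0).mul_const (energy k)).sub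
    ((Real.hasDerivAt_sinh 0).mul_const (k.1 a))

theorem rotation_smul_val (R : Matrix.specialOrthogonalGroup (Fin 3) ℝ) (k : momentumSpace m)
    (b : Fin 3) : (rotation R • k).1 b = ∑ c, R.1 b c * k.1 c := by
  rw [smul_val, rotation_mat]
  simp [Matrix.mulVec, dotProduct, Fintype.sum_sum_type, fourMomentum]

theorem energy_rotation_smul (R : Matrix.specialOrthogonalGroup (Fin 3) ℝ)
    (k : momentumSpace m) : energy (rotation R • k) = energy k := by
  have h := congrFun (fourMomentum_smul (rotation R) k) (Sum.inl ())
  change energy _ = _ at h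
  rw [h, rotation_mat]
  simp [Matrix.mulVec, dotProduct, Fintype.sum_sum_type, fourMomentum]

theorem hasDerivAt_axisRotation_inv_smul (a : Fin 3) (k : momentumSpace m) (b : Fin 3) :
    HasDerivAt (fun t => ((rotation (axisRotation a t))⁻¹ • k).1 b)
      (crossProduct (fun b => k.1 b) (Pi.single a 1) b) 0 := by
  simp only [← rotation_inv, ← axisRotation_neg, rotation_smul_val,
    Fin.sum_univ_three]
  have hs : ∀ x : ℝ, HasDerivAt (fun t => Real.sin (-t) * x) (-x) 0 := fun x => by
    simpa using! ((Real.hasDerivAt_sin 0).mul_const x).neg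
  have hs' : ∀ x : ℝ, HasDerivAt (fun t => Real.sin t * x) x 0 := fun x => by
    simpa using! (Real.hasDerivAt_sin 0).mul_const x
  have hc : ∀ x : ℝ, HasDerivAt (fun t => Real.cos (-t) * x) 0 0 := fun x => by
    simpa using (Real.hasDerivAt_cos 0).mul_const x
  have hk : ∀ x : ℝ, HasDerivAt (fun _ : ℝ => x) 0 0 := fun x => hasDerivAt_const _ _
  fin_cases a <;> fin_cases b <;> simp [axisRotation, axisRotationMatrix, cross_apply] <;>
  · first
    | exact hk _
    | simpa using! (hc _).add (hs _)
    | simpa using! (hs _).add (hc _)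
    | simpa using! (hc _).sub (hs _)
    | simpa using! (hs _).sub (hc _)
    | simpa using! (hc _).add (hs' _)
    | simpa using! (hs' _).add (hc _)

end Functions

variable {m : ℝ} {r : ℕ} {E : momentumSpace m → Type*} [TopologicalSpace (TotalSpace (Fiber r) E)]
  [∀ k, NormedAddCommGroup (E k)] [∀ k, InnerProductSpace ℂ (E k)]
  [FiberBundle (Fiber r) E] [VectorBundle ℂ (Fiber r) E] [VectorBundle ℝ (Fiber r) E]
  [ContMDiffVectorBundle ∞ (Fiber r) E 𝓘(ℝ, E3)]

namespace ParticleBundle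

variable (S : ParticleBundle m r E)

/-! ## The boost connection -/

/-- `K_a (f ψ) = i ω ∂_a f ψ + f K_a ψ`. -/
theorem K_smul_partialDeriv (a : Fin 3) {f : momentumSpace m → ℂ} {ψ : ∀ k, E k}
    (hf : SmoothFun f) (hψ : SmoothSection r ψ) (k : momentumSpace m) :
    S.K a (fun k => f k • ψ k) k
      = (Complex.I * energy k * partialDeriv a f k) • ψ k + f k • S.K a ψ k := by
  have h := hasDerivAt_comp_curve hf (hasDerivAt_boost_inv_smul a k)
  rw [S.K_smul a hψ h, boost_zero, inv_one, one_smul,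
    Finset.sum_eq_single a (fun b _ hb => by simp [hb]) (by simp)]
  congr 2
  simp
  ring

theorem opHinv_smooth {ψ : ∀ k, E k} (hψ : SmoothSection r ψ) : SmoothSection r (opHinv ψ) :=
  SmoothSection.smul smoothFun_energy_inv hψ

theorem K_opHinv (a : Fin 3) {ψ : ∀ k, E k} (hψ : SmoothSection r ψ) (k : momentumSpace m) :
    S.K a (opHinv ψ) k = (-Complex.I * (k.1 a / (energy k : ℂ) ^ 2)) • ψ k
      + (energy k : ℂ)⁻¹ • S.K a ψ k := by
  have h0 : (boost a 0)⁻¹ • k = k := by rw [boost_zero, inv_one, one_smul]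
  have h1 := (hasDerivAt_energy_boost_inv_smul a k).ofReal_comp.inv
    (by rw [h0]; exact Complex.ofReal_ne_zero.mpr (energy_pos k).ne')
  rw [h0] at h1
  refine (S.K_smul a (f := fun k => (energy k : ℂ)⁻¹) hψ h1).trans ?_
  simp

/-- The components of the boost connection. -/
noncomputable def boostD (a : Fin 3) : Op E :=
  fun ψ k => -(Complex.I / 2) • (opHinv (S.K a ψ) + S.K a (opHinv ψ)) k

theorem boostConnection_apply (X : VField m) (ψ : ∀ k, E k) (k : momentumSpace m) :
    S.boostConnection X ψ k = ∑ a, X k a • S.boostD a ψ k := rfl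

/-- Form with `H⁻¹` moved to the left. The symmetric ordering leaves half of the commutator term as
a real scalar. -/
theorem boostD_apply (a : Fin 3) {ψ : ∀ k, E k} (hψ : SmoothSection r ψ) (k : momentumSpace m) :
    S.boostD a ψ k = -(Complex.I * (energy k : ℂ)⁻¹) • S.K a ψ k
      - (k.1 a / (2 * (energy k : ℂ) ^ 2)) • ψ k := by
  rw [boostD, Pi.add_apply, S.K_opHinv a hψ, opHinv]
  match_scalars
  · ring
  · ring_nf
    rw [Complex.I_sq]
    ring

theorem boostD_smooth (a : Fin 3) {ψ : ∀ k, E k} (hψ : SmoothSection r ψ) :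
    SmoothSection r (S.boostD a ψ) :=
  ((opHinv_smooth (S.smoothSection_K a hψ)).add
    (S.smoothSection_K a (opHinv_smooth hψ))).const_smul _

theorem boostD_add (a : Fin 3) {ψ ζ : ∀ k, E k} (hψ : SmoothSection r ψ)
    (hζ : SmoothSection r ζ) (k : momentumSpace m) :
    S.boostD a (ψ + ζ) k = S.boostD a ψ k + S.boostD a ζ k := by
  rw [S.boostD_apply a hψ, S.boostD_apply a hζ, S.boostD_apply a (hψ.add hζ), S.K_add a hψ hζ]
  simp only [Pi.add_apply]
  module

/-- The factors `-i ω⁻¹` and `i ω` cancel, leaving `∂_a f`; the scalar term commutes with `f`. -/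
theorem boostD_smul (a : Fin 3) {f : momentumSpace m → ℂ} {ψ : ∀ k, E k}
    (hf : SmoothFun f) (hψ : SmoothSection r ψ) (k : momentumSpace m) :
    S.boostD a (fun k => f k • ψ k) k = partialDeriv a f k • ψ k + f k • S.boostD a ψ k := by
  rw [S.boostD_apply a hψ, S.boostD_apply a (hψ.smul hf), S.K_smul_partialDeriv a hf hψ]
  have h : (energy k : ℂ) ≠ 0 := Complex.ofReal_ne_zero.mpr (energy_pos k).ne'
  match_scalars
  · field_simp
    linear_combination (-2 * energy k ^ 2 * partialDeriv a f k) * Complex.I_sq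
  · ring

theorem isConnection_boostConnection : IsConnection r S.boostConnection where
  smooth X ψ hX hψ := SmoothSection.sum _ fun a => (S.boostD_smooth a hψ).smul (hX a)
  add_field X Y ψ _ _ _ := by
    funext k
    simp only [boostConnection_apply, Pi.add_apply, add_smul, Finset.sum_add_distrib]
  smul_field f X ψ _ _ _ := by
    funext k
    simp only [boostConnection_apply, Pi.smul_apply, smul_eq_mul, mul_smul, Finset.smul_sum]
  add_section X ψ ζ _ hψ hζ := by
    funext k
    simp only [boostConnection_apply, Pi.add_apply, S.boostD_add _ hψ hζ, smul_add,
      Finset.sum_add_distrib]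
  leibniz f X ψ hf _ hψ := by
    funext k
    simp only [boostConnection_apply, S.boostD_smul _ hf hψ, smul_add, Finset.sum_add_distrib,
      dAlong, Finset.sum_smul, Finset.smul_sum, smul_smul, mul_comm (f k)]

theorem boostConnection_eq (X : VField m) {ψ : ∀ k, E k} (hψ : SmoothSection r ψ)
    (k : momentumSpace m) :
    S.boostConnection X ψ k = ∑ a, X k a •
      (-Complex.I • opHinv (S.K a ψ - (Complex.I / 2) • opHinv (opP a ψ)) k) := by
  rw [boostConnection_apply]
  refine Finset.sum_congr rfl fun a _ => ?_
  rw [S.boostD_apply a hψ]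
  simp only [opHinv, opP, Pi.sub_apply, Pi.smul_apply]
  congr 1
  match_scalars
  · ring
  · ring_nf
    rw [Complex.I_sq]
    ring

/-! ### Rotational symmetry of the boost connection -/

/-- Both terms of the components are vectors: `K` and `k` rotate with `R`, while `ω` is invariant.
-/
theorem rep_rotation_boostD (R : Matrix.specialOrthogonalGroup (Fin 3) ℝ) (a : Fin 3)
    {ψ : ∀ k, E k} (hψ : SmoothSection r ψ) (k : momentumSpace m) :
    S.rep (rotation R) (S.boostD a ψ) k
      = ∑ b, (R.1 b a : ℂ) • S.boostD b (S.rep (rotation R) ψ) k := by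
  have h1 : S.boostD a ψ = fun k => -(Complex.I * (energy k : ℂ)⁻¹) • S.K a ψ k
      + (-(k.1 a / (2 * (energy k : ℂ) ^ 2))) • ψ k := by
    funext k
    rw [S.boostD_apply a hψ, neg_smul (_ / _), sub_eq_add_neg]
  have h2 : energy ((rotation R)⁻¹ • k) = energy k := by
    rw [← rotation_inv, energy_rotation_smul]
  have h3 : ((rotation R)⁻¹ • k).1 a = ∑ b, R.1 b a * k.1 b := by
    rw [← rotation_inv, rotation_smul_val]
    rfl
  have hadd : ∀ φ χ : ∀ k, E k, S.rep (rotation R) (fun k => φ k + χ k) k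
      = S.rep (rotation R) φ k + S.rep (rotation R) χ k :=
    fun φ χ => congrFun (S.rep_add (rotation R) φ χ) k
  rw [h1, hadd, S.rep_smul, S.rep_smul (f := fun k => -(k.1 a / (2 * (energy k : ℂ) ^ 2))),
    h2, h3, S.rep_rotation_K R a hψ]
  simp only [S.boostD_apply _ (S.smoothSection_rep (rotation R) hψ)]
  push_cast
  simp only [smul_sub, Finset.sum_sub_distrib, Finset.smul_sum, smul_smul]
  rw [← Finset.sum_smul, neg_smul (_ / _), ← sub_eq_add_neg]
  congr 1
  · exact Finset.sum_congr rfl fun b _ => by rw [mul_comm]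
  · congr 1
    rw [Finset.sum_div]
    exact Finset.sum_congr rfl fun b _ => by ring

theorem isRotationallySymmetric_boostConnection :
    S.IsRotationallySymmetric S.boostConnection := by
  intro R X ψ _ hψ
  funext k
  have h1 : S.rep (rotation R) (S.rep (rotation R⁻¹) ψ) = ψ := by
    rw [← rep_mul, rotation_inv, mul_inv_cancel, rep_one]
  have h2 : S.boostConnection X (S.rep (rotation R⁻¹) ψ)
      = fun k => ∑ a, X k a • S.boostD a (S.rep (rotation R⁻¹) ψ) k := rfl
  rw [h2, rep_sum, boostConnection_apply]
  simp only [S.rep_smul _ (fun k => X k _), S.rep_rotation_boostD R _ (S.smoothSection_rep _ hψ),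
    h1, VField.rotate, Matrix.mulVec, dotProduct, Finset.sum_smul, Finset.smul_sum, smul_smul,
    Matrix.map_apply]
  -- Exchanging the sums moves `R` from the operators `D_a` to the components of the vector field.
  rw [Finset.sum_comm]
  simp only [mul_comm]

end ParticleBundle

end Particle

namespace Particle

open Bundle MeasureTheory

/-! ## Integrals of partial derivatives -/

/-- The integral of a partial derivative over Euclidean space vanishes, provided that the function
and its derivative are integrable. The function need not be differentiable at the origin. -/
theorem integral_partial_eq_zero (a : Fin 3) {F F' : E3 → ℂ} (hF : Integrable F)
    (hF' : Integrable F')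
    (h : ∀ y, y ≠ 0 → HasDerivAt (fun t : ℝ => F (y + t • EuclideanSpace.single a 1)) (F' y) 0) :
    ∫ y, F' y = 0 := by
  let e : ℝ × (Fin 2 → ℝ) ≃ᵐ E3 :=
    (MeasurableEquiv.piFinSuccAbove (fun _ : Fin 3 => ℝ) a).symm.trans
      (MeasurableEquiv.toLp 2 (Fin 3 → ℝ))
  have he : MeasurePreserving e :=
    (PiLp.volume_preserving_toLp (Fin 3)).comp
      (volume_preserving_piFinSuccAbove (fun _ : Fin 3 => ℝ) a).symm
  have hline : ∀ s t y, e (s, y) = e (t, y) + (s - t) • EuclideanSpace.single a 1 := by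
    intro s t y
    ext i
    change (a.insertNth s y : Fin 3 → ℝ) i = (a.insertNth t y : Fin 3 → ℝ) i
      + (s - t) * (EuclideanSpace.single a (1 : ℝ) : E3) i
    refine Fin.succAboveCases a ?_ (fun j => ?_) i
    · simp
    · simp [Fin.succAbove_ne]
  have hne : ∀ t y, y ≠ 0 → e (t, y) ≠ 0 := by
    intro t y hy h0
    refine hy (funext fun j => ?_)
    have h1 : (a.insertNth t y : Fin 3 → ℝ) (a.succAbove j) = 0 :=
      congrArg (fun v : E3 => v (a.succAbove j)) h0
    simpa using h1
  have hi : Integrable fun p => F (e p) := he.integrable_comp_of_integrable hF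
  have hi' : Integrable fun p => F' (e p) := he.integrable_comp_of_integrable hF'
  rw [← he.integral_comp' F']
  rw [Measure.volume_eq_prod] at hi hi' ⊢
  rw [integral_prod_symm _ hi']
  refine integral_eq_zero_of_ae ?_
  -- The excluded parameter is the single line through the origin, where the function may fail to be
  -- differentiable.
  have h0 : ∀ᵐ y : Fin 2 → ℝ, y ≠ 0 := compl_mem_ae_iff.mpr (measure_singleton 0)
  filter_upwards [hi.prod_left_ae, hi'.prod_left_ae, h0] with y h1 h2 h3
  refine integral_eq_zero_of_hasDerivAt_of_integrable (f := fun t => F (e (t, y))) (fun t => ?_)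
    h2 h1
  have h4 := h (e (t, y)) (hne t y h3)
  have h5 := HasDerivAt.comp_sub_const (x := t) (a := t) (by rw [sub_self]; exact h4)
  convert! h5 using 1
  funext s
  rw [← hline s t y]

variable {m : ℝ} {r : ℕ} {E : momentumSpace m → Type*} [TopologicalSpace (TotalSpace (Fiber r) E)]
  [∀ k, NormedAddCommGroup (E k)] [∀ k, InnerProductSpace ℂ (E k)]
  [FiberBundle (Fiber r) E] [VectorBundle ℂ (Fiber r) E] [VectorBundle ℝ (Fiber r) E]
  [ContMDiffVectorBundle ∞ (Fiber r) E 𝓘(ℝ, E3)]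

theorem integrable_extend {f : momentumSpace m → ℂ} (hf : Integrable f (d3k m)) :
    Integrable (Function.extend Subtype.val f 0) := by
  have hs : MeasurableSet (momentumSpace m : Set E3) := (momentumSpace m).isOpen.measurableSet
  have h1 : IntegrableOn (Function.extend Subtype.val f 0) (momentumSpace m : Set E3) := by
    rw [integrableOn_iff_comap_subtypeVal hs]
    change Integrable (Function.extend Subtype.val f 0 ∘ (Subtype.val : momentumSpace m → E3)) _
    rw [Function.extend_comp Subtype.val_injective f 0]
    exact hf
  refine (integrableOn_iff_integrable_of_support_subset ?_).mp h1
  intro x hx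
  by_contra hx'
  exact hx (Function.extend_apply' (f := (Subtype.val : momentumSpace m → E3)) f 0 x (by rintro ⟨y, rfl⟩; exact hx' y.2))

theorem integral_extend (f : momentumSpace m → ℂ) :
    ∫ y, Function.extend Subtype.val f 0 y = ∫ k, f k ∂(d3k m) := by
  have hs : MeasurableSet (momentumSpace m : Set E3) := (momentumSpace m).isOpen.measurableSet
  have h1 := integral_subtype_comap hs (μ := volume) (Function.extend Subtype.val f 0)
  rw [setIntegral_eq_integral_of_forall_compl_eq_zero (fun x hx =>
    Function.extend_apply' (f := (Subtype.val : momentumSpace m → E3)) f 0 x (by rintro ⟨y, rfl⟩; exact hx y.2))] at h1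
  rw [← h1]
  refine integral_congr_ae (Filter.Eventually.of_forall fun k => ?_)
  exact Subtype.val_injective.extend_apply f 0 k

/-- The integral of a partial derivative over momentum space vanishes. -/
theorem integral_partialDeriv_eq_zero (a : Fin 3) {f : momentumSpace m → ℂ} (hf : SmoothFun f)
    (hi : Integrable f (d3k m)) (hi' : Integrable (partialDeriv a f) (d3k m)) :
    ∫ k, partialDeriv a f k ∂(d3k m) = 0 := by
  rw [← integral_extend]
  refine integral_partial_eq_zero a (integrable_extend hi) (integrable_extend hi') fun y hy => ?_
  have hm : y ∈ momentumSpace m := Or.inr hy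
  have h1 := hasFDerivAt_extend hf ⟨y, hm⟩
  have h2 : HasDerivAt (fun t : ℝ => y + t • (EuclideanSpace.single a 1 : E3))
      (EuclideanSpace.single a 1) 0 := by
    simpa using! ((hasDerivAt_id (0 : ℝ)).smul_const (EuclideanSpace.single a 1 : E3)).const_add y
  have h3 := HasFDerivAt.comp_hasDerivAt (0 : ℝ)
    (f := fun t : ℝ => y + t • (EuclideanSpace.single a 1 : E3)) (by simpa using! h1) h2
  convert! h3 using 1
  exact Subtype.val_injective.extend_apply (partialDeriv a f) 0 ⟨y, hm⟩

namespace ParticleBundle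

variable (S : ParticleBundle m r E)

/-! ### Anti-Hermiticity of the boost connection -/

theorem smoothFun_inner (S : ParticleBundle m r E) {ψ ζ : ∀ k, E k} (hψ : SmoothSection r ψ) (hζ : SmoothSection r ζ) :
    SmoothFun fun k => inner ℂ (ψ k) (ζ k) :=
  contMDiffOn_univ.mp (S.smooth_inner Set.univ ψ ζ isOpen_univ (ContMDiff.contMDiffOn hψ)
    (ContMDiff.contMDiffOn hζ))

theorem integrable_inner (S : ParticleBundle m r E) {ψ ζ : ∀ k, E k} (hψ : SmoothSection r ψ) (hζ : SmoothSection r ζ)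
    (hiψ : SquareIntegrable ψ) (hiζ : SquareIntegrable ζ) :
    Integrable (fun k : momentumSpace m => ((energy k)⁻¹ : ℂ) * inner ℂ (ψ k) (ζ k)) (d3k m) := by
  refine Integrable.mono' (hiψ.add hiζ) ?_ (Filter.Eventually.of_forall fun k => ?_)
  · have h := smoothFun_energy_inv.mul (S.smoothFun_inner hψ hζ)
    exact (ContMDiff.continuous h).aestronglyMeasurable
  · have h0 : 0 < (energy k)⁻¹ := inv_pos.mpr (energy_pos k)
    rw [norm_mul, norm_inv, Complex.norm_real, Real.norm_of_nonneg (energy_pos k).le,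
      Pi.add_apply, ← mul_add]
    refine mul_le_mul_of_nonneg_left ((norm_inner_le_norm _ _).trans ?_) h0.le
    nlinarith [sq_nonneg (‖ψ k‖ - ‖ζ k‖), sq_nonneg (‖ψ k‖ + ‖ζ k‖)]

/-- Fiberwise unitarity means that `⟨Σ̃ψ, Σ̃ζ⟩` at `k` is `⟨ψ, ζ⟩` at the inversely boosted
momentum. Differentiating gives the `K` terms; the derivative of the density `ω⁻¹` splits evenly
between the scalar corrections of the two arguments. -/
theorem partialDeriv_inner (a : Fin 3) {ψ ζ : ∀ k, E k} (hψ : SmoothSection r ψ)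
    (hζ : SmoothSection r ζ) (k : momentumSpace m) :
    partialDeriv a (fun k => ((energy k)⁻¹ : ℂ) * inner ℂ (ψ k) (ζ k)) k
      = ((energy k)⁻¹ : ℂ) * inner ℂ (S.boostD a ψ k) (ζ k)
        + ((energy k)⁻¹ : ℂ) * inner ℂ (ψ k) (S.boostD a ζ k) := by
  have hF := smoothFun_energy_inv.mul (S.smoothFun_inner hψ hζ)
  have hω : (energy k : ℂ) ≠ 0 := Complex.ofReal_ne_zero.mpr (energy_pos k).ne'
  have h0 : (boost a 0)⁻¹ • k = k := by rw [boost_zero, inv_one, one_smul]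
  have h1 := hasDerivAt_comp_curve hF (hasDerivAt_boost_inv_smul a k)
  rw [h0, Finset.sum_eq_single a (fun b _ hb => by simp [hb]) (by simp)] at h1
  have h2 := (hasDerivAt_energy_boost_inv_smul a k).ofReal_comp.inv (by rw [h0]; exact hω)
  have h3 := (S.hasDerivAt_rep_boost a hψ k).inner ℂ (S.hasDerivAt_rep_boost a hζ k)
  simp only [S.inner_rep] at h3
  have h4 := h1.unique (h2.mul h3)
  simp only [Pi.inv_apply] at h4
  rw [h0, boost_zero, rep_one, rep_one] at h4
  rw [S.boostD_apply a hψ, S.boostD_apply a hζ]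
  simp only [inner_smul_left, inner_smul_right, inner_sub_left, inner_sub_right, map_neg, map_mul,
    map_div₀, map_inv₀, map_pow, Complex.conj_I, Complex.conj_ofReal, map_ofNat] at h4 ⊢
  simp only [Pi.single_eq_same, mul_one] at h4
  push_cast at h4
  have h5 : ∀ x y : ℂ, -(energy k : ℂ) * x = y → x = -(energy k : ℂ)⁻¹ * y := by
    rintro x y rfl
    field_simp
  rw [h5 _ _ h4]
  field_simp
  ring

theorem isAntiHermitian_boostConnection : IsAntiHermitian r S.boostConnection := by
  intro a ψ ζ hψ hζ hiψ hiζ hDψ hDζ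
  have hD : ∀ φ : ∀ k, E k, S.boostConnection (constField a) φ = S.boostD a φ := by
    intro φ
    funext k
    rw [boostConnection_apply, Finset.sum_eq_single a]
    · simp [constField]
    · intro b _ hb
      simp [constField, hb]
    · simp
  rw [hD] at hDψ hDζ ⊢
  rw [hD]
  have h1 := S.integrable_inner (S.boostD_smooth a hψ) hζ hDψ hiζ
  have h2 := S.integrable_inner hψ (S.boostD_smooth a hζ) hiψ hDζ
  have h3 := funext (S.partialDeriv_inner a hψ hζ)
  have h4 := integral_partialDeriv_eq_zero a (smoothFun_energy_inv.mul (S.smoothFun_inner hψ hζ))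
    (S.integrable_inner hψ hζ hiψ hiζ) (by
      rw [h3]
      exact h1.add h2)
  rw [h3, integral_add h1 h2] at h4
  unfold secInner
  have h5 : ∀ k, ((energy k)⁻¹ : ℂ) * inner ℂ ((Complex.I • S.boostD a ψ) k) (ζ k)
      = -Complex.I * (((energy k)⁻¹ : ℂ) * inner ℂ (S.boostD a ψ k) (ζ k)) := by
    intro k
    rw [Pi.smul_apply, inner_smul_left, Complex.conj_I]
    ring
  have h6 : ∀ k, ((energy k)⁻¹ : ℂ) * inner ℂ (ψ k) ((Complex.I • S.boostD a ζ) k)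
      = Complex.I * (((energy k)⁻¹ : ℂ) * inner ℂ (ψ k) (S.boostD a ζ k)) := by
    intro k
    rw [Pi.smul_apply, inner_smul_right]
    ring
  simp only [h5, h6, integral_const_mul]
  linear_combination (-Complex.I) * h4

end ParticleBundle

end Particle

namespace Particle

open Bundle

/-! ### Interchange of derivatives, infinitesimal rotations and a trace argument -/

/-- Symmetry of the second derivative, stated with existence of the outer derivative so that it can
be compared with other derivatives by uniqueness. -/
theorem hasDerivAt_deriv_comm {V : Type*} [NormedAddCommGroup V] [NormedSpace ℝ V]
    {F : ℝ × ℝ → V} (hF : ContDiff ℝ ∞ F) :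
    HasDerivAt (fun t => deriv (fun s => F (s, t)) 0)
      (deriv (fun s => deriv (fun t => F (s, t)) 0) 0) 0 := by
  have hd : ∀ p, HasFDerivAt F (fderiv ℝ F p) p := fun p =>
    (hF.differentiable (by simp) p).hasFDerivAt
  have hl : ∀ s t : ℝ, HasDerivAt (fun s => (s, t)) ((1, 0) : ℝ × ℝ) s := fun s t =>
    (hasDerivAt_id s).prodMk (hasDerivAt_const s t)
  have hr : ∀ s t : ℝ, HasDerivAt (fun t => (s, t)) ((0, 1) : ℝ × ℝ) t := fun s t =>
    (hasDerivAt_const t s).prodMk (hasDerivAt_id t)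
  have h1 : ∀ s t, deriv (fun s => F (s, t)) s = fderiv ℝ F (s, t) (1, 0) := fun s t =>
    ((hd (s, t)).comp_hasDerivAt s (hl s t)).deriv
  have h2 : ∀ s t, deriv (fun t => F (s, t)) t = fderiv ℝ F (s, t) (0, 1) := fun s t =>
    ((hd (s, t)).comp_hasDerivAt t (hr s t)).deriv
  have hdd : HasFDerivAt (fderiv ℝ F) (fderiv ℝ (fderiv ℝ F) (0, 0)) (0, 0) :=
    ((hF.fderiv_right (m := 1) (by norm_cast)).differentiable (by simp) _).hasFDerivAt
  have h3 := (HasFDerivAt.comp_hasDerivAt (0 : ℝ) (f := fun t : ℝ => ((0 : ℝ), t)) hdd (hr 0 0)).clm_apply (hasDerivAt_const (0 : ℝ) ((1 : ℝ), (0 : ℝ)))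
  have h4 := (HasFDerivAt.comp_hasDerivAt (0 : ℝ) (f := fun s : ℝ => (s, (0 : ℝ))) hdd (hl 0 0)).clm_apply (hasDerivAt_const (0 : ℝ) ((0 : ℝ), (1 : ℝ)))
  have hsymm : IsSymmSndFDerivAt ℝ F (0, 0) :=
    hF.contDiffAt.isSymmSndFDerivAt (by
      rw [minSmoothness_of_isRCLikeNormedField]
      have h : (1 : ℕ∞ω) + 1 ≤ ∞ := by norm_cast
      rwa [one_add_one_eq_two] at h)
  simp only [h1, h2]
  have h5 : deriv (fun s => fderiv ℝ F (s, 0) (0, 1)) 0 = _ := h4.deriv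
  rw [h5]
  convert! h3 using 1
  simp only [map_zero, add_zero]
  exact hsymm.eq _ _

theorem hasDerivAt_axisRotation (a b c : Fin 3) :
    HasDerivAt (fun t => (axisRotation a t).1 b c) (skew (Pi.single a 1) b c) 0 := by
  have hs : HasDerivAt Real.sin 1 0 := by simpa using Real.hasDerivAt_sin 0
  have hc : HasDerivAt Real.cos 0 0 := by simpa using Real.hasDerivAt_cos 0
  have hn : HasDerivAt (fun t => -Real.sin t) (-1) 0 := hs.neg
  fin_cases a <;> fin_cases b <;> fin_cases c <;>
    simp [axisRotation, axisRotationMatrix, skew] <;>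
    first
    | exact hs
    | exact hc
    | exact hn
    | exact hasDerivAt_const _ _

theorem skew_single_eq_neg_eps (a b c : Fin 3) :
    ((skew (Pi.single b 1) c a : ℝ) : ℂ) = -eps a b c := by
  fin_cases a <;> fin_cases b <;> fin_cases c <;> simp [skew, eps, cross_apply]

/-- On a finite dimensional Hilbert space, a skew-adjoint operator `B` which commutes with `A` and
is of the form `[C, A]` vanishes. -/
theorem eq_zero_of_commutator {H : Type*} [NormedAddCommGroup H] [InnerProductSpace ℂ H]
    [FiniteDimensional ℂ H] {A B C : H →ₗ[ℂ] H}
    (hskew : ∀ v w, inner ℂ v (B w) + inner ℂ (B v) w = 0) (hAB : ∀ v, A (B v) = B (A v))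
    (hC : ∀ v, C (A v) = A (C v) + B v) : B = 0 := by
  have h1 : LinearMap.trace ℂ H (B * B) = 0 := by
    have hB : B = C * A - A * C := by
      ext v
      simp [hC v]
    -- With `B` commuting past `A`, the square of `B` becomes a commutator of `A` and `C B` up to
    -- sign, so its trace vanishes.
    have h2 : B * B = C * (B * A) - A * (C * B) := by
      have h3 : A * B = B * A := LinearMap.ext hAB
      calc B * B = (C * A - A * C) * B := by rw [← hB]
        _ = _ := by rw [sub_mul, mul_assoc, mul_assoc, h3]
    rw [h2, map_sub, LinearMap.trace_mul_comm ℂ A, mul_assoc, sub_self]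
  let b := stdOrthonormalBasis ℂ H
  rw [LinearMap.trace_eq_sum_inner _ b] at h1
  -- By skewness the diagonal entries of `B²` are `-‖B b_i‖²`; a vanishing sum kills each of them.
  have h2 : ∀ i, inner ℂ (b i) ((B * B) (b i)) = -((‖B (b i)‖ ^ 2 : ℝ) : ℂ) := fun i => by
    have := hskew (b i) (B (b i))
    rw [inner_self_eq_norm_sq_to_K] at this
    rw [Module.End.mul_apply]
    push_cast
    exact eq_neg_of_add_eq_zero_left this
  simp only [h2, Finset.sum_neg_distrib, neg_eq_zero] at h1
  rw [← Complex.ofReal_sum, Complex.ofReal_eq_zero,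
    Finset.sum_eq_zero_iff_of_nonneg fun i _ => sq_nonneg _] at h1
  refine b.toBasis.ext fun i => ?_
  simpa using h1 i (Finset.mem_univ i)

variable {m : ℝ} {r : ℕ} {E : momentumSpace m → Type*} [TopologicalSpace (TotalSpace (Fiber r) E)]
  [∀ k, NormedAddCommGroup (E k)] [∀ k, InnerProductSpace ℂ (E k)]
  [FiberBundle (Fiber r) E] [VectorBundle ℂ (Fiber r) E] [VectorBundle ℝ (Fiber r) E]
  [ContMDiffVectorBundle ∞ (Fiber r) E 𝓘(ℝ, E3)]

theorem finiteDimensional_fiber (r : ℕ) {E : momentumSpace m → Type*}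
    [TopologicalSpace (TotalSpace (Fiber r) E)] [∀ k, NormedAddCommGroup (E k)]
    [∀ k, InnerProductSpace ℂ (E k)] [FiberBundle (Fiber r) E] [VectorBundle ℂ (Fiber r) E]
    (k : momentumSpace m) : FiniteDimensional ℂ (E k) :=
  LinearEquiv.finiteDimensional ((trivializationAt (Fiber r) E k).continuousLinearEquivAt ℂ k
    (mem_baseSet_trivializationAt (Fiber r) E k)).symm.toLinearEquiv

namespace ParticleBundle

variable (S : ParticleBundle m r E)

/-! ## The commutation relations of the angular momentum -/

/-- `J_a` is itself a derivative, so differentiating through it is an interchange of two parameter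
derivatives. The result lets the covariance law of `J` be differentiated in the rotation. -/
theorem hasDerivAt_J_rep (a b : Fin 3) {ψ : ∀ k, E k} (hψ : SmoothSection r ψ)
    (k : momentumSpace m) :
    HasDerivAt (fun t => S.J a (S.rep (rotation (axisRotation b t)) ψ) k)
      (-Complex.I • S.J a (S.J b ψ) k) 0 := by
  have hfam : IsSmoothFamily fun p : ℝ × ℝ =>
      rotation (axisRotation a p.1) * rotation (axisRotation b p.2) :=
    ((isSmoothFamily_axisRotation a).comp contDiff_fst).mul
      ((isSmoothFamily_axisRotation b).comp contDiff_snd)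
  have h1 := (hasDerivAt_deriv_comm (S.contDiff_rep hfam hψ k)).const_smul Complex.I
  simp only [rep_mul] at h1
  have h2 : ∀ s, deriv (fun t => S.rep (rotation (axisRotation a s))
      (S.rep (rotation (axisRotation b t)) ψ) k) 0
      = -Complex.I • S.rep (rotation (axisRotation a s)) (S.J b ψ) k := by
    intro s
    have h3 := (((S.act (rotation (axisRotation a s)) (smul_inv_smul _
      k)).toContinuousLinearEquiv.toContinuousLinearMap.restrictScalars
      ℝ).hasFDerivAt).comp_hasDerivAt (0 : ℝ) (S.hasDerivAt_rep_axisRotation b hψ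
      ((rotation (axisRotation a s))⁻¹ • k))
    exact h3.deriv.trans (map_smul (S.act (rotation (axisRotation a s)) _) _ _)
  have h4 : deriv (fun s => -Complex.I • S.rep (rotation (axisRotation a s)) (S.J b ψ) k) 0
      = -Complex.I • -Complex.I • S.J a (S.J b ψ) k :=
    ((S.hasDerivAt_rep_axisRotation a (S.smoothSection_J b hψ) k).const_smul (-Complex.I)).deriv
  simp only [h2, h4] at h1
  convert! h1 using 1
  match_scalars
  linear_combination (-Complex.I) * Complex.I_sq

/-- `[J_a, J_b] = i ε_{abc} J_c`. -/
theorem J_comm (a b : Fin 3) {ψ : ∀ k, E k} (hψ : SmoothSection r ψ) (k : momentumSpace m) :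
    S.J a (S.J b ψ) k - S.J b (S.J a ψ) k = Complex.I • ∑ c, eps a b c • S.J c ψ k := by
  have h1 := S.hasDerivAt_rep_axisRotation b (S.smoothSection_J a hψ) k
  have h2 : HasDerivAt (fun t => ∑ c, (((axisRotation b t).1 c a : ℝ) : ℂ) •
      S.J c (S.rep (rotation (axisRotation b t)) ψ) k) _ 0 :=
    HasDerivAt.fun_sum fun c _ =>
      (hasDerivAt_axisRotation b c a).ofReal_comp.smul (S.hasDerivAt_J_rep c b hψ k)
  -- By covariance this sum is the rotated section `J_a ψ`, whose derivative is `h1`; comparing the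
  -- two gives the commutator.
  simp only [← S.rep_rotation_J _ _ hψ] at h2
  have h3 := h1.unique h2
  simp only [axisRotation_zero, rotation_one, rep_one, skew_single_eq_neg_eps] at h3
  have h4 : ∑ c, ((((1 : Matrix.specialOrthogonalGroup (Fin 3) ℝ).1 c a : ℝ) : ℂ) •
      -Complex.I • S.J c (S.J b ψ) k + -eps a b c • S.J c ψ k)
      = -Complex.I • S.J a (S.J b ψ) k - ∑ c, eps a b c • S.J c ψ k := by
    rw [Finset.sum_add_distrib, Finset.sum_eq_single a]
    · simp [sub_eq_add_neg]
    · intro c _ hc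
      simp [hc]
    · simp
  rw [h4] at h3
  have h5 : ∑ c, eps a b c • S.J c ψ k
      = -Complex.I • S.J a (S.J b ψ) k + Complex.I • S.J b (S.J a ψ) k := by
    linear_combination (norm := module) h3
  rw [h5]
  match_scalars
  · linear_combination Complex.I_sq
  · linear_combination (-1 : ℂ) * Complex.I_sq

/-! ## Stabilizers of momenta -/

/-- The infinitesimal action of a family of transformations which fix `k` on the fiber at `k`. -/
noncomputable def fiberDeriv {g : ℝ → Poincare} (hg : IsSmoothFamily g) {k : momentumSpace m}
    (hk : ∀ t, g t • k = k) : E k →ₗ[ℂ] E k where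
  toFun v := deriv (fun t => S.act (g t) (hk t) v) 0
  map_add' v w := by
    have h := fun v => ((S.contDiff_act_of_fixed hg hk v).differentiable (by simp) 0)
    simp only [map_add]
    exact deriv_add (h v) (h w)
  map_smul' c v := by
    have h := fun v => ((S.contDiff_act_of_fixed hg hk v).differentiable (by simp) 0)
    simp only [map_smul, RingHom.id_apply]
    exact deriv_const_smul_field c _

theorem hasDerivAt_act {g : ℝ → Poincare} (hg : IsSmoothFamily g) {k : momentumSpace m}
    (hk : ∀ t, g t • k = k) (v : E k) :
    HasDerivAt (fun t => S.act (g t) (hk t) v) (S.fiberDeriv hg hk v) 0 :=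
  ((S.contDiff_act_of_fixed hg hk v).differentiable (by simp) 0).hasDerivAt

theorem act_congr {g h : Poincare} (e : g = h) {k k' : momentumSpace m} (hg : g • k = k')
    (hh : h • k = k') (v : E k) : S.act g hg v = S.act h hh v := by
  subst e
  rfl

theorem act_eq_self_of_eq_one {g : Poincare} (e : g = 1) {k : momentumSpace m} (hg : g • k = k)
    (v : E k) : S.act g hg v = v := by
  subst e
  exact S.act_one hg v

/-- Near the identity a product differentiates to a sum: the derivative of the two-parameter action
at the origin is linear and is read off on the axes. -/
theorem hasDerivAt_act_comp {n₁ n₂ : ℝ → Poincare} (h₁ : IsSmoothFamily n₁)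
    (h₂ : IsSmoothFamily n₂) {k : momentumSpace m} (hk₁ : ∀ t, n₁ t • k = k)
    (hk₂ : ∀ t, n₂ t • k = k) (h₁0 : n₁ 0 = 1) (h₂0 : n₂ 0 = 1) (α β : ℝ) (v : E k) :
    HasDerivAt (fun s => S.act (n₁ (α * s)) (hk₁ _) (S.act (n₂ (β * s)) (hk₂ _) v))
      ((α : ℂ) • S.fiberDeriv h₁ hk₁ v + (β : ℂ) • S.fiberDeriv h₂ hk₂ v) 0 := by
  have hfam : IsSmoothFamily fun p : ℝ × ℝ => n₁ p.1 * n₂ p.2 :=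
    (h₁.comp contDiff_fst).mul (h₂.comp contDiff_snd)
  have hk : ∀ p : ℝ × ℝ, (n₁ p.1 * n₂ p.2) • k = k := fun p => by rw [mul_smul, hk₂, hk₁]
  set F := fun p : ℝ × ℝ => S.act (n₁ p.1 * n₂ p.2) (hk p) v with hF
  have hd : HasFDerivAt F (fderiv ℝ F (0, 0)) (0, 0) :=
    ((S.contDiff_act_of_fixed hfam hk v).differentiable (by simp) _).hasFDerivAt
  have hl : fderiv ℝ F (0, 0) (1, 0) = S.fiberDeriv h₁ hk₁ v := by
    have h3 := HasFDerivAt.comp_hasDerivAt (0 : ℝ) (f := fun s : ℝ => (s, (0 : ℝ))) hd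
      ((hasDerivAt_id (0 : ℝ)).prodMk (hasDerivAt_const (0 : ℝ) (0 : ℝ)))
    refine h3.unique ?_
    convert! S.hasDerivAt_act h₁ hk₁ v using 1
    funext t
    exact S.act_congr (by simp [h₂0]) _ _ v
  have hr : fderiv ℝ F (0, 0) (0, 1) = S.fiberDeriv h₂ hk₂ v := by
    have h3 := HasFDerivAt.comp_hasDerivAt (0 : ℝ) (f := fun t : ℝ => ((0 : ℝ), t)) hd
      ((hasDerivAt_const (0 : ℝ) (0 : ℝ)).prodMk (hasDerivAt_id (0 : ℝ)))
    refine h3.unique ?_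
    convert! S.hasDerivAt_act h₂ hk₂ v using 1
    funext t
    exact S.act_congr (by simp [h₁0]) _ _ v
  have hc : HasDerivAt (fun s : ℝ => (α * s, β * s)) (α, β) 0 := by
    simpa using! ((hasDerivAt_id (0 : ℝ)).const_mul α).prodMk ((hasDerivAt_id (0 : ℝ)).const_mul β)
  have h4 := HasFDerivAt.comp_hasDerivAt (0 : ℝ) (f := fun s : ℝ => (α * s, β * s))
    (by simpa using hd) hc
  convert! h4 using 1
  · funext s
    exact (S.act_mul _ _ (hk₂ _) (hk₁ _) _ v).symm
  · have hsplit : ((α, β) : ℝ × ℝ) = α • (1, 0) + β • (0, 1) := by simp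
    rw [hsplit, map_add, map_smul, map_smul, hl, hr, Complex.coe_smul, Complex.coe_smul]

/-- If `n₁`, `n₂` generate translations of a Euclidean plane and `c` the rotations of this plane,
all of which fix the momentum `k`, then the translations act trivially on the fiber at `k`. -/
theorem fiberDeriv_eq_zero {n₁ n₂ c : ℝ → Poincare} (h₁ : IsSmoothFamily n₁)
    (h₂ : IsSmoothFamily n₂) (hc : IsSmoothFamily c) {k : momentumSpace m}
    (hk₁ : ∀ t, n₁ t • k = k) (hk₂ : ∀ t, n₂ t • k = k) (hkc : ∀ t, c t • k = k)
    (h₁0 : n₁ 0 = 1) (h₂0 : n₂ 0 = 1) (hc0 : c 0 = 1)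
    (hcomm : ∀ s t, n₁ s * n₂ t = n₂ t * n₁ s)
    (hrot : ∀ θ s, c θ * n₁ s = n₁ (Real.cos θ * s) * n₂ (Real.sin θ * s) * c θ) :
    S.fiberDeriv h₁ hk₁ = 0 ∧ S.fiberDeriv h₂ hk₂ = 0 := by
  have := finiteDimensional_fiber r (E := E) k
  set A := S.fiberDeriv h₁ hk₁ with hA
  set B := S.fiberDeriv h₂ hk₂ with hB
  set C := S.fiberDeriv hc hkc with hC
  have hlin : ∀ (T : E k →ₗ[ℂ] E k) {f : ℝ → E k} {f' : E k}, HasDerivAt f f' 0 →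
      HasDerivAt (fun t => T (f t)) (T f') 0 := fun T f f' hf =>
    ((LinearMap.toContinuousLinearMap T).restrictScalars ℝ).hasFDerivAt.comp_hasDerivAt 0 hf
  have hact : ∀ (g : Poincare) (hg : g • k = k) {f : ℝ → E k} {f' : E k}, HasDerivAt f f' 0 →
      HasDerivAt (fun t => S.act g hg (f t)) (S.act g hg f') 0 := fun g hg f f' hf =>
    hlin (S.act g hg).toLinearEquiv.toLinearMap hf
  -- The unitary action preserves inner products, so their derivative along the stabilizer is zero.
  have hskew : ∀ v w, inner ℂ v (B w) + inner ℂ (B v) w = 0 := by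
    intro v w
    have h3 := (S.hasDerivAt_act h₂ hk₂ v).inner ℂ (S.hasDerivAt_act h₂ hk₂ w)
    simp only [LinearIsometryEquiv.inner_map_map] at h3
    rw [S.act_eq_self_of_eq_one h₂0, S.act_eq_self_of_eq_one h₂0] at h3
    exact h3.unique (hasDerivAt_const _ _)
  have hB1 : ∀ s v, S.act (n₁ s) (hk₁ s) (B v) = B (S.act (n₁ s) (hk₁ s) v) := by
    intro s v
    refine (hact (n₁ s) (hk₁ s) (S.hasDerivAt_act h₂ hk₂ v)).unique ?_
    convert! S.hasDerivAt_act h₂ hk₂ (S.act (n₁ s) (hk₁ s) v) using 1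
    funext t
    rw [← S.act_mul _ _ _ _ (by simp only [mul_smul, hk₁, hk₂]),
      ← S.act_mul _ _ _ _ (by simp only [mul_smul, hk₁, hk₂])]
    exact S.act_congr (hcomm s t) _ _ v
  have hAB : ∀ v, A (B v) = B (A v) := by
    intro v
    refine (S.hasDerivAt_act h₁ hk₁ (B v)).unique ?_
    simp only [hB1]
    exact hlin B (S.hasDerivAt_act h₁ hk₁ v)
  -- Infinitesimal form in `s` of `hrot`: conjugation by `c θ` rotates the pair `(A, B)`.
  have hR : ∀ θ v, S.act (c θ) (hkc θ) (A v) = (Real.cos θ : ℂ) • A (S.act (c θ) (hkc θ) v)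
      + (Real.sin θ : ℂ) • B (S.act (c θ) (hkc θ) v) := by
    intro θ v
    refine (hact (c θ) (hkc θ) (S.hasDerivAt_act h₁ hk₁ v)).unique ?_
    convert! S.hasDerivAt_act_comp h₁ h₂ hk₁ hk₂ h₁0 h₂0 (Real.cos θ) (Real.sin θ)
      (S.act (c θ) (hkc θ) v) using 1
    funext s
    rw [← S.act_mul _ _ _ _ (by simp only [mul_smul, hk₁, hkc]),
      ← S.act_mul _ _ _ _ (by simp only [mul_smul, hk₁, hk₂]),
      ← S.act_mul _ _ _ _ (by simp only [mul_smul, hk₁, hk₂, hkc])]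
    exact S.act_congr (by rw [hrot, mul_assoc]) _ _ v
  -- The derivative of `hR` at `θ = 0` is the relation `[C, A] = B`.
  have hCA : ∀ v, C (A v) = A (C v) + B v := by
    intro v
    refine (S.hasDerivAt_act hc hkc (A v)).unique ?_
    simp only [hR]
    have h5 := S.hasDerivAt_act hc hkc v
    have h6 := ((Real.hasDerivAt_cos 0).ofReal_comp.smul (hlin A h5)).add
      ((Real.hasDerivAt_sin 0).ofReal_comp.smul (hlin B h5))
    convert! h6 using 1
    rw [S.act_eq_self_of_eq_one hc0]
    simp [hC]
  have hB0 : B = 0 := eq_zero_of_commutator hskew hAB hCA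
  refine ⟨LinearMap.ext fun v => ?_, hB0⟩
  -- A quarter turn carries `A` to `B`; since `B = 0` and the action is injective, `A` vanishes too.
  have h7 := hR (Real.pi / 2) v
  rw [hB0] at h7
  simpa using h7

end ParticleBundle

end Particle

namespace Particle

open Bundle

variable {m : ℝ} {r : ℕ} {E : momentumSpace m → Type*} [TopologicalSpace (TotalSpace (Fiber r) E)]
  [∀ k, NormedAddCommGroup (E k)] [∀ k, InnerProductSpace ℂ (E k)]
  [FiberBundle (Fiber r) E] [VectorBundle ℂ (Fiber r) E] [VectorBundle ℝ (Fiber r) E]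
  [ContMDiffVectorBundle ∞ (Fiber r) E 𝓘(ℝ, E3)]

/-! ## Massless particles: the null rotations act trivially -/

theorem energy_of_massless (hm : m = 0) (k : momentumSpace m) : energy k = ‖k.1‖ := by
  subst hm
  simp [energy]

theorem nullRotation_smul {k : momentumSpace m} (h0 : k.1 0 = 0) (h1 : k.1 1 = 0)
    (h2 : k.1 2 = energy k) (s t : ℝ) : nullRotation s t • k = k := by
  refine fourMomentum_injective ?_
  rw [fourMomentum_smul, nullRotation_mat]
  ext i
  rcases i with i | i <;> (try fin_cases i) <;>
  · simp [Matrix.mulVec, dotProduct, Fintype.sum_sum_type, Fin.sum_univ_three, fourMomentum,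
      h0, h1, h2]
    try ring

theorem axisRotation_two_smul {k : momentumSpace m} (h0 : k.1 0 = 0) (h1 : k.1 1 = 0) (θ : ℝ) :
    rotation (axisRotation 2 θ) • k = k := by
  refine Subtype.ext (PiLp.ext fun b => ?_)
  rw [rotation_smul_val, Fin.sum_univ_three]
  fin_cases b <;> simp [axisRotation, axisRotationMatrix, h0, h1]

/-- Conjugating by a rotation keeps the form boost times rotation, so the generators remain
computable when the null direction is turned into `k`. -/
theorem rotation_conj (R : Matrix.specialOrthogonalGroup (Fin 3) ℝ) (u v : Fin 3 → ℝ) :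
    rotation R * (pureBoost u * rotation (rodrigues v)) * (rotation R)⁻¹
      = pureBoost (R.1 *ᵥ u) * rotation (rodrigues (R.1 *ᵥ v)) := by
  rw [← mul_assoc, rotation_mul_pureBoost, mul_assoc (pureBoost _), ← rotation_mul, mul_rodrigues,
    rotation_mul, mul_assoc, mul_assoc, mul_inv_cancel, mul_one]

theorem nullRotation_zero : nullRotation 0 0 = 1 := by
  have h := nullRotation_mul 0 0 0 0
  rw [add_zero, mul_eq_right] at h
  exact h

namespace ParticleBundle

variable (S : ParticleBundle m r E)

/-- On massless particles of momentum `k`, the generators of the null rotations around `k`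
vanish. -/
theorem null_generators (hm : m = 0) (k : momentumSpace m)
    (R : Matrix.specialOrthogonalGroup (Fin 3) ℝ) (hR : ∀ i, R.1 i 2 = k.1 i / ‖k.1‖)
    {ψ : ∀ k, E k} (hψ : SmoothSection r ψ) :
    (∑ a, (R.1 a 0 : ℂ) • S.K a ψ k + ∑ a, (R.1 a 1 : ℂ) • S.J a ψ k = 0) ∧
    (∑ a, (R.1 a 1 : ℂ) • S.K a ψ k - ∑ a, (R.1 a 0 : ℂ) • S.J a ψ k = 0) := by
  have hk0 : ‖k.1‖ ≠ 0 := by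
    rw [← energy_of_massless hm]
    exact (energy_pos k).ne'
  -- The third column of `R` is the direction of `k`, so `R⁻¹ k` lies on the positive third axis,
  -- where the little group is explicit.
  have hcoord : ∀ b, ((rotation R)⁻¹ • k).1 b = ‖k.1‖ * (R.1ᵀ * R.1) b 2 := by
    intro b
    rw [← rotation_inv, rotation_smul_val, Matrix.mul_apply, Finset.mul_sum]
    refine Finset.sum_congr rfl fun c _ => ?_
    rw [hR, coe_inv_SO]
    field_simp
  simp only [transpose_mul_self_of_SO] at hcoord
  set k₀ := (rotation R)⁻¹ • k with hk₀
  have c0 : k₀.1 0 = 0 := by simp [hcoord 0]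
  have c1 : k₀.1 1 = 0 := by simp [hcoord 1]
  have c2 : k₀.1 2 = energy k₀ := by
    rw [hcoord 2, hk₀, ← rotation_inv, energy_rotation_smul, energy_of_massless hm]
    simp
  have hfix : ∀ g : Poincare, g • k₀ = k₀ → (rotation R * g * (rotation R)⁻¹) • k = k := by
    intro g hg
    rw [mul_smul, mul_smul, hg, hk₀, smul_inv_smul]
  have hconj : ∀ {g : ℝ → Poincare}, IsSmoothFamily g →
      IsSmoothFamily fun t => rotation R * g t * (rotation R)⁻¹ := fun hg =>
    ((IsSmoothFamily.const _).mul hg).mul (IsSmoothFamily.const _)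
  have hs1 := hconj (isSmoothFamily_nullRotation contDiff_id contDiff_const (g := fun _ => 0))
  have hs2 := hconj (isSmoothFamily_nullRotation contDiff_const contDiff_id (f := fun _ => 0))
  have hf1 := fun s : ℝ => hfix _ (nullRotation_smul c0 c1 c2 s 0)
  have hf2 := fun s : ℝ => hfix _ (nullRotation_smul c0 c1 c2 0 s)
  have hz := S.fiberDeriv_eq_zero hs1 hs2 (hconj (isSmoothFamily_axisRotation 2)) hf1 hf2
    (fun θ => hfix _ (axisRotation_two_smul c0 c1 θ))
    (by simp [nullRotation_zero]) (by simp [nullRotation_zero])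
    (by simp [axisRotation_zero, rotation_one])
    (fun s t => by
      simp only [id, conj_mul, nullRotation_mul]
      simp)
    (fun θ s => by
      simp only [id, conj_mul, axisRotation_mul_nullRotation, nullRotation_mul]
      simp)
  have hmul : ∀ (w : ℝ → Fin 3 → ℝ) (w' : Fin 3 → ℝ), (∀ c, HasDerivAt (fun t => w t c) (w' c) 0) →
      HasDerivAt (fun t => R.1 *ᵥ w t) (R.1 *ᵥ w') 0 := by
    intro w w' hw
    rw [hasDerivAt_pi]
    intro b
    simp only [Matrix.mulVec, dotProduct]
    exact HasDerivAt.fun_sum fun c _ => (hw c).const_mul (R.1 b c)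
  have hrep : ∀ {g : ℝ → Poincare} (hg : IsSmoothFamily g) (hgk : ∀ t, g t • k = k),
      S.fiberDeriv hg hgk = 0 → HasDerivAt (fun t => S.rep (g t) ψ k) 0 0 := by
    intro g hg hgk h0
    have h := S.hasDerivAt_act hg hgk (ψ k)
    rw [h0] at h
    convert! h using 1
    funext t
    exact S.rep_apply_of_smul_eq _ _ (hgk t)
  have hsq : HasDerivAt (fun s : ℝ => s ^ 2 / 2) 0 0 := by
    simpa using! (hasDerivAt_pow 2 (0 : ℝ)).div_const 2
  have hid : HasDerivAt (fun s : ℝ => s) 1 0 := hasDerivAt_id _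
  have hhalf : HasDerivAt (fun s : ℝ => s / 2) (1 / 2) 0 := hid.div_const 2
  have hhalf' : HasDerivAt (fun s : ℝ => s / 2) 2⁻¹ 0 := by simpa using hhalf
  have hz0 : (![0, 0, 0] : Fin 3 → ℝ) = 0 := by
    ext i
    fin_cases i <;> rfl
  have hnhalf : HasDerivAt (fun s : ℝ => -s / 2) (-1 / 2) 0 := hid.neg.div_const 2
  have hzero : HasDerivAt (fun _ : ℝ => (0 : ℝ)) 0 0 := hasDerivAt_const _ _
  -- The derivative of the conjugated null rotations, computed a second way. To first order the
  -- boost vector is `s R e_0` and the Rodrigues vector `-(s/2) R e_1`; the component quadratic in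
  -- `s` does not contribute.
  have e1 := S.hasDerivAt_rep_pureBoost_mul_rodrigues
    (hmul (fun s => ![s, 0, (s ^ 2 + 0 ^ 2) / 2]) ![1, 0, 0] (fun c => by
      fin_cases c <;> simp <;> assumption))
    (hmul (fun s => ![0 / 2, -s / 2, 0]) ![0, -1 / 2, 0] (fun c => by
      fin_cases c <;> simp <;> assumption)) (by simp [hz0]) (by simp [hz0]) hψ k
  have e2 := S.hasDerivAt_rep_pureBoost_mul_rodrigues
    (hmul (fun s => ![0, s, (0 ^ 2 + s ^ 2) / 2]) ![0, 1, 0] (fun c => by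
      fin_cases c <;> simp <;> assumption))
    (hmul (fun s => ![s / 2, -0 / 2, 0]) ![1 / 2, 0, 0] (fun c => by
      fin_cases c <;> simp <;> assumption)) (by simp [hz0]) (by simp [hz0]) hψ k
  simp only [← rotation_conj] at e1 e2
  have g1 := e1.unique (hrep hs1 hf1 hz.1)
  have g2 := e2.unique (hrep hs2 hf2 hz.2)
  simp only [Matrix.mulVec, dotProduct, Fin.sum_univ_three] at g1 g2 ⊢
  simp at g1 g2
  constructor
  · linear_combination (norm := skip) (-Complex.I) • g1
    match_scalars <;> ring_nf <;> simp
  · linear_combination (norm := skip) (-Complex.I) • g2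
    match_scalars <;> ring_nf <;> simp

end ParticleBundle

end Particle

namespace Particle

open Bundle

variable {m : ℝ} {r : ℕ} {E : momentumSpace m → Type*} [TopologicalSpace (TotalSpace (Fiber r) E)]
  [∀ k, NormedAddCommGroup (E k)] [∀ k, InnerProductSpace ℂ (E k)]
  [FiberBundle (Fiber r) E] [VectorBundle ℂ (Fiber r) E] [VectorBundle ℝ (Fiber r) E]
  [ContMDiffVectorBundle ∞ (Fiber r) E 𝓘(ℝ, E3)]

/-! ## The splitting of the angular momentum of a massless particle -/

/-- A component of the velocity vector `k / ω`, which is the direction `k / |k|` if `m = 0`. -/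
noncomputable def velocity (a : Fin 3) (k : momentumSpace m) : ℂ := k.1 a * (energy k : ℂ)⁻¹

theorem smoothFun_velocity (a : Fin 3) : SmoothFun (velocity (m := m) a) :=
  (smoothFun_coord a).mul smoothFun_energy_inv

theorem velocity_of_massless (hm : m = 0) (a : Fin 3) (k : momentumSpace m) :
    velocity a k = ((k.1 a / ‖k.1‖ : ℝ) : ℂ) := by
  rw [velocity, energy_of_massless hm, div_eq_mul_inv]
  push_cast
  rfl

theorem opPhat_eq (hm : m = 0) (a : Fin 3) (ψ : ∀ k, E k) :
    opPhat a ψ = fun k => velocity a k • ψ k := by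
  funext k
  rw [velocity_of_massless hm]
  rfl

theorem sum_unit_sq (hm : m = 0) (k : momentumSpace m) : ∑ a, (k.1 a / ‖k.1‖) ^ 2 = 1 := by
  have h0 : ‖k.1‖ ≠ 0 := by
    rw [← energy_of_massless hm]
    exact (energy_pos k).ne'
  simp only [div_pow]
  rw [← Finset.sum_div, ← EuclideanSpace.real_norm_sq_eq, div_self (pow_ne_zero 2 h0)]

theorem sum_velocity_sq (hm : m = 0) (k : momentumSpace m) :
    ∑ a, velocity a k * velocity a k = 1 := by
  simp only [velocity_of_massless hm, ← pow_two]
  exact_mod_cast sum_unit_sq hm k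

theorem sum_eps_velocity (a b : Fin 3) (k : momentumSpace m) :
    crossProduct (fun b => velocity b k) (Pi.single b 1) a
      = -∑ c, eps a b c * velocity c k := by
  rw [Fin.sum_univ_three]
  fin_cases a <;> fin_cases b <;> simp [eps, cross_apply]

theorem hasDerivAt_velocity_axisRotation (a b : Fin 3) (k : momentumSpace m) :
    HasDerivAt (fun t => velocity a ((rotation (axisRotation b t))⁻¹ • k))
      (-∑ c, eps a b c * velocity c k) 0 := by
  have he : ∀ t, energy ((rotation (axisRotation b t))⁻¹ • k) = energy k := fun t => by
    rw [← rotation_inv, energy_rotation_smul]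
  have h := ((hasDerivAt_axisRotation_inv_smul b k a).ofReal_comp).mul_const (energy k : ℂ)⁻¹
  rw [← sum_eps_velocity]
  convert! h using 1
  · funext t
    rw [velocity, he]
  · fin_cases a <;> fin_cases b <;> simp [velocity, cross_apply]

namespace ParticleBundle

variable (S : ParticleBundle m r E)

theorem J_velocity_smul (a b : Fin 3) {ψ : ∀ k, E k} (hψ : SmoothSection r ψ)
    (k : momentumSpace m) :
    S.J b (fun k => velocity a k • ψ k) k = velocity a k • S.J b ψ k
      - Complex.I • (∑ c, eps a b c * velocity c k) • ψ k := by
  rw [S.J_smul b hψ (hasDerivAt_velocity_axisRotation a b k)]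
  module

theorem J_sub (a : Fin 3) {ψ ζ : ∀ k, E k} (hψ : SmoothSection r ψ) (hζ : SmoothSection r ζ) :
    S.J a (ψ - ζ) = S.J a ψ - S.J a ζ := by
  rw [eq_sub_iff_add_eq, ← S.J_add a (hψ.sub hζ) hζ, sub_add_cancel]

theorem Jperp_apply (a : Fin 3) (ψ : ∀ k, E k) (k : momentumSpace m) :
    S.Jperp a ψ k = -∑ b, ∑ c, (eps a b c * velocity b k) • S.K c ψ k := by
  change -((energy k : ℂ)⁻¹ • opCross opP S.K a ψ k) = _
  simp only [opCross, opP, Finset.sum_apply, Pi.smul_apply, velocity, Finset.smul_sum, smul_smul]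
  congr 1
  refine Finset.sum_congr rfl fun b _ => Finset.sum_congr rfl fun c _ => ?_
  congr 1
  ring

/-- The scalar part of `D_b` is proportional to `k_b` and cancels because `k × k = 0`, for any mass.
-/
theorem L_boostConnection (a : Fin 3) {ψ : ∀ k, E k} (hψ : SmoothSection r ψ) :
    L S.boostConnection a ψ = S.Jperp a ψ := by
  funext k
  have hc : ∀ c, (constField a).cross radialField k c = ∑ b, eps a b c * k.1 b := by
    intro c
    rw [Fin.sum_univ_three]
    change crossProduct (Pi.single a 1) (fun b => (k.1 b : ℂ)) c = _
    fin_cases a <;> fin_cases c <;> simp [eps, cross_apply]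
  change -Complex.I • S.boostConnection _ ψ k = _
  rw [boostConnection_apply, Jperp_apply]
  simp only [S.boostD_apply _ hψ, hc, velocity, Fin.sum_univ_three]
  fin_cases a <;> simp [eps, cross_apply] <;> match_scalars <;> ring_nf <;> simp <;> ring

theorem helicity_apply (hm : m = 0) (ψ : ∀ k, E k) (k : momentumSpace m) :
    S.helicity ψ k = ∑ b, velocity b k • S.J b ψ k := by
  simp only [helicity, opPhat_eq hm, Finset.sum_apply]

theorem smoothSection_helicity (hm : m = 0) {ψ : ∀ k, E k} (hψ : SmoothSection r ψ) :
    SmoothSection r (S.helicity ψ) := by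
  rw [show S.helicity ψ = fun k => ∑ b, velocity b k • S.J b ψ k from
    funext fun k => S.helicity_apply hm ψ k]
  exact SmoothSection.sum _ fun b => (S.smoothSection_J b hψ).smul (smoothFun_velocity b)

theorem helicity_sub (hm : m = 0) {ψ ζ : ∀ k, E k} (hψ : SmoothSection r ψ)
    (hζ : SmoothSection r ζ) : S.helicity (ψ - ζ) = S.helicity ψ - S.helicity ζ := by
  funext k
  simp only [S.helicity_apply hm, S.J_sub _ hψ hζ, Pi.sub_apply, smul_sub,
    Finset.sum_sub_distrib]

/-- An infinitesimal rotation about `n` leaves `n` unchanged: the derivative terms sum to a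
component of `n × n`. -/
theorem helicity_velocity_smul (hm : m = 0) (a : Fin 3) {ψ : ∀ k, E k}
    (hψ : SmoothSection r ψ) (k : momentumSpace m) :
    S.helicity (fun k => velocity a k • ψ k) k = velocity a k • S.helicity ψ k := by
  simp only [S.helicity_apply hm, S.J_velocity_smul a _ hψ, Fin.sum_univ_three]
  fin_cases a <;> simp [eps, cross_apply] <;> module

/-- The scalar product of two vector operators is a scalar: the contributions of `[n_a, J_b]` and
`[J_a, J_b]` cancel by antisymmetry of `ε`. -/
theorem helicity_J (hm : m = 0) (b : Fin 3) {ψ : ∀ k, E k} (hψ : SmoothSection r ψ) :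
    S.helicity (S.J b ψ) = S.J b (S.helicity ψ) := by
  funext k
  have hs : ∀ a, SmoothSection r fun k => velocity a k • S.J a ψ k := fun a =>
    (S.smoothSection_J a hψ).smul (smoothFun_velocity a)
  have h1 : S.helicity ψ = (fun k => velocity 0 k • S.J 0 ψ k)
      + (fun k => velocity 1 k • S.J 1 ψ k) + fun k => velocity 2 k • S.J 2 ψ k := by
    funext k
    rw [S.helicity_apply hm, Fin.sum_univ_three]
    rfl
  rw [h1, S.J_add b ((hs 0).add (hs 1)) (hs 2), S.J_add b (hs 0) (hs 1), S.helicity_apply hm]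
  simp only [Pi.add_apply, S.J_velocity_smul _ _ (S.smoothSection_J _ hψ)]
  have h := fun a => S.J_comm a b hψ k
  simp only [Fin.sum_univ_three] at h ⊢
  rw [sub_eq_iff_eq_add.mp (h 0), sub_eq_iff_eq_add.mp (h 1), sub_eq_iff_eq_add.mp (h 2)]
  fin_cases b <;> simp [eps, cross_apply] <;> module

end ParticleBundle

/-- If `J` and `K` satisfy `K × n = J - (n · J) n` in the plane orthogonal to the third column `n`
of a rotation matrix, they satisfy it in all components. -/
theorem add_cross_eq_of_SO {V : Type*} [AddCommGroup V] [Module ℂ V]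
    (R : Matrix.specialOrthogonalGroup (Fin 3) ℝ) {J K : Fin 3 → V}
    (h1 : ∑ a, (R.1 a 0 : ℂ) • K a + ∑ a, (R.1 a 1 : ℂ) • J a = 0)
    (h2 : ∑ a, (R.1 a 1 : ℂ) • K a - ∑ a, (R.1 a 0 : ℂ) • J a = 0) (a : Fin 3) :
    J a + ∑ b, ∑ c, (eps a b c * (R.1 b 2 : ℂ)) • K c
      = (R.1 a 2 : ℂ) • ∑ b, (R.1 b 2 : ℂ) • J b := by
  -- Expansion of `J` in the orthonormal columns of `R`.
  have hJ : J a = (R.1 a 0 : ℂ) • ∑ b, (R.1 b 0 : ℂ) • J b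
      + (R.1 a 1 : ℂ) • ∑ b, (R.1 b 1 : ℂ) • J b + (R.1 a 2 : ℂ) • ∑ b, (R.1 b 2 : ℂ) • J b := by
    have h : ∀ b, (R.1 a 0 : ℂ) * R.1 b 0 + R.1 a 1 * R.1 b 1 + R.1 a 2 * R.1 b 2
        = if a = b then 1 else 0 := by
      intro b
      have := congrFun (congrFun (mul_transpose_self_of_SO R) a) b
      rw [Matrix.mul_apply, Fin.sum_univ_three, Matrix.one_apply] at this
      simp only [Matrix.transpose_apply] at this
      simpa [apply_ite Complex.ofReal] using congrArg Complex.ofReal this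
    simp only [Finset.smul_sum, ← Finset.sum_add_distrib, smul_smul, ← add_smul, h]
    simp
  -- The third column is the cross product of the first two.
  have hc := fun i => congrFun (congrFun (transpose_eq_adjugate_of_SO R) 2) i
  have c0 := congrArg Complex.ofReal (hc 0)
  have c1 := congrArg Complex.ofReal (hc 1)
  have c2 := congrArg Complex.ofReal (hc 2)
  simp [Matrix.adjugate_fin_three, Matrix.transpose_apply] at c0 c1 c2
  -- The double cross product identity for `(R e_0 × R e_1) × K`.
  have hK : (R.1 a 0 : ℂ) • ∑ b, (R.1 b 1 : ℂ) • K b - (R.1 a 1 : ℂ) • ∑ b, (R.1 b 0 : ℂ) • K b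
      + ∑ b, ∑ c, (eps a b c * (R.1 b 2 : ℂ)) • K c = 0 := by
    simp only [Fin.sum_univ_three, c0, c1, c2]
    fin_cases a <;> simp [eps, cross_apply] <;> module
  linear_combination (norm := module) hJ + hK + (R.1 a 1 : ℂ) • h1 - (R.1 a 0 : ℂ) • h2

namespace ParticleBundle

variable (S : ParticleBundle m r E)

/-- At each momentum, in a frame whose third axis is `n = k/|k|`, vanishing of the null generators
says that the part of `J` orthogonal to `n` is `-n × K`, which is `L`. Only the longitudinal part
remains. -/
theorem spin_boostConnection (hm : m = 0) (a : Fin 3) {ψ : ∀ k, E k} (hψ : SmoothSection r ψ)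
    (k : momentumSpace m) :
    S.spin S.boostConnection a ψ k = velocity a k • S.helicity ψ k := by
  obtain ⟨R, hR⟩ := exists_SO_col_two (fun i => k.1 i / ‖k.1‖) (sum_unit_sq hm k)
  have h := S.null_generators hm k R hR hψ
  have hv : ∀ b, velocity b k = (R.1 b 2 : ℂ) := fun b => by
    rw [velocity_of_massless hm, hR]
  rw [spin, Pi.sub_apply, S.L_boostConnection a hψ, Jperp_apply, sub_neg_eq_add,
    S.helicity_apply hm]
  simp only [hv]
  exact add_cross_eq_of_SO R (J := fun a => S.J a ψ k) (K := fun a => S.K a ψ k) h.1 h.2 a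

theorem spin_boostConnection_eq (hm : m = 0) (a : Fin 3) {ψ : ∀ k, E k}
    (hψ : SmoothSection r ψ) :
    S.spin S.boostConnection a ψ = fun k => velocity a k • S.helicity ψ k :=
  funext fun k => S.spin_boostConnection hm a hψ k

theorem Jpar_eq_spin_boostConnection (hm : m = 0) (a : Fin 3) {ψ : ∀ k, E k}
    (hψ : SmoothSection r ψ) : S.spin S.boostConnection a ψ = S.Jpar a ψ := by
  rw [S.spin_boostConnection_eq hm a hψ, Jpar, opPhat_eq hm]
  exact funext fun k => (S.helicity_velocity_smul hm a hψ k).symm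

theorem smoothSection_spin (hm : m = 0) (a : Fin 3) {ψ : ∀ k, E k} (hψ : SmoothSection r ψ) :
    SmoothSection r (S.spin S.boostConnection a ψ) := by
  rw [S.spin_boostConnection_eq hm a hψ]
  exact (S.smoothSection_helicity hm hψ).smul (smoothFun_velocity a)

theorem L_eq_sub (a : Fin 3) (ψ : ∀ k, E k) :
    L S.boostConnection a ψ = S.J a ψ - S.spin S.boostConnection a ψ := by
  rw [spin, sub_sub_cancel]

/-! ### Commutation relations of the two parts of the angular momentum -/

theorem isVectorOperator_J : S.IsVectorOperator S.J := by
  intro a b ψ hψ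
  funext k
  simpa using! S.J_comm a b hψ k

theorem isVectorOperator_spin (hm : m = 0) : S.IsVectorOperator (S.spin S.boostConnection) := by
  intro a b ψ hψ
  have hχ := S.smoothSection_helicity hm hψ
  rw [S.spin_boostConnection_eq hm a (S.smoothSection_J b hψ), S.spin_boostConnection_eq hm a hψ]
  funext k
  simp only [Pi.sub_apply, Pi.smul_apply, Pi.add_apply, S.helicity_J hm b hψ,
    S.J_velocity_smul a b hχ, S.spin_boostConnection hm _ hψ, Fin.sum_univ_three]
  module

theorem isVectorOperator_L (hm : m = 0) : S.IsVectorOperator (L S.boostConnection) := by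
  intro a b ψ hψ
  have h1 := S.isVectorOperator_J a b ψ hψ
  have h2 := S.isVectorOperator_spin hm a b ψ hψ
  simp only [L_eq_sub, S.J_sub b (S.smoothSection_J a hψ) (S.smoothSection_spin hm a hψ),
    smul_sub, Finset.sum_sub_distrib]
  linear_combination (norm := module) h1 - h2

/-- Since `χ` commutes with multiplication by `n`, both products equal `n_a n_b χ²`. -/
theorem spin_comm (hm : m = 0) (a b : Fin 3) {ψ : ∀ k, E k} (hψ : SmoothSection r ψ) :
    S.spin S.boostConnection a (S.spin S.boostConnection b ψ)
      - S.spin S.boostConnection b (S.spin S.boostConnection a ψ) = 0 := by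
  have hχ := S.smoothSection_helicity hm hψ
  rw [S.spin_boostConnection_eq hm a (S.smoothSection_spin hm b hψ),
    S.spin_boostConnection_eq hm b (S.smoothSection_spin hm a hψ),
    S.spin_boostConnection_eq hm a hψ, S.spin_boostConnection_eq hm b hψ]
  funext k
  simp only [Pi.sub_apply, Pi.zero_apply, S.helicity_velocity_smul hm _ hχ]
  module

theorem spin_sub (hm : m = 0) (a : Fin 3) {ψ ζ : ∀ k, E k} (hψ : SmoothSection r ψ)
    (hζ : SmoothSection r ζ) : S.spin S.boostConnection a (ψ - ζ)
      = S.spin S.boostConnection a ψ - S.spin S.boostConnection a ζ := by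
  rw [S.spin_boostConnection_eq hm a (hψ.sub hζ), S.helicity_sub hm hψ hζ,
    S.spin_boostConnection_eq hm a hψ, S.spin_boostConnection_eq hm a hζ]
  funext k
  exact smul_sub _ _ _

/-- Expand the commutator of `J - S`: the term `[J, J]` gives `J`, each mixed term gives `-S`, and
`[S, S] = 0`. The total is `J - 2S = L - S`. -/
theorem L_comm (hm : m = 0) (a b : Fin 3) {ψ : ∀ k, E k} (hψ : SmoothSection r ψ) :
    L S.boostConnection a (L S.boostConnection b ψ)
      - L S.boostConnection b (L S.boostConnection a ψ)
      = Complex.I • ∑ c, eps a b c • (L S.boostConnection c ψ - S.spin S.boostConnection c ψ) := by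
  have hJ := fun a => S.smoothSection_J a hψ
  have hs := fun a => S.smoothSection_spin hm a hψ
  have h1 := S.isVectorOperator_J a b ψ hψ
  have h2 := S.isVectorOperator_spin hm a b ψ hψ
  have h3 := S.isVectorOperator_spin hm b a ψ hψ
  have h4 := S.spin_comm hm a b hψ
  have h5 : ∀ c, eps b a c = -eps a b c := fun c => by
    fin_cases a <;> fin_cases b <;> fin_cases c <;> simp [eps, cross_apply]
  simp only [h5, neg_smul, Finset.sum_neg_distrib] at h3
  simp only [L_eq_sub, S.J_sub _ (hJ _) (hs _), S.spin_sub hm _ (hJ _) (hs _), smul_sub,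
    Finset.sum_sub_distrib]
  linear_combination (norm := module) h1 - h2 + h3 + h4

/-- Contraction with `ε` loses nothing, so every component of `S ψ = n χ ψ` vanishes; contracting
with the unit vector `n` recovers `χ ψ`. -/
theorem helicity_eq_zero (hm : m = 0) {ψ : ∀ k, E k} (hψ : SmoothSection r ψ)
    (h : ∀ a b, ∑ c, eps a b c • S.spin S.boostConnection c ψ = 0) : S.helicity ψ = 0 := by
  have h0 : S.spin S.boostConnection 0 ψ = 0 := by
    simpa [Fin.sum_univ_three, eps, cross_apply] using h 1 2
  have h1 : S.spin S.boostConnection 1 ψ = 0 := by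
    simpa [Fin.sum_univ_three, eps, cross_apply] using h 2 0
  have h2 : S.spin S.boostConnection 2 ψ = 0 := by
    simpa [Fin.sum_univ_three, eps, cross_apply] using h 0 1
  funext k
  have hv := fun a => S.spin_boostConnection hm a hψ k
  have e0 := hv 0
  have e1 := hv 1
  have e2 := hv 2
  rw [h0, Pi.zero_apply] at e0
  rw [h1, Pi.zero_apply] at e1
  rw [h2, Pi.zero_apply] at e2
  rw [Pi.zero_apply, ← one_smul ℂ (S.helicity ψ k), ← sum_velocity_sq hm k, Fin.sum_univ_three,
    add_smul, add_smul, mul_smul, mul_smul, mul_smul, ← e0, ← e1, ← e2]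
  simp

theorem not_isAngularMomentum_spin (hm : m = 0)
    (h : ∃ ψ : ∀ k, E k, SmoothSection r ψ ∧ S.helicity ψ ≠ 0) :
    ¬ IsAngularMomentum r (S.spin S.boostConnection) := by
  obtain ⟨ψ, hψ, hne⟩ := h
  refine fun hA => hne (S.helicity_eq_zero hm hψ fun a b => ?_)
  have := hA a b ψ hψ
  rw [S.spin_comm hm a b hψ] at this
  exact (smul_eq_zero.mp this.symm).resolve_left Complex.I_ne_zero

theorem not_isAngularMomentum_L (hm : m = 0)
    (h : ∃ ψ : ∀ k, E k, SmoothSection r ψ ∧ S.helicity ψ ≠ 0) :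
    ¬ IsAngularMomentum r (L S.boostConnection) := by
  obtain ⟨ψ, hψ, hne⟩ := h
  refine fun hA => hne (S.helicity_eq_zero hm hψ fun a b => ?_)
  have := hA a b ψ hψ
  rw [S.L_comm hm a b hψ] at this
  -- The `L` terms cancel against the assumed relation, leaving the same condition on `S` as in the
  -- case of the spin part.
  simp only [smul_sub, Finset.sum_sub_distrib, sub_eq_self] at this
  exact (smul_eq_zero.mp this).resolve_left Complex.I_ne_zero

end ParticleBundle

end Particle

/-! ### The boost connection theorem -/

open Particle Bundle in
theorem theorem5 {m : ℝ} (hm : 0 ≤ m) {r : ℕ} {E : momentumSpace m → Type*}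
    [TopologicalSpace (TotalSpace (Fiber r) E)]
    [∀ k, NormedAddCommGroup (E k)] [∀ k, InnerProductSpace ℂ (E k)]
    [FiberBundle (Fiber r) E] [VectorBundle ℂ (Fiber r) E] [VectorBundle ℝ (Fiber r) E]
    [ContMDiffVectorBundle ∞ (Fiber r) E 𝓘(ℝ, E3)]
    (S : ParticleBundle m r E) :
    (IsConnection r S.boostConnection ∧
      IsAntiHermitian r S.boostConnection ∧
      S.IsRotationallySymmetric S.boostConnection ∧
      ∀ (X : VField m) (ψ : ∀ k, E k), X.Smooth → SmoothSection r ψ → ∀ k,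
        S.boostConnection X ψ k = ∑ a, X k a •
          (-Complex.I • opHinv (S.K a ψ - (Complex.I / 2) • opHinv (opP a ψ)) k)) ∧
    (m = 0 →
      (∀ (a : Fin 3) (ψ : ∀ k, E k), SmoothSection r ψ →
        ParticleBundle.L S.boostConnection a ψ = S.Jperp a ψ ∧
        S.spin S.boostConnection a ψ = S.Jpar a ψ) ∧
      S.IsVectorOperator (ParticleBundle.L S.boostConnection) ∧
      S.IsVectorOperator (S.spin S.boostConnection) ∧
      ((∃ ψ : ∀ k, E k, SmoothSection r ψ ∧ S.helicity ψ ≠ 0) →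
        ¬ IsAngularMomentum r (ParticleBundle.L S.boostConnection) ∧
        ¬ IsAngularMomentum r (S.spin S.boostConnection))) := by
  refine ⟨⟨S.isConnection_boostConnection, S.isAntiHermitian_boostConnection,
    S.isRotationallySymmetric_boostConnection, fun X _ _ hψ k => S.boostConnection_eq X hψ k⟩,
    fun hm0 => ⟨fun a _ hψ => ⟨S.L_boostConnection a hψ, S.Jpar_eq_spin_boostConnection hm0 a hψ⟩,
      S.isVectorOperator_L hm0, S.isVectorOperator_spin hm0, fun h =>
      ⟨S.not_isAngularMomentum_L hm0 h, S.not_isAngularMomentum_spin hm0 h⟩⟩⟩
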